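/- **Theorem 2.2 (BEC).** Let $V\ge 0$ be the sum of a nonnegative locally integrable function and of countably many nonnegative point masses on $(0,1)$, locally finite on $(0,1)$, and let $\gamma\ge 0$. For $N\ge 1$ let $$H=\sum_{i=1}^N\bigl(-\partial_{z_i}^2+V(z_i)\bigr)+\frac{\gamma}{N}\sum_{i<j}\delta(z_i-z_j)$$ on the symmetric wave functions in $L^2([0,1]^N)$, with Dirichlet boundary conditions (the self-adjoint operator given by the closure of the quadratic form on symmetric functions in $C_c^\infty((0,1)^N)$), let $\Psi_0$ be a normalized ground state of $H$, and let $\rho^{(1)}_N$ be its one-particle reduced density matrix, with trace $N$. Let $\psi_0\ge 0$ be the minimizer of $$\mathcal E^{\rm GP}[\psi]=\int_0^1\Bigl\{|\psi'|^2+V|\psi|^2+\frac{\gamma}{2}|\psi|^4\Bigr\}\,dz$$ over $\psi\in H^1_0([0,1])$ with $\int_0^1|\psi|^2=1$, let $h=-\partial_z^2+V+\gamma\psi_0^2-\frac{\gamma}{2}\int_0^1\psi_0^4$ on $L^2([0,1])$ with Dirichlet boundary conditions, let $e_0\le e_1$ be the two lowest eigenvalues of $h$ (counted with multiplicity), and let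 $N_0=\langle\psi_0,\rho^{(1)}_N\psi_0\rangle$. Then $e_0<e_1$, and $$1-\frac{N_0}{N}\le C\,\frac{e_0}{e_1-e_0}\,N^{-1/3}\min\{\gamma^{1/2},\gamma\}$$ with a universal constant $C$ (independent of $N$, $\gamma$ and $V$). Consequently, for fixed $\gamma$ and $V$ there is complete Bose-Einstein condensation: as $N\to\infty$, $\rho^{(1)}_N/N$ converges in trace norm to the projector $|\psi_0\rangle\langle\psi_0|$. -/

import Mathlib

open Set Filter Topology MeasureTheory
open scoped ENNReal NNReal ContDiff InnerProductSpace ComplexConjugate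

noncomputable section

namespace DisorderedBEC

/-! ## The unit interval, the unit cube and their `L²` spaces -/

/-- Lebesgue measure on the unit interval `[0,1]`. -/
def unitMeasure : Measure ℝ := volume.restrict (Icc 0 1)

/-- Lebesgue measure on the unit cube `[0,1]^N`. -/
def cubeMeasure (N : ℕ) : Measure (Fin N → ℝ) := Measure.pi fun _ => unitMeasure

/-- The one-particle Hilbert space `L²([0,1])`. -/
abbrev OneParticle : Type := Lp ℂ 2 unitMeasure

/-- The `N`-particle space `L²([0,1]^N) = L²([0,1])^{⊗N}`. -/
abbrev ManyParticle (N : ℕ) : Type := Lp ℂ 2 (cubeMeasure N)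

instance isProbabilityMeasure_unitMeasure : IsProbabilityMeasure unitMeasure :=
  ⟨by simp [unitMeasure]⟩

instance isProbabilityMeasure_cubeMeasure (N : ℕ) : IsProbabilityMeasure (cubeMeasure N) := by
  unfold cubeMeasure; infer_instance

/-! ## The external potential -/

/-- The external potentials on the open interval `(0,1)`: the sum of a nonnegative locally
integrable function and of (countably many) point masses `c i • δ_{a i}`, `c i ≥ 0`.
The potential is viewed as a measure, and it is locally finite on `(0,1)` (for the point masses
this says that the series `∑ c i • δ_{a i}` makes sense as a distribution on `(0,1)`). -/
structure IsPotential (V : Measure ℝ) : Prop where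
  exists_eq : ∃ (f : ℝ → ℝ) (c : ℕ → ℝ≥0) (a : ℕ → ℝ),
    (∀ x, 0 ≤ f x) ∧ LocallyIntegrableOn f (Ioo 0 1) ∧
    V = (volume.withDensity (fun x => ENNReal.ofReal (f x)) +
      Measure.sum fun i => c i • Measure.dirac (a i)).restrict (Ioo 0 1)
  lt_top : ∀ K : Set ℝ, IsCompact K → K ⊆ Ioo 0 1 → V K < ⊤

/-! ## The Gross-Pitaevskii functional -/

/-- `H¹₀([0,1])`: absolutely continuous functions with square integrable derivative which vanish
at both end points. (Values outside `[0,1]` are irrelevant; `deriv φ` exists almost everywhere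
on `(0,1)` and is the weak derivative.) -/
structure IsH10 (φ : ℝ → ℂ) : Prop where
  absolutelyContinuous : AbsolutelyContinuousOnInterval φ 0 1
  memLp_deriv : MemLp (deriv φ) 2 unitMeasure
  zero_left : φ 0 = 0
  zero_right : φ 1 = 0

theorem IsH10.memLp {φ : ℝ → ℂ} (h : IsH10 φ) : MemLp φ 2 unitMeasure := by
  have hc : ContinuousOn φ (Icc 0 1) := by
    simpa [uIcc_of_le (zero_le_one : (0 : ℝ) ≤ 1)] using h.absolutelyContinuous.continuousOn
  obtain ⟨C, hC⟩ := isCompact_Icc.exists_bound_of_continuousOn hc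
  refine MemLp.of_bound (hc.aestronglyMeasurable measurableSet_Icc) C ?_
  exact (ae_restrict_iff' measurableSet_Icc).2 (ae_of_all _ hC)

/-- The Gross-Pitaevskii energy
`∫₀¹ |φ'|² + V |φ|² + (γ/2) |φ|⁴`. -/
def gpEnergy (V : Measure ℝ) (γ : ℝ) (φ : ℝ → ℂ) : ℝ≥0∞ :=
  (∫⁻ x, ‖deriv φ x‖ₑ ^ 2 ∂unitMeasure) + (∫⁻ x, ‖φ x‖ₑ ^ 2 ∂V)
    + ENNReal.ofReal (γ / 2) * ∫⁻ x, ‖φ x‖ₑ ^ 4 ∂unitMeasure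

/-- `ψ` is the nonnegative normalized minimizer of the Gross-Pitaevskii functional over
the normalized functions in `H¹₀([0,1])`. -/
structure IsGPMinimizer (V : Measure ℝ) (γ : ℝ) (ψ : ℝ → ℝ) : Prop where
  nonneg : ∀ x ∈ Icc (0 : ℝ) 1, 0 ≤ ψ x
  isH10 : IsH10 fun x => (ψ x : ℂ)
  normalized : ∫⁻ x, ‖(ψ x : ℂ)‖ₑ ^ 2 ∂unitMeasure = 1
  minimal : ∀ φ : ℝ → ℂ, IsH10 φ → ∫⁻ x, ‖φ x‖ₑ ^ 2 ∂unitMeasure = 1 →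
    gpEnergy V γ (fun x => (ψ x : ℂ)) ≤ gpEnergy V γ φ

/-- The Gross-Pitaevskii minimizer as an element of `L²([0,1])`. -/
def IsGPMinimizer.state {V : Measure ℝ} {γ : ℝ} {ψ : ℝ → ℝ} (h : IsGPMinimizer V γ ψ) :
    OneParticle :=
  h.isH10.memLp.toLp _

/-! ## The mean-field Hamiltonian `h = -∂² + V + γ ψ² - (γ/2) ∫ ψ⁴` -/

/-- The form domain of `-∂² + V` (and of `h`): functions in `H¹₀([0,1])` with `∫ V |φ|² < ∞`. -/
structure InFormDomain (V : Measure ℝ) (φ : ℝ → ℂ) : Prop where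
  isH10 : IsH10 φ
  memLp_potential : MemLp φ 2 V

/-- The sesquilinear form `⟨χ, h φ⟩` of the mean-field Hamiltonian. -/
def meanFieldForm (V : Measure ℝ) (γ : ℝ) (ψ : ℝ → ℝ) (χ φ : ℝ → ℂ) : ℂ :=
  (∫ x, conj (deriv χ x) * deriv φ x ∂unitMeasure) + (∫ x, conj (χ x) * φ x ∂V)
    + γ * (∫ x, (ψ x : ℂ) ^ 2 * (conj (χ x) * φ x) ∂unitMeasure)
    - γ / 2 * (∫ x, (ψ x : ℂ) ^ 4 ∂unitMeasure) * ∫ x, conj (χ x) * φ x ∂unitMeasure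

/-- `h φ = E φ`, for the self-adjoint operator `h` defined by the form. -/
structure SolvesEigenEquation (V : Measure ℝ) (γ : ℝ) (ψ : ℝ → ℝ) (E : ℝ) (φ : ℝ → ℂ) :
    Prop where
  inFormDomain : InFormDomain V φ
  eq : ∀ χ : ℝ → ℂ, InFormDomain V χ →
    meanFieldForm V γ ψ χ φ = E * ∫ x, conj (χ x) * φ x ∂unitMeasure

/-- `E` is the eigenvalue number `k` (counted from `0`, in increasing order and with
multiplicity) of the mean-field Hamiltonian: the least real number such that there are `k + 1`
orthonormal eigenfunctions with eigenvalues at most `E`. -/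
def IsMeanFieldEigenvalue (V : Measure ℝ) (γ : ℝ) (ψ : ℝ → ℝ) (k : ℕ) (E : ℝ) : Prop :=
  IsLeast {μ : ℝ | ∃ φ : Fin (k + 1) → ℝ → ℂ,
    (∀ i, ∃ ν ≤ μ, SolvesEigenEquation V γ ψ ν (φ i)) ∧
    ∀ i j, ∫ x, conj (φ i x) * φ j x ∂unitMeasure = if i = j then 1 else 0} E

/-! ## The many-body Hamiltonian and its ground states -/

/-- Bosonic test functions: smooth, compactly supported in the open cube `(0,1)^N` (Dirichlet
boundary conditions) and symmetric under permutations of the particles. -/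
structure IsBosonicTestFunction {N : ℕ} (Φ : (Fin N → ℝ) → ℂ) : Prop where
  contDiff : ContDiff ℝ ∞ Φ
  hasCompactSupport : HasCompactSupport Φ
  tsupport_subset : tsupport Φ ⊆ Set.univ.pi fun _ => Ioo 0 1
  symm : ∀ (s : Equiv.Perm (Fin N)) (z : Fin N → ℝ), Φ (z ∘ s) = Φ z

/-- The energy `⟨Φ, H Φ⟩` of a test function for
`H = ∑ᵢ (-∂ᵢ² + V(zᵢ)) + (γ/N) ∑_{i<j} δ(zᵢ - zⱼ)`, that is
`∑ᵢ ∫ |∂ᵢΦ|² + ∑ᵢ ∫ |Φ|² V(dzᵢ) ∏_{k≠i} dz_k + (γ/N) ∑_{i<j} ∫ |Φ|²|_{zⱼ=zᵢ} ∏_{k≠j} dz_k`.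
In the second (third) term the variable `zᵢ` (`zⱼ`) of the outer integral is overwritten, so that
its integration over `[0,1]` only contributes a factor `1`. -/
def manyBodyEnergy (V : Measure ℝ) (γ : ℝ) {N : ℕ} (Φ : (Fin N → ℝ) → ℂ) : ℝ≥0∞ :=
  (∑ i, ∫⁻ z, ‖fderiv ℝ Φ z (Pi.single i 1)‖ₑ ^ 2 ∂cubeMeasure N)
    + (∑ i, ∫⁻ z, ∫⁻ x, ‖Φ (Function.update z i x)‖ₑ ^ 2 ∂V ∂cubeMeasure N)
    + ENNReal.ofReal (γ / N) *
      ∑ i, ∑ j ∈ Finset.Ioi i, ∫⁻ z, ‖Φ (Function.update z j (z i))‖ₑ ^ 2 ∂cubeMeasure N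

/-- The closed quadratic form of `H` on `L²([0,1]^N)_symm`: the closure of `manyBodyEnergy` on the
bosonic test functions, given as its lower semicontinuous envelope in `L²`. It is `⊤` outside the
form domain, in particular for wave functions that are not symmetric. -/
def closedEnergy (V : Measure ℝ) (γ : ℝ) {N : ℕ} (Ψ : ManyParticle N) : ℝ≥0∞ :=
  ⨅ (Φ : ℕ → (Fin N → ℝ) → ℂ) (_ : ∀ k, IsBosonicTestFunction (Φ k))
    (_ : Tendsto (fun k => eLpNorm (fun z => Φ k z - Ψ z) 2 (cubeMeasure N)) atTop (𝓝 0)),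
    liminf (fun k => manyBodyEnergy V γ (Φ k)) atTop

/-- `Ψ` is a normalized ground state of `H` on the symmetric wave functions. -/
structure IsGroundState (V : Measure ℝ) (γ : ℝ) {N : ℕ} (Ψ : ManyParticle N) : Prop where
  symm : ∀ s : Equiv.Perm (Fin N), (fun z => Ψ (z ∘ s)) =ᵐ[cubeMeasure N] Ψ
  normalized : ‖Ψ‖ = 1
  minimal : ∀ Φ : ManyParticle N, ‖Φ‖ = 1 → closedEnergy V γ Ψ ≤ closedEnergy V γ Φ

/-! ## The one-particle reduced density matrix -/

theorem measurePreserving_cons (n : ℕ) :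
    MeasurePreserving (fun p : ℝ × (Fin n → ℝ) => (Fin.cons p.1 p.2 : Fin (n + 1) → ℝ))
      (unitMeasure.prod (cubeMeasure n)) (cubeMeasure (n + 1)) := by
  have h := (measurePreserving_piFinSuccAbove (fun _ : Fin (n + 1) => unitMeasure) 0).symm
  have he : (fun p : ℝ × (Fin n → ℝ) => (Fin.cons p.1 p.2 : Fin (n + 1) → ℝ))
      = (MeasurableEquiv.piFinSuccAbove (fun _ : Fin (n + 1) => ℝ) 0).symm := by
    funext p
    simp [MeasurableEquiv.piFinSuccAbove, Fin.insertNthEquiv]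
  rw [he]
  exact h

theorem memLp_cons {n : ℕ} (Ψ : ManyParticle (n + 1)) :
    MemLp (fun p : ℝ × (Fin n → ℝ) => Ψ (Fin.cons p.1 p.2)) 2
      (unitMeasure.prod (cubeMeasure n)) :=
  (Lp.memLp Ψ).comp_measurePreserving (measurePreserving_cons n)

/-- The function `z ↦ ∫ conj Ψ(y, z) f(y) dy` of `n` variables. -/
def overlapFun {n : ℕ} (Ψ : ManyParticle (n + 1)) (f : OneParticle) (z : Fin n → ℝ) : ℂ :=
  ∫ y, conj (Ψ (Fin.cons y z)) * f y ∂unitMeasure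

theorem aestronglyMeasurable_integrand {n : ℕ} (Ψ : ManyParticle (n + 1)) (f : OneParticle) :
    AEStronglyMeasurable (fun p : ℝ × (Fin n → ℝ) => conj (Ψ (Fin.cons p.1 p.2)) * f p.1)
      (unitMeasure.prod (cubeMeasure n)) :=
  (Complex.continuous_conj.comp_aestronglyMeasurable (memLp_cons Ψ).1).mul
    (Lp.memLp f).1.comp_fst

theorem aestronglyMeasurable_overlapFun {n : ℕ} (Ψ : ManyParticle (n + 1)) (f : OneParticle) :
    AEStronglyMeasurable (overlapFun Ψ f) (cubeMeasure n) :=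
  (aestronglyMeasurable_integrand Ψ f).prod_swap.integral_prod_right'

theorem ae_memLp_slice {n : ℕ} (Ψ : ManyParticle (n + 1)) :
    ∀ᵐ z ∂cubeMeasure n, MemLp (fun y => Ψ (Fin.cons y z)) 2 unitMeasure := by
  have h := memLp_cons Ψ
  have h2 : Integrable (fun p : ℝ × (Fin n → ℝ) => ‖Ψ (Fin.cons p.1 p.2)‖ ^ 2)
      (unitMeasure.prod (cubeMeasure n)) := h.integrable_norm_pow two_ne_zero
  filter_upwards [h2.swap.prod_right_ae, h.1.prod_swap.prodMk_left] with z hz hm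
  exact (memLp_two_iff_integrable_sq_norm hm).2 hz

theorem ae_integrable_slice {n : ℕ} (Ψ : ManyParticle (n + 1)) :
    ∀ᵐ z ∂cubeMeasure n, ∀ f : OneParticle,
      Integrable (fun y => conj (Ψ (Fin.cons y z)) * f y) unitMeasure := by
  filter_upwards [ae_memLp_slice Ψ] with z hz f
  exact MemLp.integrable_mul (p := 2) (q := 2) hz.star (Lp.memLp f)

theorem enorm_overlapFun_sq_le {n : ℕ} (Ψ : ManyParticle (n + 1)) (f : OneParticle) :
    ∀ᵐ z ∂cubeMeasure n, ‖overlapFun Ψ f z‖ₑ ^ 2 ≤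
      (∫⁻ y, ‖Ψ (Fin.cons y z)‖ₑ ^ 2 ∂unitMeasure) * ‖f‖ₑ ^ 2 := by
  filter_upwards [ae_memLp_slice Ψ] with z hz
  have h1 : ‖overlapFun Ψ f z‖ₑ ≤
      ∫⁻ y, ‖Ψ (Fin.cons y z)‖ₑ * ‖f y‖ₑ ∂unitMeasure := by
    refine (enorm_integral_le_lintegral_enorm _).trans (le_of_eq ?_)
    simp [enorm_mul]
  have h2 := ENNReal.lintegral_mul_le_Lp_mul_Lq unitMeasure
    (Real.HolderConjugate.two_two) hz.1.enorm (Lp.memLp f).1.enorm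
  have h3 : ‖f‖ₑ ^ 2 = ∫⁻ y, ‖f y‖ₑ ^ 2 ∂unitMeasure := by
    rw [Lp.enorm_def, eLpNorm_eq_lintegral_rpow_enorm_toReal two_ne_zero ENNReal.ofNat_ne_top,
      ← ENNReal.rpow_natCast, ← ENNReal.rpow_mul]
    simp
  have h4 := pow_le_pow_left' (h1.trans h2) 2
  have h5 : ∀ a : ℝ≥0∞, (a ^ (1 / (2 : ℝ))) ^ 2 = a := fun a => by
    rw [← ENNReal.rpow_natCast, ← ENNReal.rpow_mul]
    simp
  rw [mul_pow, h5, h5] at h4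
  rw [h3]
  simpa using h4

theorem eLpNorm_overlapFun_le {n : ℕ} (Ψ : ManyParticle (n + 1)) (f : OneParticle) :
    eLpNorm (overlapFun Ψ f) 2 (cubeMeasure n) ≤ ‖Ψ‖ₑ * ‖f‖ₑ := by
  have hΨ : ‖Ψ‖ₑ ^ 2 = ∫⁻ z, ∫⁻ y, ‖Ψ (Fin.cons y z)‖ₑ ^ 2 ∂unitMeasure ∂cubeMeasure n := by
    have h := eLpNorm_comp_measurePreserving (p := 2) (Lp.memLp Ψ).1 (measurePreserving_cons n)
    rw [Lp.enorm_def, ← h,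
      eLpNorm_eq_lintegral_rpow_enorm_toReal two_ne_zero ENNReal.ofNat_ne_top,
      ← ENNReal.rpow_natCast, ← ENNReal.rpow_mul]
    simp only [ENNReal.toReal_ofNat, Nat.cast_ofNat, Function.comp_apply]
    norm_num
    rw [lintegral_prod_symm]
    exact (memLp_cons Ψ).1.enorm.pow_const 2
  have key : eLpNorm (overlapFun Ψ f) 2 (cubeMeasure n) ^ 2 ≤ (‖Ψ‖ₑ * ‖f‖ₑ) ^ 2 := by
    rw [eLpNorm_eq_lintegral_rpow_enorm_toReal two_ne_zero ENNReal.ofNat_ne_top,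
      ← ENNReal.rpow_natCast, ← ENNReal.rpow_mul, mul_pow, hΨ,
      ← lintegral_mul_const' _ _ (by simp)]
    simp only [ENNReal.toReal_ofNat, Nat.cast_ofNat]
    norm_num
    exact lintegral_mono_ae (enorm_overlapFun_sq_le Ψ f)
  exact (ENNReal.pow_le_pow_left_iff two_ne_zero).1 key

theorem memLp_overlapFun {n : ℕ} (Ψ : ManyParticle (n + 1)) (f : OneParticle) :
    MemLp (overlapFun Ψ f) 2 (cubeMeasure n) :=
  ⟨aestronglyMeasurable_overlapFun Ψ f,
    (eLpNorm_overlapFun_le Ψ f).trans_lt (by simp [ENNReal.mul_lt_top_iff])⟩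

/-- The operator `f ↦ (z ↦ ∫ conj Ψ(y, z) f(y) dy)` from `L²([0,1])` to `L²([0,1]^n)`, for a wave
function `Ψ` of `n + 1` particles. -/
def overlap {n : ℕ} (Ψ : ManyParticle (n + 1)) : OneParticle →L[ℂ] ManyParticle n :=
  LinearMap.mkContinuous
    { toFun := fun f => (memLp_overlapFun Ψ f).toLp _
      map_add' := fun f g => by
        rw [← MemLp.toLp_add, MemLp.toLp_eq_toLp_iff]
        filter_upwards [ae_integrable_slice Ψ] with z hz
        rw [Pi.add_apply, overlapFun, overlapFun, overlapFun, ← integral_add (hz f) (hz g)]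
        refine integral_congr_ae ?_
        filter_upwards [Lp.coeFn_add f g] with y hy
        rw [hy, Pi.add_apply, mul_add]
      map_smul' := fun c f => by
        rw [RingHom.id_apply, ← MemLp.toLp_const_smul, MemLp.toLp_eq_toLp_iff]
        refine ae_of_all _ fun z => ?_
        rw [Pi.smul_apply, overlapFun, overlapFun, ← integral_smul]
        refine integral_congr_ae ?_
        filter_upwards [Lp.coeFn_smul c f] with y hy
        rw [hy, Pi.smul_apply, smul_eq_mul, smul_eq_mul, mul_left_comm] }
    ‖Ψ‖ fun f => by
      have h := eLpNorm_overlapFun_le Ψ f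
      have h' := ENNReal.toReal_mono (by simp [ENNReal.mul_eq_top]) h
      simpa [Lp.norm_toLp] using h'

/-- The one-particle reduced density matrix `ρ⁽¹⁾` of a wave function `Ψ` of `N = n + 1` particles
(of trace `N` if `‖Ψ‖ = 1`), that is, the operator with integral kernel
`N ∫ Ψ(x, z₂, …, z_N) conj Ψ(y, z₂, …, z_N) dz₂ ⋯ dz_N`. -/
def reducedDensityMatrix {n : ℕ} (Ψ : ManyParticle (n + 1)) : OneParticle →L[ℂ] OneParticle :=
  ((n + 1 : ℕ) : ℂ) • (ContinuousLinearMap.adjoint (overlap Ψ)).comp (overlap Ψ)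

/-- The average occupancy `tr ρ |φ⟩⟨φ| = ⟨φ, ρ φ⟩` of a one-particle state `φ`. -/
def occupancy (ρ : OneParticle →L[ℂ] OneParticle) (φ : OneParticle) : ℝ :=
  (⟪φ, ρ φ⟫_ℂ).re

/-- The orthogonal projector `|φ⟩⟨φ|` on a normalized one-particle state. -/
def projector (φ : OneParticle) : OneParticle →L[ℂ] OneParticle :=
  InnerProductSpace.rankOne ℂ φ φ

/-- The trace norm `tr |T|`, `|T| = (T* T)^{1/2}`, in `[0,∞]`; the trace of the positive operator
`|T|` is the supremum of `∑ᵢ ⟨eᵢ, |T| eᵢ⟩` over all finite orthonormal families. -/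
def traceNorm {E : Type*} [NormedAddCommGroup E] [InnerProductSpace ℂ E] [CompleteSpace E]
    (T : E →L[ℂ] E) : ℝ≥0∞ :=
  ⨆ (m : ℕ) (e : Fin m → E) (_ : Orthonormal ℂ e),
    ∑ i, ENNReal.ofReal (⟪e i, CFC.abs T (e i)⟫_ℂ).re

end DisorderedBEC

end

open DisorderedBEC

/-!
The proof compares the `N`-body Hamiltonian `H` with the mean-field Hamiltonian `∑ᵢ hᵢ`, from both
sides, and reads off the number of particles outside the condensate from the spectral gap.

*The mean-field Hamiltonian.* The quartic term of the Gross-Pitaevskii functional is convex in the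
density `|φ|²`, and the kinetic energy satisfies the diamagnetic-type bound `IsH10.sqrt_sq_add_sq`;
hence `ψ₀` is a ground state of `h`, whose lowest eigenvalue `e₀` is the minimal Gross-Pitaevskii
energy (`IsGPMinimizer.le_energyMap`). The second eigenvalue `e₁` is the minimum of the form on the
orthogonal complement of `ψ₀`, which exists because `H¹₀` embeds compactly into `L²`. A function in
the form domain that minimizes the form and vanishes at one point can be cut off there, and then
vanishes identically, so that two ground states are proportional and `e₀ < e₁`
(`IsGPMinimizer.ground_state_unique`). The trial functions `(x - a) ψ₀` and the uncertainty principle give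
`e₁ - e₀ ≤ 4 e₀`. All this is summarized in `IsGPMinimizer.exists_gap`.

*Lower bound on `H`.* The interval is divided into `M` cells. Since `|φ(x) - φ(z)|²` is at most
`|x - z|` times the kinetic energy between `x` and `z`, a fraction of the kinetic energy allows one
to replace the delta interaction by `M` times the indicator function of pairs in the same cell, and
the density `ψ₀²` by its averages over the cells. The smeared interaction is positive definite:
completing a square in each cell bounds it below by the mean-field interaction, up to the
self-interaction `γ M / 2` of the particles (`sum_sameCell_ge`). With the gap inequality for `h` in
each variable this gives `IsBosonicTestFunction.le_manyBodyEnergy`, and by semicontinuity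
`le_closedEnergy`: the energy is at least `N e₀ + (e₁ - e₀) (N - N₀)`, up to errors of relative order
`N^{-1/3} min{γ^{1/2}, γ}` if `M ∼ N^{2/3}`.

*Upper bound on `H`.* Product states of smooth compactly supported approximations of `ψ₀` have
energy at most `N (e₀ + ε)` (`IsGroundState.closedEnergy_le`). The two bounds together are
`IsGroundState.depletion_le`; if the error terms are not small, the trivial bound `1 - N₀ / N ≤ 1`
and `e₁ - e₀ ≤ 4 e₀` suffice.

*Trace norm.* The operator `T = ρ / N - |ψ₀⟩⟨ψ₀|` has trace at most zero, so that its trace norm is at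
most twice the trace of its negative part. Since `T ≥ -|ψ₀⟩⟨ψ₀|`, the negative part has rank at most
one, and its norm is controlled by the depletion (`traceNorm_le`,
`traceNorm_reducedDensityMatrix_sub_le`).
-/

noncomputable section

namespace DisorderedBEC

/-! ### Absolutely continuous functions and `H¹₀` -/

section

theorem absolutelyContinuous_of_dist_le {X Y : Type*} [PseudoMetricSpace X] [PseudoMetricSpace Y]
    {f : ℝ → X} {g : ℝ → Y} {a b : ℝ} (hf : AbsolutelyContinuousOnInterval f a b)
    (C : ℝ) (h : ∀ x ∈ uIcc a b, ∀ y ∈ uIcc a b, dist (g x) (g y) ≤ C * dist (f x) (f y)) :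
    AbsolutelyContinuousOnInterval g a b := by
  unfold AbsolutelyContinuousOnInterval at hf ⊢
  have hC := hf.const_mul C
  rw [mul_zero] at hC
  refine squeeze_zero' (Eventually.of_forall fun E => Finset.sum_nonneg fun _ _ => dist_nonneg)
    ?_ hC
  have : ∀ᶠ E in AbsolutelyContinuousOnInterval.totalLengthFilter ⊓
      𝓟 (AbsolutelyContinuousOnInterval.disjWithin a b),
      E ∈ AbsolutelyContinuousOnInterval.disjWithin a b :=
    eventually_inf_principal.mpr (by simp)
  filter_upwards [this] with E hE
  rw [Finset.mul_sum]
  refine Finset.sum_le_sum fun i hi => ?_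
  have := hE.1 i hi
  exact h _ this.1 _ this.2

theorem absolutelyContinuous_re {f : ℝ → ℂ} {a b : ℝ} (h : AbsolutelyContinuousOnInterval f a b) :
    AbsolutelyContinuousOnInterval (fun x => (f x).re) a b := by
  refine absolutelyContinuous_of_dist_le h 1 fun x _ y _ => ?_
  rw [one_mul, Complex.dist_eq, Real.dist_eq, ← Complex.sub_re]
  exact Complex.abs_re_le_norm _

theorem absolutelyContinuous_im {f : ℝ → ℂ} {a b : ℝ} (h : AbsolutelyContinuousOnInterval f a b) :
    AbsolutelyContinuousOnInterval (fun x => (f x).im) a b := by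
  refine absolutelyContinuous_of_dist_le h 1 fun x _ y _ => ?_
  rw [one_mul, Complex.dist_eq, Real.dist_eq, ← Complex.sub_im]
  exact Complex.abs_im_le_norm _

theorem ae_unitMeasure_iff {p : ℝ → Prop} :
    (∀ᵐ x ∂unitMeasure, p x) ↔ ∀ᵐ x, x ∈ Ioo (0 : ℝ) 1 → p x := by
  rw [unitMeasure, Measure.restrict_congr_set Ioo_ae_eq_Icc.symm,
    ae_restrict_iff' measurableSet_Ioo]

theorem ae_mem_Ioo : ∀ᵐ x ∂unitMeasure, x ∈ Ioo (0 : ℝ) 1 :=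
  ae_unitMeasure_iff.2 (ae_of_all _ fun _ h => h)

theorem absolutelyContinuous_ae_differentiableAt {f : ℝ → ℂ}
    (h : AbsolutelyContinuousOnInterval f 0 1) :
    ∀ᵐ x ∂unitMeasure, DifferentiableAt ℝ f x := by
  rw [ae_unitMeasure_iff]
  filter_upwards [(absolutelyContinuous_re h).ae_differentiableAt,
    (absolutelyContinuous_im h).ae_differentiableAt] with x h1 h2 hx
  have hx' : x ∈ uIcc (0 : ℝ) 1 := by
    rw [uIcc_of_le zero_le_one]; exact Ioo_subset_Icc_self hx
  have h3 := (Complex.ofRealCLM.differentiableAt.comp x (h1 hx')).add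
    ((Complex.ofRealCLM.differentiableAt.comp x (h2 hx')).mul_const Complex.I)
  convert! h3 using 1
  funext y
  simp [Complex.re_add_im]

theorem integral_unitMeasure {E : Type*} [NormedAddCommGroup E] [NormedSpace ℝ E] (f : ℝ → E) :
    ∫ x, f x ∂unitMeasure = ∫ x in (0 : ℝ)..1, f x := by
  rw [unitMeasure, intervalIntegral.integral_of_le zero_le_one, integral_Icc_eq_integral_Ioc]

theorem intervalIntegrable_of_integrable {E : Type*} [NormedAddCommGroup E] {f : ℝ → E}
    (hf : Integrable f unitMeasure) {a b : ℝ} (ha : a ∈ Icc (0 : ℝ) 1) (hb : b ∈ Icc (0 : ℝ) 1) :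
    IntervalIntegrable f volume a b := by
  have h : IntegrableOn f (Icc 0 1) := hf
  rw [intervalIntegrable_iff]
  refine h.mono_set (uIoc_subset_uIcc.trans ?_)
  exact (convex_Icc (0 : ℝ) 1).ordConnected.uIcc_subset ha hb

theorem absolutelyContinuous_primitive {g : ℝ → ℂ} (hg : Integrable g unitMeasure) :
    AbsolutelyContinuousOnInterval (fun x => ∫ t in (0 : ℝ)..x, g t) 0 1 := by
  have h0 : (0 : ℝ) ∈ Icc (0 : ℝ) 1 := by simp
  have h1 : (1 : ℝ) ∈ Icc (0 : ℝ) 1 := by simp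
  have hn := (intervalIntegrable_of_integrable hg.norm h0 h1)
  have := hn.absolutelyContinuousOnInterval_intervalIntegral (c := 0) (by simp)
  refine absolutelyContinuous_of_dist_le this 1 fun x hx y hy => ?_
  rw [uIcc_of_le zero_le_one] at hx hy
  have e1 := intervalIntegrable_of_integrable hg h0 hx
  have e2 := intervalIntegrable_of_integrable hg h0 hy
  have e3 := intervalIntegrable_of_integrable hg.norm h0 hx
  have e4 := intervalIntegrable_of_integrable hg.norm h0 hy
  rw [one_mul, dist_eq_norm, dist_eq_norm, intervalIntegral.integral_interval_sub_left e1 e2,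
    intervalIntegral.integral_interval_sub_left e3 e4]
  exact intervalIntegral.norm_integral_le_abs_integral_norm

/-- A function on `[0,1]` which is the primitive of a square integrable function `g` and vanishes
at both end points is in `H¹₀`, with weak derivative `g`. -/
theorem isH10_of_primitive {φ g : ℝ → ℂ} (hg : MemLp g 2 unitMeasure)
    (h : ∀ x ∈ Icc (0 : ℝ) 1, φ x = ∫ t in (0 : ℝ)..x, g t) (h1 : φ 1 = 0) :
    IsH10 φ ∧ deriv φ =ᵐ[unitMeasure] g := by
  have hi : Integrable g unitMeasure := hg.integrable one_le_two
  have hd : deriv φ =ᵐ[unitMeasure] g := by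
    rw [EventuallyEq, ae_unitMeasure_iff]
    filter_upwards [(intervalIntegrable_of_integrable hi (a := 0) (b := 1) (by simp)
      (by simp)).ae_hasDerivAt_integral] with x hx hx'
    have h2 := hx (by rw [uIcc_of_le zero_le_one]; exact Ioo_subset_Icc_self hx') 0 (by simp)
    refine (h2.congr_of_eventuallyEq ?_).deriv
    filter_upwards [Icc_mem_nhds hx'.1 hx'.2] with y hy using h y hy
  refine ⟨⟨?_, hg.ae_eq hd.symm, by simpa using h 0 (by simp), h1⟩, hd⟩
  refine absolutelyContinuous_of_dist_le (absolutelyContinuous_primitive hi) 1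
    fun x hx y hy => ?_
  rw [uIcc_of_le zero_le_one] at hx hy
  rw [h x hx, h y hy, one_mul]

namespace IsH10

variable {φ χ : ℝ → ℂ}

theorem continuousOn (h : IsH10 φ) : ContinuousOn φ (Icc 0 1) := by
  simpa [uIcc_of_le (zero_le_one : (0 : ℝ) ≤ 1)] using h.absolutelyContinuous.continuousOn

theorem ae_differentiableAt (h : IsH10 φ) : ∀ᵐ x ∂unitMeasure, DifferentiableAt ℝ φ x :=
  absolutelyContinuous_ae_differentiableAt h.absolutelyContinuous

theorem integrable_deriv (h : IsH10 φ) : Integrable (deriv φ) unitMeasure :=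
  h.memLp_deriv.integrable one_le_two

theorem eq_integral_deriv (h : IsH10 φ) {x : ℝ} (hx : x ∈ Icc (0 : ℝ) 1) :
    φ x = ∫ t in (0 : ℝ)..x, deriv φ t := by
  have hac := h.absolutelyContinuous.sub (absolutelyContinuous_primitive h.integrable_deriv)
  obtain ⟨C, hC⟩ := hac.const_of_ae_hasDerivAt_zero (by
    have h2 := ae_unitMeasure_iff.1 h.ae_differentiableAt
    have h0 : ∀ᵐ x : ℝ, x ≠ 0 := by simp [ae_iff, measure_singleton]
    have h1 : ∀ᵐ x : ℝ, x ≠ 1 := by simp [ae_iff, measure_singleton]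
    filter_upwards [(intervalIntegrable_of_integrable h.integrable_deriv (a := 0) (b := 1) (by simp)
      (by simp)).ae_hasDerivAt_integral, h2, h0, h1] with x hx hx' hx0 hx1 hxm
    have hxm' := hxm
    rw [uIcc_of_le zero_le_one] at hxm'
    have := (hx' ⟨lt_of_le_of_ne hxm'.1 hx0.symm, lt_of_le_of_ne hxm'.2 hx1⟩).hasDerivAt.sub
      (hx hxm 0 (by simp))
    simpa using this)
  rw [uIcc_of_le zero_le_one] at hC
  have e0 := hC 0 (by simp)
  have ex := hC x hx
  simp only [Pi.sub_apply, intervalIntegral.integral_same, h.zero_left, sub_zero] at e0 ex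
  rw [← e0, sub_eq_zero] at ex
  exact ex

theorem sub_eq_integral_deriv (h : IsH10 φ) {x y : ℝ} (hx : x ∈ Icc (0 : ℝ) 1)
    (hy : y ∈ Icc (0 : ℝ) 1) : φ y - φ x = ∫ t in x..y, deriv φ t := by
  rw [h.eq_integral_deriv hx, h.eq_integral_deriv hy]
  exact intervalIntegral.integral_interval_sub_left
    (intervalIntegrable_of_integrable h.integrable_deriv (by simp) hy)
    (intervalIntegrable_of_integrable h.integrable_deriv (by simp) hx)

theorem add (h : IsH10 φ) (h' : IsH10 χ) :
    IsH10 (φ + χ) ∧ deriv (φ + χ) =ᵐ[unitMeasure] deriv φ + deriv χ :=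
  isH10_of_primitive (h.memLp_deriv.add h'.memLp_deriv) (fun x hx => by
    rw [Pi.add_apply, h.eq_integral_deriv hx, h'.eq_integral_deriv hx]
    exact (intervalIntegral.integral_add
      (intervalIntegrable_of_integrable h.integrable_deriv (by simp) hx)
      (intervalIntegrable_of_integrable h'.integrable_deriv (by simp) hx)).symm)
    (by simp [h.zero_right, h'.zero_right])

theorem smul (c : ℂ) (h : IsH10 φ) :
    IsH10 (c • φ) ∧ deriv (c • φ) =ᵐ[unitMeasure] c • deriv φ :=
  isH10_of_primitive (h.memLp_deriv.const_smul c) (fun x hx => by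
    rw [Pi.smul_apply, h.eq_integral_deriv hx]
    exact (intervalIntegral.integral_smul _ _).symm)
    (by simp [h.zero_right])

theorem zero : IsH10 (0 : ℝ → ℂ) :=
  (isH10_of_primitive (g := 0) MemLp.zero (fun x _ => by simp) rfl).1

end IsH10

theorem sq_integral_norm_le {E : Type*} [NormedAddCommGroup E] {μ : Measure ℝ} [IsFiniteMeasure μ]
    {f : ℝ → E} (hf : MemLp f 2 μ) :
    (∫ x, ‖f x‖ ∂μ) ^ 2 ≤ μ.real univ * ∫ x, ‖f x‖ ^ 2 ∂μ := by
  have h1 : MemLp (fun x => ‖f x‖) (ENNReal.ofReal 2) μ := by simpa using hf.norm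
  have h2 : MemLp (fun _ : ℝ => (1 : ℝ)) (ENNReal.ofReal 2) μ := memLp_const 1
  have := integral_mul_norm_le_Lp_mul_Lq (Real.HolderConjugate.two_two) h2 h1
  simp only [norm_one, one_mul, norm_norm, Real.one_rpow, integral_const, smul_eq_mul,
    mul_one] at this
  have h3 := pow_le_pow_left₀ (integral_nonneg fun x => norm_nonneg (f x)) this 2
  refine h3.trans (le_of_eq ?_)
  rw [mul_pow, ← Real.sqrt_eq_rpow, ← Real.sqrt_eq_rpow, Real.sq_sqrt measureReal_nonneg,
    Real.sq_sqrt (integral_nonneg fun x => by positivity)]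
  simp

theorem norm_sub_sq_le_of_primitive {φ g : ℝ → ℂ} (hg : MemLp g 2 unitMeasure) {x y : ℝ}
    (hx : 0 ≤ x) (hy : y ≤ 1) (hxy : x ≤ y) (h : φ y - φ x = ∫ t in x..y, g t) :
    ‖φ y - φ x‖ ^ 2 ≤ (y - x) * ∫ t in Icc x y, ‖g t‖ ^ 2 := by
  have hm : MemLp g 2 (volume.restrict (Icc x y)) :=
    hg.mono_measure (Measure.restrict_mono (Icc_subset_Icc hx hy) le_rfl)
  have h2 := sq_integral_norm_le hm
  have h3 : ‖φ y - φ x‖ ≤ ∫ t in Icc x y, ‖g t‖ := by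
    rw [h, intervalIntegral.integral_of_le hxy, integral_Icc_eq_integral_Ioc]
    exact norm_integral_le_integral_norm _
  refine (pow_le_pow_left₀ (norm_nonneg _) h3 2).trans (h2.trans (le_of_eq ?_))
  simp [Measure.real, hxy]

namespace IsH10

variable {φ χ : ℝ → ℂ}

theorem norm_sub_sq_le (h : IsH10 φ) {x y : ℝ} (hx : 0 ≤ x) (hy : y ≤ 1) (hxy : x ≤ y) :
    ‖φ y - φ x‖ ^ 2 ≤ (y - x) * ∫ t in Icc x y, ‖deriv φ t‖ ^ 2 :=
  norm_sub_sq_le_of_primitive h.memLp_deriv hx hy hxy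
    (h.sub_eq_integral_deriv ⟨hx, hxy.trans hy⟩ ⟨hx.trans hxy, hy⟩)

theorem integrable_norm_deriv_sq (h : IsH10 φ) :
    Integrable (fun x => ‖deriv φ x‖ ^ 2) unitMeasure :=
  h.memLp_deriv.integrable_norm_pow two_ne_zero

theorem norm_sub_sq_le' (h : IsH10 φ) {x y : ℝ} (hx : x ∈ Icc (0 : ℝ) 1) (hy : y ∈ Icc (0 : ℝ) 1) :
    ‖φ y - φ x‖ ^ 2 ≤ |y - x| * ∫ t, ‖deriv φ t‖ ^ 2 ∂unitMeasure := by
  wlog hxy : x ≤ y generalizing x y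
  · rw [norm_sub_rev, abs_sub_comm]; exact this hy hx (le_of_not_ge hxy)
  rw [abs_of_nonneg (sub_nonneg.2 hxy)]
  refine (h.norm_sub_sq_le hx.1 hy.2 hxy).trans ?_
  refine mul_le_mul_of_nonneg_left ?_ (sub_nonneg.2 hxy)
  exact setIntegral_mono_set h.integrable_norm_deriv_sq (ae_of_all _ fun _ => by positivity)
    (ae_of_all _ (Icc_subset_Icc hx.1 hy.2))

theorem norm_sq_le (h : IsH10 φ) {x : ℝ} (hx : x ∈ Icc (0 : ℝ) 1) :
    ‖φ x‖ ^ 2 ≤ ∫ t, ‖deriv φ t‖ ^ 2 ∂unitMeasure := by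
  have := h.norm_sub_sq_le' (x := 0) (by simp) hx
  rw [h.zero_left, sub_zero, sub_zero, abs_of_nonneg hx.1] at this
  refine this.trans ?_
  have h0 : 0 ≤ ∫ t, ‖deriv φ t‖ ^ 2 ∂unitMeasure := integral_nonneg fun _ => by positivity
  nlinarith [hx.2]

/-- A function of class `H¹₀` that vanishes at `a` may be replaced by `0` on `[0,a]`. -/
theorem indicator_Ioi (h : IsH10 φ) {a : ℝ} (ha : a ∈ Icc (0 : ℝ) 1) (hφ : φ a = 0) :
    IsH10 ((Ioi a).indicator φ) ∧
      deriv ((Ioi a).indicator φ) =ᵐ[unitMeasure] (Ioi a).indicator (deriv φ) := by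
  refine isH10_of_primitive (h.memLp_deriv.indicator measurableSet_Ioi) (fun x hx => ?_) ?_
  · rcases le_or_gt x a with hxa | hxa
    · rw [indicator_of_notMem (by simpa using hxa), intervalIntegral.integral_of_le hx.1]
      refine (setIntegral_eq_zero_of_forall_eq_zero fun t ht => ?_).symm
      exact indicator_of_notMem (by simpa using ht.2.trans hxa) _
    · rw [indicator_of_mem (by simpa using hxa), ← sub_zero (φ x), ← hφ,
        h.sub_eq_integral_deriv ha hx, intervalIntegral.integral_of_le hx.1,
        intervalIntegral.integral_of_le hxa.le, setIntegral_indicator measurableSet_Ioi]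
      congr 2
      ext t
      simp only [mem_Ioc, mem_inter_iff, mem_Ioi]
      constructor
      · rintro ⟨h1, h2⟩; exact ⟨⟨ha.1.trans_lt h1, h2⟩, h1⟩
      · rintro ⟨⟨_, h2⟩, h1⟩; exact ⟨h1, h2⟩
  · by_cases h1 : (1 : ℝ) ∈ Ioi a
    · rw [indicator_of_mem h1, h.zero_right]
    · rw [indicator_of_notMem h1]

end IsH10

theorem isH10_of_lipschitz {φ : ℝ → ℂ} {K : ℝ≥0} (h : LipschitzWith K φ) (h0 : φ 0 = 0)
    (h1 : φ 1 = 0) : IsH10 φ :=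
  ⟨(h.lipschitzOnWith).absolutelyContinuousOnInterval,
    MemLp.of_bound (measurable_deriv φ).aestronglyMeasurable K
      (ae_of_all _ fun _ => norm_deriv_le_of_lipschitz h), h0, h1⟩

/-- The diamagnetic-type bound behind the convexity of the kinetic energy in the density: the
pointwise Euclidean norm of two functions of class `H¹₀` is of class `H¹₀`. -/
theorem IsH10.sqrt_sq_add_sq {φ χ : ℝ → ℂ} (h : IsH10 φ) (h' : IsH10 χ) :
    IsH10 (fun x => ((√(‖φ x‖ ^ 2 + ‖χ x‖ ^ 2) : ℝ) : ℂ)) ∧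
      ∀ᵐ x ∂unitMeasure, ‖deriv (fun x => ((√(‖φ x‖ ^ 2 + ‖χ x‖ ^ 2) : ℝ) : ℂ)) x‖ ^ 2 ≤
        ‖deriv φ x‖ ^ 2 + ‖deriv χ x‖ ^ 2 := by
  set F : ℝ → WithLp 2 (ℂ × ℂ) := fun x => WithLp.toLp 2 (φ x, χ x) with hF
  set N : ℝ → ℂ := fun x => ((√(‖φ x‖ ^ 2 + ‖χ x‖ ^ 2) : ℝ) : ℂ) with hN
  have hNF : ∀ x, N x = ((‖F x‖ : ℝ) : ℂ) := fun x => by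
    simp only [hN, hF, WithLp.prod_norm_eq_of_L2]
    rfl
  have hdist : ∀ x y, ‖N x - N y‖ ≤ ‖F x - F y‖ := fun x y => by
    rw [hNF, hNF, ← Complex.ofReal_sub, Complex.norm_real, Real.norm_eq_abs]
    exact abs_norm_sub_norm_le _ _
  have hFn : ∀ x y, ‖F x - F y‖ = √(‖φ x - φ y‖ ^ 2 + ‖χ x - χ y‖ ^ 2) := fun x y => by
    simp only [hF, ← WithLp.toLp_sub, Prod.mk_sub_mk, WithLp.prod_norm_eq_of_L2]
    rfl
  have hac : AbsolutelyContinuousOnInterval N 0 1 := by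
    have h1 : AbsolutelyContinuousOnInterval (fun x => (φ x, χ x)) 0 1 := by
      have e1 := h.absolutelyContinuous
      have e2 := h'.absolutelyContinuous
      unfold AbsolutelyContinuousOnInterval at e1 e2 ⊢
      have e3 := e1.add e2
      rw [add_zero] at e3
      refine squeeze_zero (fun E => Finset.sum_nonneg fun _ _ => dist_nonneg) (fun E => ?_) e3
      rw [← Finset.sum_add_distrib]
      refine Finset.sum_le_sum fun i _ => ?_
      rw [Prod.dist_eq]
      exact max_le_add_of_nonneg dist_nonneg dist_nonneg
    refine absolutelyContinuous_of_dist_le h1 2 fun x _ y _ => ?_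
    rw [dist_eq_norm, dist_eq_norm]
    refine (hdist x y).trans ?_
    rw [hFn]
    have a1 : ‖φ x - φ y‖ ≤ ‖(φ x, χ x) - (φ y, χ y)‖ := by
      exact norm_fst_le ((φ x, χ x) - (φ y, χ y))
    have a2 : ‖χ x - χ y‖ ≤ ‖(φ x, χ x) - (φ y, χ y)‖ := by
      exact norm_snd_le ((φ x, χ x) - (φ y, χ y))
    refine Real.sqrt_le_iff.2 ⟨by positivity, ?_⟩
    nlinarith [norm_nonneg (φ x - φ y), norm_nonneg (χ x - χ y)]
  have hd : ∀ᵐ x ∂unitMeasure, ‖deriv N x‖ ^ 2 ≤ ‖deriv φ x‖ ^ 2 + ‖deriv χ x‖ ^ 2 := by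
    filter_upwards [h.ae_differentiableAt, h'.ae_differentiableAt,
      absolutelyContinuous_ae_differentiableAt hac] with x h1 h2 h3
    have t1 := (hasDerivAt_iff_tendsto_slope.1 h1.hasDerivAt).norm.pow 2
    have t2 := (hasDerivAt_iff_tendsto_slope.1 h2.hasDerivAt).norm.pow 2
    have t3 := (hasDerivAt_iff_tendsto_slope.1 h3.hasDerivAt).norm.pow 2
    refine le_of_tendsto_of_tendsto' t3 (t1.add t2) fun y => ?_
    simp only [slope, vsub_eq_sub, norm_smul, mul_pow]
    rw [← mul_add]
    refine mul_le_mul_of_nonneg_left ?_ (by positivity)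
    have := pow_le_pow_left₀ (norm_nonneg _) (hdist y x) 2
    rwa [hFn, Real.sq_sqrt (by positivity)] at this
  refine ⟨⟨hac, ?_, by simp [hN, h.zero_left, h'.zero_left], by
    simp [hN, h.zero_right, h'.zero_right]⟩, hd⟩
  rw [memLp_two_iff_integrable_sq_norm (measurable_deriv N).aestronglyMeasurable]
  refine (h.integrable_norm_deriv_sq.add h'.integrable_norm_deriv_sq).mono'
    ((measurable_deriv N).norm.pow_const 2).aestronglyMeasurable ?_
  filter_upwards [hd] with x hx
  rw [Real.norm_of_nonneg (by positivity)]
  exact hx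

end

/-! ### The form domain as a vector space, and the energy norm -/

section

theorem IsPotential.ae_mem {V : Measure ℝ} (hV : IsPotential V) : ∀ᵐ x ∂V, x ∈ Ioo (0 : ℝ) 1 := by
  obtain ⟨f, c, a, -, -, h⟩ := hV.exists_eq
  rw [h]
  exact ae_restrict_mem measurableSet_Ioo

theorem IsPotential.restrict_Ioo {V : Measure ℝ} (hV : IsPotential V) :
    V.restrict (Ioo 0 1) = V :=
  Measure.restrict_eq_self_of_ae_mem hV.ae_mem

theorem IsPotential.inFormDomain {V : Measure ℝ} (hV : IsPotential V) {φ : ℝ → ℂ} (h : IsH10 φ)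
    (hfin : ∫⁻ x, ‖φ x‖ₑ ^ 2 ∂V < ⊤) : InFormDomain V φ := by
  have hm : AEStronglyMeasurable φ V := by
    rw [← hV.restrict_Ioo]
    exact (h.continuousOn.mono Ioo_subset_Icc_self).aestronglyMeasurable measurableSet_Ioo
  refine ⟨h, hm, ?_⟩
  rw [eLpNorm_lt_top_iff_lintegral_rpow_enorm_lt_top two_ne_zero ENNReal.ofNat_ne_top]
  simpa using hfin

theorem memLp_of_continuousOn {φ : ℝ → ℂ} (h : ContinuousOn φ (Icc 0 1)) {p : ℝ≥0∞} :
    MemLp φ p unitMeasure := by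
  obtain ⟨C, hC⟩ := isCompact_Icc.exists_bound_of_continuousOn h
  refine MemLp.of_bound (h.aestronglyMeasurable measurableSet_Icc) C ?_
  exact (ae_restrict_iff' measurableSet_Icc).2 (ae_of_all _ hC)

theorem integrable_of_continuousOn {E : Type*} [NormedAddCommGroup E] {φ : ℝ → E}
    (h : ContinuousOn φ (Icc 0 1)) : Integrable φ unitMeasure :=
  h.integrableOn_Icc

theorem lintegral_enorm_sq {α E : Type*} [MeasurableSpace α] [NormedAddCommGroup E]
    {μ : Measure α} {f : α → E} (hf : MemLp f 2 μ) :
    ∫⁻ x, ‖f x‖ₑ ^ 2 ∂μ = ENNReal.ofReal (∫ x, ‖f x‖ ^ 2 ∂μ) := by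
  rw [ofReal_integral_eq_lintegral_ofReal (hf.integrable_norm_pow two_ne_zero)
    (ae_of_all _ fun _ => by positivity)]
  simp_rw [ENNReal.ofReal_pow (norm_nonneg _), ofReal_norm]

theorem norm_toLp_sq {α E : Type*} [MeasurableSpace α] [NormedAddCommGroup E]
    {μ : Measure α} {f : α → E} (hf : MemLp f 2 μ) :
    ‖hf.toLp f‖ ^ 2 = ∫ x, ‖f x‖ ^ 2 ∂μ := by
  rw [Lp.norm_toLp, ← ENNReal.toReal_pow,
    eLpNorm_eq_lintegral_rpow_enorm_toReal two_ne_zero ENNReal.ofNat_ne_top,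
    ← ENNReal.rpow_natCast, ← ENNReal.rpow_mul]
  simp only [ENNReal.toReal_ofNat, Nat.cast_ofNat]
  norm_num
  rw [lintegral_enorm_sq hf, ENNReal.toReal_ofReal (integral_nonneg fun _ => by positivity)]

theorem inner_toLp {α : Type*} [MeasurableSpace α] {μ : Measure α} {f g : α → ℂ}
    (hf : MemLp f 2 μ) (hg : MemLp g 2 μ) :
    ⟪hf.toLp f, hg.toLp g⟫_ℂ = ∫ x, conj (f x) * g x ∂μ := by
  rw [L2.inner_def]
  refine integral_congr_ae ?_
  filter_upwards [hf.coeFn_toLp, hg.coeFn_toLp] with x h1 h2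
  rw [h1, h2, RCLike.inner_apply, mul_comm]

/-- The form domain of `-∂² + V` as a space of functions. -/
def formDomain (V : Measure ℝ) : Submodule ℂ (ℝ → ℂ) where
  carrier := {φ | InFormDomain V φ}
  add_mem' h h' := ⟨(h.isH10.add h'.isH10).1, h.memLp_potential.add h'.memLp_potential⟩
  zero_mem' := ⟨IsH10.zero, MemLp.zero⟩
  smul_mem' c _ h := ⟨(h.isH10.smul c).1, h.memLp_potential.const_smul c⟩

variable {V : Measure ℝ} {γ : ℝ} {ψ : ℝ → ℝ}

/-- The embedding of the form domain into `L²([0,1])`. -/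
def embed (V : Measure ℝ) : formDomain V →ₗ[ℂ] OneParticle where
  toFun φ := φ.2.isH10.memLp.toLp _
  map_add' _ _ := rfl
  map_smul' _ _ := rfl

/-- The weak derivative as a linear map on the form domain. -/
def weakDeriv (V : Measure ℝ) : formDomain V →ₗ[ℂ] OneParticle where
  toFun φ := φ.2.isH10.memLp_deriv.toLp _
  map_add' φ χ := by
    rw [← MemLp.toLp_add, MemLp.toLp_eq_toLp_iff]
    exact (φ.2.isH10.add χ.2.isH10).2
  map_smul' c φ := by
    rw [RingHom.id_apply, ← MemLp.toLp_const_smul, MemLp.toLp_eq_toLp_iff]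
    exact (φ.2.isH10.smul c).2

/-- The embedding of the form domain into `L²(V)`. -/
def potentialEmbed (V : Measure ℝ) : formDomain V →ₗ[ℂ] Lp ℂ 2 V where
  toFun φ := φ.2.memLp_potential.toLp _
  map_add' _ _ := rfl
  map_smul' _ _ := rfl

theorem memLp_weighted (hψ : IsH10 fun x => (ψ x : ℂ)) {φ : ℝ → ℂ} (hφ : IsH10 φ) :
    MemLp (fun x => ((√γ : ℝ) : ℂ) * (ψ x : ℂ) * φ x) 2 unitMeasure :=
  memLp_of_continuousOn ((continuousOn_const.mul hψ.continuousOn).mul hφ.continuousOn)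

/-- Multiplication by `√γ ψ`, from the form domain to `L²([0,1])`. -/
def weightedEmbed (V : Measure ℝ) (γ : ℝ) (hψ : IsH10 fun x => (ψ x : ℂ)) :
    formDomain V →ₗ[ℂ] OneParticle where
  toFun φ := (memLp_weighted (γ := γ) hψ φ.2.isH10).toLp _
  map_add' φ χ := by
    rw [← MemLp.toLp_add, MemLp.toLp_eq_toLp_iff]
    exact ae_of_all _ fun x => mul_add _ _ _
  map_smul' c φ := by
    rw [RingHom.id_apply, ← MemLp.toLp_const_smul, MemLp.toLp_eq_toLp_iff]
    exact ae_of_all _ fun x => mul_left_comm _ _ _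

/-- The Hilbert space in which the energy norm `∫ |φ'|² + V |φ|² + γ ψ² |φ|²` takes its values. -/
abbrev EnergySpace (V : Measure ℝ) : Type :=
  WithLp 2 (OneParticle × WithLp 2 (Lp ℂ 2 V × OneParticle))

/-- The map `φ ↦ (φ', φ, √γ ψ φ)`, whose square norm is the form of `-∂² + V + γ ψ²`. -/
def energyMap (V : Measure ℝ) (γ : ℝ) (hψ : IsH10 fun x => (ψ x : ℂ)) :
    formDomain V →ₗ[ℂ] EnergySpace V :=
  (WithLp.linearEquiv 2 ℂ _).symm.toLinearMap ∘ₗ (weakDeriv V).prod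
    ((WithLp.linearEquiv 2 ℂ _).symm.toLinearMap ∘ₗ
      (potentialEmbed V).prod (weightedEmbed V γ hψ))

theorem inner_energyMap (hψ : IsH10 fun x => (ψ x : ℂ)) (χ φ : formDomain V) :
    ⟪energyMap V γ hψ χ, energyMap V γ hψ φ⟫_ℂ =
      ⟪weakDeriv V χ, weakDeriv V φ⟫_ℂ + (⟪potentialEmbed V χ, potentialEmbed V φ⟫_ℂ +
        ⟪weightedEmbed V γ hψ χ, weightedEmbed V γ hψ φ⟫_ℂ) := by
  simp only [WithLp.prod_inner_apply]
  rfl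

theorem norm_energyMap_sq (hψ : IsH10 fun x => (ψ x : ℂ)) (φ : formDomain V) :
    ‖energyMap V γ hψ φ‖ ^ 2 =
      ‖weakDeriv V φ‖ ^ 2 + (‖potentialEmbed V φ‖ ^ 2 + ‖weightedEmbed V γ hψ φ‖ ^ 2) := by
  simp only [WithLp.prod_norm_sq_eq_of_L2]
  rfl

theorem norm_embed_sq (φ : formDomain V) :
    ‖embed V φ‖ ^ 2 = ∫ x, ‖φ.1 x‖ ^ 2 ∂unitMeasure := norm_toLp_sq φ.2.isH10.memLp

theorem norm_weakDeriv_sq (φ : formDomain V) :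
    ‖weakDeriv V φ‖ ^ 2 = ∫ x, ‖deriv φ.1 x‖ ^ 2 ∂unitMeasure :=
  norm_toLp_sq φ.2.isH10.memLp_deriv

theorem norm_potentialEmbed_sq (φ : formDomain V) :
    ‖potentialEmbed V φ‖ ^ 2 = ∫ x, ‖φ.1 x‖ ^ 2 ∂V := norm_toLp_sq φ.2.memLp_potential

theorem norm_weightedEmbed_sq (hγ : 0 ≤ γ) (hψ : IsH10 fun x => (ψ x : ℂ)) (φ : formDomain V) :
    ‖weightedEmbed V γ hψ φ‖ ^ 2 = γ * ∫ x, ψ x ^ 2 * ‖φ.1 x‖ ^ 2 ∂unitMeasure := by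
  refine (norm_toLp_sq (memLp_weighted (γ := γ) hψ φ.2.isH10)).trans ?_
  rw [← integral_const_mul]
  refine integral_congr_ae (ae_of_all _ fun x => ?_)
  simp only [norm_mul, mul_pow, Complex.norm_real, Real.norm_eq_abs, sq_abs, Real.sq_sqrt hγ]
  ring

theorem meanFieldForm_eq (hγ : 0 ≤ γ) (hψ : IsH10 fun x => (ψ x : ℂ)) (χ φ : formDomain V) :
    meanFieldForm V γ ψ χ.1 φ.1 = ⟪energyMap V γ hψ χ, energyMap V γ hψ φ⟫_ℂ -
      ((γ / 2 * ∫ x, ψ x ^ 4 ∂unitMeasure : ℝ) : ℂ) * ⟪embed V χ, embed V φ⟫_ℂ := by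
  have h1 : ⟪weakDeriv V χ, weakDeriv V φ⟫_ℂ = _ :=
    inner_toLp χ.2.isH10.memLp_deriv φ.2.isH10.memLp_deriv
  have h2 : ⟪potentialEmbed V χ, potentialEmbed V φ⟫_ℂ = _ :=
    inner_toLp χ.2.memLp_potential φ.2.memLp_potential
  have h3 : ⟪weightedEmbed V γ hψ χ, weightedEmbed V γ hψ φ⟫_ℂ = _ :=
    inner_toLp (memLp_weighted hψ χ.2.isH10) (memLp_weighted hψ φ.2.isH10)
  have h4 : ⟪embed V χ, embed V φ⟫_ℂ = _ := inner_toLp χ.2.isH10.memLp φ.2.isH10.memLp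
  rw [inner_energyMap, h1, h2, h3, h4, meanFieldForm]
  have h5 : (∫ x, (ψ x : ℂ) ^ 4 ∂unitMeasure) = ((∫ x, ψ x ^ 4 ∂unitMeasure : ℝ) : ℂ) := by
    rw [← integral_complex_ofReal]
    simp
  have h6 : (γ : ℂ) * (∫ x, (ψ x : ℂ) ^ 2 * (conj (χ.1 x) * φ.1 x) ∂unitMeasure) =
      ∫ x, conj (((√γ : ℝ) : ℂ) * (ψ x : ℂ) * χ.1 x) *
        (((√γ : ℝ) : ℂ) * (ψ x : ℂ) * φ.1 x) ∂unitMeasure := by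
    rw [← integral_const_mul]
    refine integral_congr_ae (ae_of_all _ fun x => ?_)
    simp only [map_mul, Complex.conj_ofReal]
    have : (γ : ℂ) = ((√γ : ℝ) : ℂ) * ((√γ : ℝ) : ℂ) := by
      rw [← Complex.ofReal_mul, Real.mul_self_sqrt hγ]
    rw [this]
    ring
  rw [h5, h6]
  push_cast
  ring

/-- The first variation: if the square norm of `K` is bounded below by `lam` times that of `u`, with
equality at `ψ`, then `ψ` satisfies the Euler-Lagrange equation. -/
theorem inner_eq_of_minimizer {W H H' : Type*} [AddCommGroup W] [Module ℂ W]
    [NormedAddCommGroup H] [InnerProductSpace ℂ H] [NormedAddCommGroup H'] [InnerProductSpace ℂ H']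
    (K : W →ₗ[ℂ] H) (u : W →ₗ[ℂ] H') {lam : ℝ} {ψ χ : W}
    (hmin : ∀ t : ℂ, lam * ‖u (ψ + t • χ)‖ ^ 2 ≤ ‖K (ψ + t • χ)‖ ^ 2)
    (heq : ‖K ψ‖ ^ 2 = lam * ‖u ψ‖ ^ 2) : ⟪K χ, K ψ⟫_ℂ = lam * ⟪u χ, u ψ⟫_ℂ := by
  set w : ℂ := ⟪K χ, K ψ⟫_ℂ - lam * ⟪u χ, u ψ⟫_ℂ with hw
  have key : ∀ t : ℂ, 0 ≤ 2 * (conj t * w).re + ‖t‖ ^ 2 * (‖K χ‖ ^ 2 - lam * ‖u χ‖ ^ 2) := by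
    intro t
    have h := hmin t
    rw [map_add, map_add, map_smul, map_smul, norm_add_sq (𝕜 := ℂ), norm_add_sq (𝕜 := ℂ), norm_smul,
      norm_smul, heq, inner_re_symm (K ψ), inner_re_symm (u ψ), inner_smul_left, inner_smul_left] at h
    have : (conj t * w).re = (conj t * ⟪K χ, K ψ⟫_ℂ).re - lam * (conj t * ⟪u χ, u ψ⟫_ℂ).re := by
      rw [hw, mul_sub, Complex.sub_re, mul_left_comm, Complex.re_ofReal_mul]
    rw [this]
    simp only [RCLike.re_to_complex] at h
    nlinarith
  set B := ‖K χ‖ ^ 2 - lam * ‖u χ‖ ^ 2 with hB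
  have hw0 : w = 0 := by
    by_contra hne
    have hpos : 0 < ‖w‖ ^ 2 := by positivity
    have hk : ∀ r : ℝ, 0 ≤ -2 * r * ‖w‖ ^ 2 + r ^ 2 * ‖w‖ ^ 2 * B := by
      intro r
      have h := key (-(r : ℂ) * w)
      have e1 : (conj (-(r : ℂ) * w) * w).re = -r * ‖w‖ ^ 2 := by
        have : conj (-(r : ℂ) * w) * w = ((-r * ‖w‖ ^ 2 : ℝ) : ℂ) := by
          rw [map_mul, mul_assoc, mul_comm (conj w), Complex.mul_conj, Complex.normSq_eq_norm_sq]
          simp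
        rw [this, Complex.ofReal_re]
      rw [e1, norm_mul, norm_neg, mul_pow, Complex.norm_real, Real.norm_eq_abs, sq_abs] at h
      nlinarith
    have h1 := hk (1 / (|B| + 1))
    have hb : 0 < |B| + 1 := by positivity
    have h2 : (1 / (|B| + 1)) * B ≤ 1 := by
      rw [one_div, inv_mul_le_iff₀ hb]
      linarith [le_abs_self B]
    have h3 : 0 < 1 / (|B| + 1) := by positivity
    nlinarith [mul_pos h3 hpos]
  rw [hw, sub_eq_zero] at hw0
  exact hw0

end

/-! ### The Gross-Pitaevskii minimizer is the ground state of the mean-field Hamiltonian -/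

section

variable {V : Measure ℝ} {γ : ℝ} {ψ : ℝ → ℝ}

theorem inFormDomain_of_lipschitz (hV : IsPotential V) {φ : ℝ → ℂ} {C : ℝ≥0}
    (hL : LipschitzWith C φ) {K : Set ℝ} (hK : IsCompact K) (hK' : K ⊆ Ioo 0 1)
    (h : ∀ x ∉ K, φ x = 0) : InFormDomain V φ := by
  refine hV.inFormDomain (isH10_of_lipschitz hL (h 0 fun h0 => by simpa using (hK' h0).1)
    (h 1 fun h1 => by simpa using (hK' h1).2)) ?_
  obtain ⟨M, hM⟩ := hK.exists_bound_of_continuousOn hL.continuous.continuousOn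
  have hle : ∀ x, ‖φ x‖ₑ ^ 2 ≤ K.indicator (fun _ => ENNReal.ofReal M ^ 2) x := by
    intro x
    by_cases hx : x ∈ K
    · rw [indicator_of_mem hx, ← ofReal_norm]
      gcongr
      exact hM x hx
    · simp [h x hx]
  refine (lintegral_mono hle).trans_lt ?_
  rw [lintegral_indicator hK.measurableSet, setLIntegral_const]
  exact ENNReal.mul_lt_top (by simp) (hV.lt_top K hK hK')

theorem embed_eq_zero {φ : formDomain V} (h : embed V φ = 0) {x : ℝ} (hx : x ∈ Icc (0 : ℝ) 1) :
    φ.1 x = 0 := by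
  have h1 : φ.1 =ᵐ[unitMeasure] fun _ => (0 : ℂ) := by
    have h2 : (φ.2.isH10.memLp.toLp φ.1 : ℝ → ℂ) =ᵐ[unitMeasure] φ.1 := φ.2.isH10.memLp.coeFn_toLp
    have h3 : (φ.2.isH10.memLp.toLp φ.1) = 0 := h
    rw [h3] at h2
    exact h2.symm.trans (Lp.coeFn_zero _ _ _)
  exact Measure.eqOn_Icc_of_ae_eq volume zero_ne_one h1 φ.2.isH10.continuousOn
    continuousOn_const hx

theorem gpEnergy_eq (hγ : 0 ≤ γ) (φ : formDomain V) :
    gpEnergy V γ φ.1 = ENNReal.ofReal (‖weakDeriv V φ‖ ^ 2 + ‖potentialEmbed V φ‖ ^ 2 +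
      γ / 2 * ∫ x, ‖φ.1 x‖ ^ 4 ∂unitMeasure) := by
  have h4 : ∫⁻ x, ‖φ.1 x‖ₑ ^ 4 ∂unitMeasure
      = ENNReal.ofReal (∫ x, ‖φ.1 x‖ ^ 4 ∂unitMeasure) := by
    have hi : Integrable (fun x => ‖φ.1 x‖ ^ 4) unitMeasure :=
      integrable_of_continuousOn (φ.2.isH10.continuousOn.norm.pow 4)
    rw [ofReal_integral_eq_lintegral_ofReal hi
      (ae_of_all _ fun _ => by positivity)]
    simp_rw [ENNReal.ofReal_pow (norm_nonneg _), ofReal_norm]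
  have hi : 0 ≤ ∫ x, ‖φ.1 x‖ ^ 4 ∂unitMeasure := integral_nonneg fun _ => by positivity
  rw [gpEnergy, h4, lintegral_enorm_sq φ.2.isH10.memLp_deriv, lintegral_enorm_sq
    φ.2.memLp_potential, ← ENNReal.ofReal_mul (by positivity), ← ENNReal.ofReal_add
    (integral_nonneg fun _ => by positivity) (integral_nonneg fun _ => by positivity),
    ← ENNReal.ofReal_add (add_nonneg (integral_nonneg fun _ => by positivity)
      (integral_nonneg fun _ => by positivity)) (by positivity), norm_weakDeriv_sq,
    norm_potentialEmbed_sq]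

theorem lintegral_eq_one_iff (φ : formDomain V) :
    ∫⁻ x, ‖φ.1 x‖ₑ ^ 2 ∂unitMeasure = 1 ↔ ‖embed V φ‖ = 1 := by
  rw [lintegral_enorm_sq φ.2.isH10.memLp, ENNReal.ofReal_eq_one, ← norm_embed_sq,
    pow_eq_one_iff_of_nonneg (norm_nonneg _) two_ne_zero]

theorem exists_normalized (hV : IsPotential V) : ∃ φ : formDomain V, ‖embed V φ‖ = 1 := by
  set f : ℝ → ℂ := fun x => ((max 0 (1 / 4 - |x - 1 / 2|) : ℝ) : ℂ) with hf
  have hL : LipschitzWith 1 f := by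
    refine LipschitzWith.of_dist_le_mul fun x y => ?_
    rw [hf, Complex.dist_eq, ← Complex.ofReal_sub, Complex.norm_real, Real.norm_eq_abs,
      NNReal.coe_one, one_mul, Real.dist_eq]
    refine (abs_max_sub_max_le_max _ _ _ _).trans ?_
    simp only [sub_self, abs_zero]
    refine max_le (abs_nonneg _) ?_
    have := abs_abs_sub_abs_le (y - 1 / 2) (x - 1 / 2)
    rw [sub_sub_sub_cancel_left]
    refine this.trans (le_of_eq ?_)
    rw [sub_sub_sub_cancel_right, abs_sub_comm]
  have hd : InFormDomain V f := inFormDomain_of_lipschitz hV hL (K := Icc (1 / 4) (3 / 4))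
    isCompact_Icc (Icc_subset_Ioo (by norm_num) (by norm_num)) (fun x hx => by
      simp only [hf]
      norm_cast
      refine max_eq_left ?_
      by_contra! hc
      have h1 : |x - 1 / 2| < 1 / 4 := by linarith
      rw [abs_lt] at h1
      exact hx ⟨by linarith, by linarith⟩)
  set F : formDomain V := ⟨f, hd⟩
  have hne : embed V F ≠ 0 := by
    intro h0
    have := embed_eq_zero h0 (x := 1 / 2) (by norm_num)
    simp [F, hf] at this
  refine ⟨((‖embed V F‖⁻¹ : ℝ) : ℂ) • F, ?_⟩
  rw [map_smul, norm_smul, Complex.norm_real, norm_inv, norm_norm,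
    inv_mul_cancel₀ (norm_ne_zero_iff.2 hne)]

theorem IsGPMinimizer.inFormDomain (hV : IsPotential V) (hγ : 0 ≤ γ) (h : IsGPMinimizer V γ ψ) :
    InFormDomain V fun x => (ψ x : ℂ) := by
  obtain ⟨φ, hφ⟩ := exists_normalized hV
  have h1 := h.minimal φ.1 φ.2.isH10 ((lintegral_eq_one_iff φ).2 hφ)
  rw [gpEnergy_eq hγ] at h1
  refine hV.inFormDomain h.isH10 (lt_of_le_of_lt (le_trans ?_ h1) ENNReal.ofReal_lt_top)
  rw [gpEnergy]
  exact le_add_right le_add_self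

/-- The Gross-Pitaevskii minimizer as an element of the form domain. -/
def IsGPMinimizer.elem (hV : IsPotential V) (hγ : 0 ≤ γ) (h : IsGPMinimizer V γ ψ) :
    formDomain V :=
  ⟨fun x => (ψ x : ℂ), h.inFormDomain hV hγ⟩

theorem IsGPMinimizer.norm_elem (hV : IsPotential V) (hγ : 0 ≤ γ) (h : IsGPMinimizer V γ ψ) :
    ‖embed V (h.elem hV hγ)‖ = 1 :=
  (lintegral_eq_one_iff (h.elem hV hγ)).1 h.normalized

theorem IsGPMinimizer.embed_elem (hV : IsPotential V) (hγ : 0 ≤ γ) (h : IsGPMinimizer V γ ψ) :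
    embed V (h.elem hV hγ) = h.state := rfl

/-- The chemical potential `∫ |ψ'|² + V ψ² + γ ψ⁴`. -/
def IsGPMinimizer.chemicalPotential (hV : IsPotential V) (hγ : 0 ≤ γ) (h : IsGPMinimizer V γ ψ) :
    ℝ :=
  ‖energyMap V γ h.isH10 (h.elem hV hγ)‖ ^ 2

/-- Half the interaction energy, `(γ/2) ∫ ψ⁴`, which is the constant in the mean-field
Hamiltonian. -/
def selfEnergy (γ : ℝ) (ψ : ℝ → ℝ) : ℝ := γ / 2 * ∫ x, ψ x ^ 4 ∂unitMeasure

/-- The ground state energy `∫ |ψ'|² + V ψ² + (γ/2) ψ⁴` of the mean-field Hamiltonian. -/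
def IsGPMinimizer.energy (hV : IsPotential V) (hγ : 0 ≤ γ) (h : IsGPMinimizer V γ ψ) : ℝ :=
  h.chemicalPotential hV hγ - selfEnergy γ ψ

theorem IsGPMinimizer.continuousOn (h : IsGPMinimizer V γ ψ) : ContinuousOn ψ (Icc 0 1) := by
  have := Complex.continuous_re.comp_continuousOn h.isH10.continuousOn
  simpa [Function.comp_def] using this

theorem selfEnergy_nonneg (hγ : 0 ≤ γ) : 0 ≤ selfEnergy γ ψ := by
  have : 0 ≤ ∫ x, ψ x ^ 4 ∂unitMeasure := integral_nonneg fun _ => by positivity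
  unfold selfEnergy
  positivity

theorem IsGPMinimizer.energy_eq (hV : IsPotential V) (hγ : 0 ≤ γ) (h : IsGPMinimizer V γ ψ) :
    h.energy hV hγ = ‖weakDeriv V (h.elem hV hγ)‖ ^ 2 + ‖potentialEmbed V (h.elem hV hγ)‖ ^ 2 +
      selfEnergy γ ψ := by
  rw [energy, chemicalPotential, norm_energyMap_sq, norm_weightedEmbed_sq hγ, selfEnergy]
  have : ∫ x, ψ x ^ 2 * ‖(h.elem hV hγ).1 x‖ ^ 2 ∂unitMeasure = ∫ x, ψ x ^ 4 ∂unitMeasure := by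
    refine integral_congr_ae (ae_of_all _ fun x => ?_)
    simp only [elem, Complex.norm_real, Real.norm_eq_abs, sq_abs]
    ring
  rw [this]
  ring

theorem IsGPMinimizer.gpEnergy_eq_energy (hV : IsPotential V) (hγ : 0 ≤ γ)
    (h : IsGPMinimizer V γ ψ) :
    gpEnergy V γ (fun x => (ψ x : ℂ)) = ENNReal.ofReal (h.energy hV hγ) := by
  rw [h.energy_eq, selfEnergy]
  refine (gpEnergy_eq hγ (h.elem hV hγ)).trans ?_
  have : ∫ x, ‖(h.elem hV hγ).1 x‖ ^ 4 ∂unitMeasure = ∫ x, ψ x ^ 4 ∂unitMeasure := by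
    refine integral_congr_ae (ae_of_all _ fun x => ?_)
    simp only [elem, Complex.norm_real, Real.norm_eq_abs]
    exact Even.pow_abs ⟨2, rfl⟩ _
  rw [this]

theorem nonneg_of_forall_linear_add_sq {X Y : ℝ} (h : ∀ t, 0 < t → t ≤ 1 → 0 ≤ t * X + t ^ 2 * Y) :
    0 ≤ X := by
  by_contra! hX
  have hb : 0 < |Y| + 1 := by positivity
  set t := min 1 (-X / (2 * (|Y| + 1))) with ht
  have ht0 : 0 < t := lt_min one_pos (div_pos (by linarith) (by positivity))
  have ht1 : t * (2 * (|Y| + 1)) ≤ -X := by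
    have : t ≤ -X / (2 * (|Y| + 1)) := min_le_right _ _
    rwa [le_div_iff₀ (by positivity)] at this
  have h1 := h t ht0 (min_le_left _ _)
  have h2 : 0 ≤ X + t * Y := by
    by_contra! hc
    nlinarith
  have h3 : t * Y ≤ t * |Y| := mul_le_mul_of_nonneg_left (le_abs_self Y) ht0.le
  nlinarith

/-- The Gross-Pitaevskii functional is convex as a functional of the density, so its
linearization at `ψ²` is minimized by `ψ` as well. -/
theorem IsGPMinimizer.le_energyMap_of_norm_eq_one (hV : IsPotential V) (hγ : 0 ≤ γ)
    (h : IsGPMinimizer V γ ψ) (φ : formDomain V) (hφ : ‖embed V φ‖ = 1) :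
    h.chemicalPotential hV hγ ≤ ‖energyMap V γ h.isH10 φ‖ ^ 2 := by
  set Ψ := h.elem hV hγ with hΨ
  set P := ∫ x, ψ x ^ 4 ∂unitMeasure with hP
  set R := ∫ x, ψ x ^ 2 * ‖φ.1 x‖ ^ 2 ∂unitMeasure with hR
  set S := ∫ x, ‖φ.1 x‖ ^ 4 ∂unitMeasure with hS
  have hcψ := h.continuousOn
  have hcφ := φ.2.isH10.continuousOn.norm
  have iP : Integrable (fun x => ψ x ^ 4) unitMeasure := integrable_of_continuousOn (hcψ.pow 4)
  have iR : Integrable (fun x => ψ x ^ 2 * ‖φ.1 x‖ ^ 2) unitMeasure :=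
    integrable_of_continuousOn ((hcψ.pow 2).mul (hcφ.pow 2))
  have iS : Integrable (fun x => ‖φ.1 x‖ ^ 4) unitMeasure := integrable_of_continuousOn (hcφ.pow 4)
  have e1 : h.chemicalPotential hV hγ =
      ‖weakDeriv V Ψ‖ ^ 2 + ‖potentialEmbed V Ψ‖ ^ 2 + γ * P := by
    have := h.energy_eq hV hγ
    rw [energy, selfEnergy] at this
    linear_combination this
  have e2 : ‖energyMap V γ h.isH10 φ‖ ^ 2 =
      ‖weakDeriv V φ‖ ^ 2 + ‖potentialEmbed V φ‖ ^ 2 + γ * R := by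
    rw [norm_energyMap_sq, norm_weightedEmbed_sq hγ, add_assoc]
  rw [e1, e2, ← sub_nonneg]
  refine nonneg_of_forall_linear_add_sq (Y := γ / 2 * (P - 2 * R + S)) fun t ht0 ht1 => ?_
  have ht1' : 0 ≤ 1 - t := by linarith
  set a : formDomain V := ((√(1 - t) : ℝ) : ℂ) • Ψ with ha
  set b : formDomain V := ((√t : ℝ) : ℂ) • φ with hb
  obtain ⟨hF, hdF⟩ := a.2.isH10.sqrt_sq_add_sq b.2.isH10
  set F : ℝ → ℂ := fun x => ((√(‖a.1 x‖ ^ 2 + ‖b.1 x‖ ^ 2) : ℝ) : ℂ) with hFdef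
  have na : ∀ x, ‖a.1 x‖ ^ 2 = (1 - t) * ψ x ^ 2 := fun x => by
    simp only [ha, hΨ, elem, Submodule.coe_smul, Pi.smul_apply, smul_eq_mul, norm_mul,
      Complex.norm_real, Real.norm_eq_abs, mul_pow, sq_abs, Real.sq_sqrt ht1']
  have nb : ∀ x, ‖b.1 x‖ ^ 2 = t * ‖φ.1 x‖ ^ 2 := fun x => by
    simp only [hb, Submodule.coe_smul, Pi.smul_apply, smul_eq_mul, norm_mul,
      Complex.norm_real, Real.norm_eq_abs, mul_pow, sq_abs, Real.sq_sqrt ht0.le]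
  have nF : ∀ x, ‖F x‖ ^ 2 = ‖a.1 x‖ ^ 2 + ‖b.1 x‖ ^ 2 := fun x => by
    simp only [hFdef, Complex.norm_real, Real.norm_eq_abs, sq_abs]
    rw [Real.sq_sqrt (by positivity)]
  have ia := a.2.memLp_potential.integrable_norm_pow two_ne_zero
  have ib := b.2.memLp_potential.integrable_norm_pow two_ne_zero
  have hFV : InFormDomain V F := by
    refine hV.inFormDomain hF ?_
    have h2 : ∫⁻ x, ‖F x‖ₑ ^ 2 ∂V ≤
        ENNReal.ofReal (∫ x, (‖a.1 x‖ ^ 2 + ‖b.1 x‖ ^ 2) ∂V) := by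
      have iab : Integrable (fun x => ‖a.1 x‖ ^ 2 + ‖b.1 x‖ ^ 2) V := ia.add ib
      rw [ofReal_integral_eq_lintegral_ofReal iab (ae_of_all _ fun _ => by positivity)]
      refine le_of_eq (lintegral_congr fun x => ?_)
      rw [← nF, ENNReal.ofReal_pow (norm_nonneg _), ofReal_norm]
    exact h2.trans_lt ENNReal.ofReal_lt_top
  set G : formDomain V := ⟨F, hFV⟩
  have sa : ∀ {E : Type} [NormedAddCommGroup E] [NormedSpace ℂ E] (L : formDomain V →ₗ[ℂ] E),
      ‖L a‖ ^ 2 = (1 - t) * ‖L Ψ‖ ^ 2 := fun L => by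
    rw [ha, map_smul, norm_smul, mul_pow, Complex.norm_real, Real.norm_eq_abs, sq_abs,
      Real.sq_sqrt ht1']
  have sb : ∀ {E : Type} [NormedAddCommGroup E] [NormedSpace ℂ E] (L : formDomain V →ₗ[ℂ] E),
      ‖L b‖ ^ 2 = t * ‖L φ‖ ^ 2 := fun L => by
    rw [hb, map_smul, norm_smul, mul_pow, Complex.norm_real, Real.norm_eq_abs, sq_abs,
      Real.sq_sqrt ht0.le]
  have uG : ‖embed V G‖ ^ 2 = 1 := by
    have : ‖embed V G‖ ^ 2 = ‖embed V a‖ ^ 2 + ‖embed V b‖ ^ 2 := by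
      rw [norm_embed_sq, norm_embed_sq, norm_embed_sq, ← integral_add
        (a.2.isH10.memLp.integrable_norm_pow two_ne_zero)
        (b.2.isH10.memLp.integrable_norm_pow two_ne_zero)]
      exact integral_congr_ae (ae_of_all _ nF)
    rw [this, sa, sb, h.norm_elem, hφ]
    ring
  have vG : ‖potentialEmbed V G‖ ^ 2 =
      (1 - t) * ‖potentialEmbed V Ψ‖ ^ 2 + t * ‖potentialEmbed V φ‖ ^ 2 := by
    rw [← sa, ← sb, norm_potentialEmbed_sq, norm_potentialEmbed_sq, norm_potentialEmbed_sq,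
      ← integral_add ia ib]
    exact integral_congr_ae (ae_of_all _ nF)
  have dG : ‖weakDeriv V G‖ ^ 2 ≤ (1 - t) * ‖weakDeriv V Ψ‖ ^ 2 + t * ‖weakDeriv V φ‖ ^ 2 := by
    rw [← sa, ← sb, norm_weakDeriv_sq, norm_weakDeriv_sq, norm_weakDeriv_sq,
      ← integral_add a.2.isH10.integrable_norm_deriv_sq b.2.isH10.integrable_norm_deriv_sq]
    exact integral_mono_ae hF.integrable_norm_deriv_sq
      (a.2.isH10.integrable_norm_deriv_sq.add b.2.isH10.integrable_norm_deriv_sq) hdF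
  have qG : ∫ x, ‖G.1 x‖ ^ 4 ∂unitMeasure =
      (1 - t) ^ 2 * P + 2 * t * (1 - t) * R + t ^ 2 * S := by
    have iPR : Integrable (fun x => (1 - t) ^ 2 * ψ x ^ 4 + 2 * t * (1 - t) *
        (ψ x ^ 2 * ‖φ.1 x‖ ^ 2)) unitMeasure := (iP.const_mul _).add (iR.const_mul _)
    rw [hP, hR, hS, ← integral_const_mul, ← integral_const_mul, ← integral_const_mul,
      ← integral_add (iP.const_mul _) (iR.const_mul _), ← integral_add iPR (iS.const_mul _)]
    refine integral_congr_ae (ae_of_all _ fun x => ?_)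
    have : ‖F x‖ ^ 4 = (‖F x‖ ^ 2) ^ 2 := by ring
    simp only [G, this, nF, na, nb]
    ring
  have hmin := h.minimal G.1 hF ((lintegral_eq_one_iff G).2 (by
    have := norm_nonneg (embed V G)
    nlinarith))
  have hnn : 0 ≤ ∫ x, ‖G.1 x‖ ^ 4 ∂unitMeasure := integral_nonneg fun _ => by positivity
  rw [h.gpEnergy_eq_energy hV hγ, gpEnergy_eq hγ, ENNReal.ofReal_le_ofReal_iff (by positivity),
    h.energy_eq, selfEnergy, vG, qG] at hmin
  linarith

/-- The Gross-Pitaevskii minimizer is a ground state of `-∂² + V + γ ψ²`, with the chemical potential as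
its lowest eigenvalue. -/
theorem IsGPMinimizer.le_energyMap (hV : IsPotential V) (hγ : 0 ≤ γ) (h : IsGPMinimizer V γ ψ)
    (φ : formDomain V) :
    h.chemicalPotential hV hγ * ‖embed V φ‖ ^ 2 ≤ ‖energyMap V γ h.isH10 φ‖ ^ 2 := by
  by_cases h0 : ‖embed V φ‖ = 0
  · rw [h0, zero_pow two_ne_zero, mul_zero]; positivity
  · have h1 := h.le_energyMap_of_norm_eq_one hV hγ (((‖embed V φ‖⁻¹ : ℝ) : ℂ) • φ) (by
      rw [map_smul, norm_smul, Complex.norm_real, norm_inv, norm_norm, inv_mul_cancel₀ h0])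
    rw [map_smul, norm_smul, mul_pow, Complex.norm_real, norm_inv, norm_norm, inv_pow,
      inv_mul_eq_div, le_div_iff₀ (by positivity)] at h1
    exact h1

/-- The Gross-Pitaevskii equation in weak form. -/
theorem IsGPMinimizer.inner_energyMap (hV : IsPotential V) (hγ : 0 ≤ γ) (h : IsGPMinimizer V γ ψ)
    (χ : formDomain V) :
    ⟪energyMap V γ h.isH10 χ, energyMap V γ h.isH10 (h.elem hV hγ)⟫_ℂ =
      h.chemicalPotential hV hγ * ⟪embed V χ, embed V (h.elem hV hγ)⟫_ℂ :=
  inner_eq_of_minimizer _ _ (fun _ => h.le_energyMap hV hγ _) (by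
    rw [h.norm_elem, one_pow, mul_one, chemicalPotential])

end

/-! ### Existence of the first excited state -/

section

variable {V : Measure ℝ} {γ : ℝ} {ψ : ℝ → ℝ}

/-- Minimization of a square norm on the unit sphere of a weaker norm, on the orthogonal complement
of a vector, for a compact embedding. By the parallelogram law a minimizing sequence
that converges in the weak norm is a Cauchy sequence in the strong norm. -/
theorem exists_minimizer_of_compact {W H H' : Type*} [AddCommGroup W] [Module ℂ W]
    [NormedAddCommGroup H] [InnerProductSpace ℂ H] [CompleteSpace H]
    [NormedAddCommGroup H'] [InnerProductSpace ℂ H']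
    (K : W →ₗ[ℂ] H) (u : W →ₗ[ℂ] H') (w : H')
    (hcomp : ∀ (φ : ℕ → W) (R : ℝ), (∀ n, ‖K (φ n)‖ ≤ R) →
      ∃ g : ℕ → ℕ, StrictMono g ∧ ∃ v, Tendsto (fun n => u (φ (g n))) atTop (𝓝 v))
    (hclosed : ∀ (φ : ℕ → W) k v, Tendsto (fun n => K (φ n)) atTop (𝓝 k) →
      Tendsto (fun n => u (φ n)) atTop (𝓝 v) → ∃ φ₀, K φ₀ = k ∧ u φ₀ = v)
    (hne : ∃ φ, ⟪w, u φ⟫_ℂ = 0 ∧ ‖u φ‖ = 1) :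
    ∃ φ, ⟪w, u φ⟫_ℂ = 0 ∧ ‖u φ‖ = 1 ∧
      ∀ χ, ⟪w, u χ⟫_ℂ = 0 → ‖K φ‖ ^ 2 * ‖u χ‖ ^ 2 ≤ ‖K χ‖ ^ 2 := by
  set S : Set ℝ := {r | ∃ φ, (⟪w, u φ⟫_ℂ = 0 ∧ ‖u φ‖ = 1) ∧ ‖K φ‖ ^ 2 = r} with hS
  have hSne : S.Nonempty := let ⟨φ, hφ⟩ := hne; ⟨_, φ, hφ, rfl⟩
  have hSbdd : BddBelow S := ⟨0, by rintro _ ⟨φ, -, rfl⟩; positivity⟩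
  set lam := sInf S with hlam
  have hlam0 : 0 ≤ lam := le_csInf hSne (by rintro _ ⟨φ, -, rfl⟩; positivity)
  have hbound : ∀ χ, ⟪w, u χ⟫_ℂ = 0 → lam * ‖u χ‖ ^ 2 ≤ ‖K χ‖ ^ 2 := by
    intro χ hχ
    by_cases h0 : ‖u χ‖ = 0
    · rw [h0, zero_pow two_ne_zero, mul_zero]; positivity
    · have h1 : lam ≤ ‖K (((‖u χ‖⁻¹ : ℝ) : ℂ) • χ)‖ ^ 2 := by
        refine csInf_le hSbdd ⟨_, ⟨?_, ?_⟩, rfl⟩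
        · rw [map_smul, inner_smul_right, hχ, mul_zero]
        · rw [map_smul, norm_smul, Complex.norm_real, norm_inv, norm_norm, inv_mul_cancel₀ h0]
      rw [map_smul, norm_smul, mul_pow, Complex.norm_real, norm_inv, norm_norm, inv_pow,
        inv_mul_eq_div, le_div_iff₀ (by positivity)] at h1
      exact h1
  have hseq : ∀ n : ℕ, ∃ φ, (⟪w, u φ⟫_ℂ = 0 ∧ ‖u φ‖ = 1) ∧ ‖K φ‖ ^ 2 < lam + 1 / ((n : ℝ) + 1) := by
    intro n
    obtain ⟨_, ⟨φ, hφ, rfl⟩, h⟩ := exists_lt_of_csInf_lt hSne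
      (show sInf S < lam + 1 / ((n : ℝ) + 1) from lt_add_of_pos_right _ (by positivity))
    exact ⟨φ, hφ, h⟩
  choose φ hφ hφlt using hseq
  obtain ⟨g, hg, v, hv⟩ := hcomp φ (√(lam + 1)) fun n => by
    refine Real.le_sqrt_of_sq_le ((hφlt n).le.trans ?_)
    have : 1 / ((n : ℝ) + 1) ≤ 1 := by
      rw [div_le_one (by positivity)]; linarith [(Nat.cast_nonneg n : (0 : ℝ) ≤ n)]
    linarith
  have hKsq : Tendsto (fun n => ‖K (φ (g n))‖ ^ 2) atTop (𝓝 lam) := by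
    have h1 : Tendsto (fun n : ℕ => lam + 1 / ((n : ℝ) + 1)) atTop (𝓝 lam) := by
      simpa using tendsto_const_nhds.add (tendsto_one_div_add_atTop_nhds_zero_nat (𝕜 := ℝ))
    refine tendsto_of_tendsto_of_tendsto_of_le_of_le tendsto_const_nhds
      (h1.comp hg.tendsto_atTop) (fun n => ?_) (fun n => (hφlt (g n)).le)
    have := hbound _ (hφ (g n)).1
    rwa [(hφ (g n)).2, one_pow, mul_one] at this
  have hpar : ∀ n m, ‖K (φ (g n)) - K (φ (g m))‖ ^ 2 ≤ 2 * (‖K (φ (g n))‖ ^ 2 - lam) +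
      2 * (‖K (φ (g m))‖ ^ 2 - lam) + lam * ‖u (φ (g n)) - u (φ (g m))‖ ^ 2 := by
    intro n m
    have h1 := parallelogram_law_with_norm ℂ (K (φ (g n))) (K (φ (g m)))
    have h2 := parallelogram_law_with_norm ℂ (u (φ (g n))) (u (φ (g m)))
    have h3 := hbound (φ (g n) + φ (g m)) (by
      rw [map_add, inner_add_right, (hφ _).1, (hφ _).1, add_zero])
    rw [map_add, map_add] at h3
    rw [(hφ _).2, (hφ _).2] at h2
    nlinarith
  have hcau : CauchySeq fun n => K (φ (g n)) := by
    have hu := hv.cauchySeq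
    rw [Metric.cauchySeq_iff] at hu ⊢
    intro ε hε
    obtain ⟨N₁, hN₁⟩ := hu (ε / (2 * (√lam + 1))) (by positivity)
    obtain ⟨N₂, hN₂⟩ := (hKsq.eventually (gt_mem_nhds
      (show lam < lam + ε ^ 2 / 8 by linarith [pow_pos hε 2]))).exists_forall_of_atTop
    refine ⟨max N₁ N₂, fun m hm n hn => ?_⟩
    have h1 := hN₁ m (le_of_max_le_left hm) n (le_of_max_le_left hn)
    have h2 := hN₂ m (le_of_max_le_right hm)
    have h3 := hN₂ n (le_of_max_le_right hn)
    have h4 := hpar m n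
    rw [dist_eq_norm] at h1 ⊢
    rw [lt_div_iff₀ (by positivity)] at h1
    have h5 : √lam * ‖u (φ (g m)) - u (φ (g n))‖ < ε / 2 := by
      nlinarith [norm_nonneg (u (φ (g m)) - u (φ (g n))), Real.sqrt_nonneg lam]
    have h6 : lam * ‖u (φ (g m)) - u (φ (g n))‖ ^ 2 < (ε / 2) ^ 2 := by
      have : lam * ‖u (φ (g m)) - u (φ (g n))‖ ^ 2 = (√lam * ‖u (φ (g m)) - u (φ (g n))‖) ^ 2 := by
        rw [mul_pow, Real.sq_sqrt hlam0]
      rw [this]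
      exact pow_lt_pow_left₀ h5 (by positivity) two_ne_zero
    refine lt_of_pow_lt_pow_left₀ 2 hε.le ?_
    nlinarith
  obtain ⟨k, hk⟩ := cauchySeq_tendsto_of_complete hcau
  obtain ⟨φ₀, hφk, hφv⟩ := hclosed _ k v hk hv
  have hk2 : ‖K φ₀‖ ^ 2 = lam := by
    rw [hφk]
    exact tendsto_nhds_unique (hk.norm.pow 2) hKsq
  refine ⟨φ₀, ?_, ?_, fun χ hχ => hk2 ▸ hbound χ hχ⟩
  · rw [hφv]
    refine tendsto_nhds_unique ((continuous_const.inner continuous_id).continuousAt.tendsto.comp hv)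
      ?_
    simp [Function.comp_def, (hφ _).1]
  · rw [hφv]
    refine tendsto_nhds_unique hv.norm ?_
    simp [(hφ _).2]

theorem Lp_ae_eq_of_tendsto {α : Type*} [MeasurableSpace α] {μ : Measure α} {f : ℕ → α → ℂ}
    {g : α → ℂ} {F : Lp ℂ 2 μ} (hf : ∀ n, MemLp (f n) 2 μ)
    (h : Tendsto (fun n => (hf n).toLp (f n)) atTop (𝓝 F))
    (hae : ∀ᵐ x ∂μ, Tendsto (fun n => f n x) atTop (𝓝 (g x))) : F =ᵐ[μ] g := by
  obtain ⟨ns, hns, hlim⟩ := (tendstoInMeasure_of_tendsto_Lp h).exists_seq_tendsto_ae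
  have h2 : ∀ᵐ x ∂μ, ∀ n, (hf n).toLp (f n) x = f n x :=
    ae_all_iff.2 fun n => (hf n).coeFn_toLp
  filter_upwards [hlim, hae, h2] with x h3 h4 h5
  simp only [h5] at h3
  exact tendsto_nhds_unique h3 (h4.comp hns.tendsto_atTop)

theorem norm_weakDeriv_le (hψ : IsH10 fun x => (ψ x : ℂ)) (φ : formDomain V) :
    ‖weakDeriv V φ‖ ≤ ‖energyMap V γ hψ φ‖ := by
  refine le_of_sq_le_sq ?_ (norm_nonneg _)
  rw [norm_energyMap_sq]
  nlinarith [sq_nonneg ‖potentialEmbed V φ‖, sq_nonneg ‖weightedEmbed V γ hψ φ‖]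

/-- Sets bounded in energy are relatively compact in `L²`: by the Hölder bound on functions of
class `H¹₀` this follows from the Arzelà-Ascoli theorem. -/
theorem exists_subseq_tendsto_embed (hψ : IsH10 fun x => (ψ x : ℂ)) (φ : ℕ → formDomain V) (R : ℝ)
    (hR : ∀ n, ‖energyMap V γ hψ (φ n)‖ ≤ R) :
    ∃ g : ℕ → ℕ, StrictMono g ∧ ∃ v, Tendsto (fun n => embed V (φ (g n))) atTop (𝓝 v) := by
  have hR0 : 0 ≤ R := (norm_nonneg _).trans (hR 0)
  have hd : ∀ n, ∫ t, ‖deriv (φ n).1 t‖ ^ 2 ∂unitMeasure ≤ R ^ 2 := fun n => by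
    rw [← norm_weakDeriv_sq]
    exact pow_le_pow_left₀ (norm_nonneg _) ((norm_weakDeriv_le hψ _).trans (hR n)) 2
  set f : ℕ → BoundedContinuousFunction (Icc (0 : ℝ) 1) ℂ := fun n =>
    BoundedContinuousFunction.mkOfCompact
      ⟨fun x => (φ n).1 x, ((φ n).2.isH10.continuousOn).domRestrict⟩ with hf
  have hfx : ∀ n (x : Icc (0 : ℝ) 1), f n x = (φ n).1 x := fun n x => rfl
  have hcpt : IsCompact (closure (range f)) := by
    refine BoundedContinuousFunction.arzela_ascoli (Metric.closedBall (0 : ℂ) R)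
      (isCompact_closedBall _ _) _ ?_ ?_
    · rintro _ x ⟨n, rfl⟩
      rw [mem_closedBall_zero_iff, hfx]
      refine le_of_sq_le_sq ?_ hR0
      exact ((φ n).2.isH10.norm_sq_le x.2).trans (hd n)
    · refine Metric.equicontinuous_of_continuity_modulus (fun d => R * √d) ?_ _ ?_
      · have : Continuous fun d : ℝ => R * √d := by fun_prop
        simpa using this.tendsto 0
      · rintro x y ⟨_, n, rfl⟩
        rw [dist_comm, dist_eq_norm]
        refine le_of_sq_le_sq ?_ (by positivity)
        have := (φ n).2.isH10.norm_sub_sq_le' x.2 y.2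
        rw [mul_pow, Real.sq_sqrt dist_nonneg]
        refine this.trans ?_
        rw [dist_comm, Subtype.dist_eq, Real.dist_eq, mul_comm]
        exact mul_le_mul_of_nonneg_right (hd n) (abs_nonneg _)
  obtain ⟨a, -, g, hg, hlim⟩ := hcpt.tendsto_subseq (x := f) fun n =>
    subset_closure (mem_range_self n)
  refine ⟨g, hg, cauchySeq_tendsto_of_complete ?_⟩
  have hle : ∀ n m, dist (embed V (φ (g n))) (embed V (φ (g m))) ≤ dist (f (g n)) (f (g m)) := by
    intro n m
    rw [dist_eq_norm, ← map_sub]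
    refine le_of_sq_le_sq ?_ dist_nonneg
    rw [norm_embed_sq]
    have hae : ∀ᵐ x ∂unitMeasure, ‖(φ (g n) - φ (g m)).1 x‖ ^ 2 ≤ dist (f (g n)) (f (g m)) ^ 2 := by
      filter_upwards [ae_mem_Ioo] with x hx
      refine pow_le_pow_left₀ (norm_nonneg _) ?_ 2
      have := BoundedContinuousFunction.dist_coe_le_dist (f := f (g n)) (g := f (g m))
        (⟨x, Ioo_subset_Icc_self hx⟩ : Icc (0 : ℝ) 1)
      rw [dist_eq_norm] at this
      exact this
    have := integral_mono_ae ((φ (g n) - φ (g m)).2.isH10.memLp.integrable_norm_pow two_ne_zero)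
      (integrable_const _) hae
    simpa using this
  have hc := hlim.cauchySeq
  rw [Metric.cauchySeq_iff] at hc ⊢
  intro ε hε
  obtain ⟨N, hN⟩ := hc ε hε
  exact ⟨N, fun m hm n hn => (hle m n).trans_lt (hN m hm n hn)⟩

/-- The form of `-∂² + V + γ ψ²` is closed. -/
theorem exists_energyMap_eq (hψ : IsH10 fun x => (ψ x : ℂ)) (φ : ℕ → formDomain V)
    (k : EnergySpace V) (v : OneParticle)
    (hk : Tendsto (fun n => energyMap V γ hψ (φ n)) atTop (𝓝 k))
    (hv : Tendsto (fun n => embed V (φ n)) atTop (𝓝 v)) (hV : IsPotential V) :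
    ∃ φ₀, energyMap V γ hψ φ₀ = k ∧ embed V φ₀ = v := by
  have hk1 : Tendsto (fun n => weakDeriv V (φ n)) atTop (𝓝 k.fst) :=
    ((WithLp.prod_continuous_ofLp 2 _ _).fst.tendsto k).comp hk
  have hk' : Tendsto (fun n => (energyMap V γ hψ (φ n)).snd) atTop (𝓝 k.snd) :=
    ((WithLp.prod_continuous_ofLp 2 _ _).snd.tendsto k).comp hk
  have hk2 : Tendsto (fun n => potentialEmbed V (φ n)) atTop (𝓝 k.snd.fst) :=
    ((WithLp.prod_continuous_ofLp 2 _ _).fst.tendsto k.snd).comp hk'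
  have hk3 : Tendsto (fun n => weightedEmbed V γ hψ (φ n)) atTop (𝓝 k.snd.snd) :=
    ((WithLp.prod_continuous_ofLp 2 _ _).snd.tendsto k.snd).comp hk'
  set g : ℝ → ℂ := ⇑k.fst with hg
  have hgm : MemLp g 2 unitMeasure := Lp.memLp k.fst
  set F : ℝ → ℂ := fun x => ∫ t in (0 : ℝ)..x, g t with hF
  have hptw : ∀ x ∈ Icc (0 : ℝ) 1, Tendsto (fun n => (φ n).1 x) atTop (𝓝 (F x)) := by
    intro x hx
    rw [tendsto_iff_norm_sub_tendsto_zero]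
    refine squeeze_zero (fun _ => norm_nonneg _) (fun n => ?_)
      (tendsto_iff_norm_sub_tendsto_zero.1 hk1)
    have hm := (φ n).2.isH10.memLp_deriv.sub hgm
    have h1 : (φ n).1 x - F x = ∫ t in (0 : ℝ)..x, (deriv (φ n).1 t - g t) := by
      rw [intervalIntegral.integral_sub, ← (φ n).2.isH10.eq_integral_deriv hx]
      · exact intervalIntegrable_of_integrable (φ n).2.isH10.integrable_deriv (by simp) hx
      · exact intervalIntegrable_of_integrable (hgm.integrable one_le_two) (by simp) hx
    have h2 := norm_sub_sq_le_of_primitive (φ := fun y => (φ n).1 y - F y) (x := 0) hm le_rfl hx.2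
      hx.1 (by
        simp only [(φ n).2.isH10.zero_left, hF, intervalIntegral.integral_same, sub_zero]
        exact h1)
    simp only [(φ n).2.isH10.zero_left, hF, intervalIntegral.integral_same, sub_zero] at h2
    refine le_of_sq_le_sq (h2.trans ?_) (norm_nonneg _)
    have h3 : ‖weakDeriv V (φ n) - k.fst‖ ^ 2 =
        ∫ t, ‖(deriv (φ n).1 - g) t‖ ^ 2 ∂unitMeasure := by
      rw [← norm_toLp_sq hm, MemLp.toLp_sub (φ n).2.isH10.memLp_deriv hgm, Lp.toLp_coeFn]
      rfl
    rw [h3]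
    have h4 : ∫ t in Icc 0 x, ‖(deriv (φ n).1 - g) t‖ ^ 2 ≤
        ∫ t, ‖(deriv (φ n).1 - g) t‖ ^ 2 ∂unitMeasure :=
      setIntegral_mono_set (hm.integrable_norm_pow two_ne_zero) (ae_of_all _ fun _ => by positivity)
        (ae_of_all _ (Icc_subset_Icc le_rfl hx.2))
    have h5 : 0 ≤ ∫ t in Icc 0 x, ‖(deriv (φ n).1 - g) t‖ ^ 2 :=
      integral_nonneg fun _ => by positivity
    nlinarith [hx.2, hx.1]
  have hF1 : F 1 = 0 := by
    refine tendsto_nhds_unique (hptw 1 (by simp)) ?_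
    simp [(φ _).2.isH10.zero_right]
  obtain ⟨hFH, hFd⟩ := isH10_of_primitive (φ := F) hgm (fun x _ => rfl) hF1
  have hF2 : ⇑k.snd.fst =ᵐ[V] F :=
    Lp_ae_eq_of_tendsto (fun n => (φ n).2.memLp_potential) hk2 (by
      filter_upwards [hV.ae_mem] with x hx using hptw x (Ioo_subset_Icc_self hx))
  have hF3 : ⇑k.snd.snd =ᵐ[unitMeasure] fun x => ((√γ : ℝ) : ℂ) * (ψ x : ℂ) * F x :=
    Lp_ae_eq_of_tendsto (fun n => memLp_weighted hψ (φ n).2.isH10) hk3 (by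
      filter_upwards [ae_mem_Ioo] with x hx
      exact (hptw x (Ioo_subset_Icc_self hx)).const_mul _)
  have hF4 : ⇑v =ᵐ[unitMeasure] F :=
    Lp_ae_eq_of_tendsto (fun n => (φ n).2.isH10.memLp) hv (by
      filter_upwards [ae_mem_Ioo] with x hx using hptw x (Ioo_subset_Icc_self hx))
  have hFV : InFormDomain V F := ⟨hFH, (Lp.memLp _).ae_eq hF2⟩
  refine ⟨⟨F, hFV⟩, ?_, ?_⟩
  · have a1 : weakDeriv V ⟨F, hFV⟩ = k.fst :=
      Lp.ext ((hFV.isH10.memLp_deriv.coeFn_toLp).trans hFd)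
    have a2 : potentialEmbed V ⟨F, hFV⟩ = k.snd.fst :=
      Lp.ext ((hFV.memLp_potential.coeFn_toLp).trans hF2.symm)
    have a3 : weightedEmbed V γ hψ ⟨F, hFV⟩ = k.snd.snd :=
      Lp.ext (((memLp_weighted hψ hFH).coeFn_toLp).trans hF3.symm)
    have a4 : energyMap V γ hψ ⟨F, hFV⟩ = WithLp.toLp 2 (weakDeriv V ⟨F, hFV⟩,
      WithLp.toLp 2 (potentialEmbed V ⟨F, hFV⟩, weightedEmbed V γ hψ ⟨F, hFV⟩)) := rfl
    rw [a4, a1, a2, a3]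
    rfl
  · exact Lp.ext ((hFV.isH10.memLp.coeFn_toLp).trans hF4.symm)

end

/-! ### Upper bound on the spectral gap -/

section

variable {V : Measure ℝ} {γ : ℝ} {ψ : ℝ → ℝ}

theorem IsH10.mul_left {f χ : ℝ → ℂ} (hf : AbsolutelyContinuousOnInterval f 0 1)
    (hfd : MemLp (deriv f) 2 unitMeasure) (h : IsH10 χ) :
    IsH10 (fun x => f x * χ x) ∧ deriv (fun x => f x * χ x) =ᵐ[unitMeasure]
      fun x => deriv f x * χ x + f x * deriv χ x := by
  have hd : deriv (fun x => f x * χ x) =ᵐ[unitMeasure]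
      fun x => deriv f x * χ x + f x * deriv χ x := by
    filter_upwards [absolutelyContinuous_ae_differentiableAt hf, h.ae_differentiableAt] with x h1 h2
    exact (h1.hasDerivAt.mul h2.hasDerivAt).deriv
  have hfc : ContinuousOn f (Icc 0 1) := by
    simpa [uIcc_of_le (zero_le_one : (0 : ℝ) ≤ 1)] using hf.continuousOn
  have hb : ∀ {g : ℝ → ℂ}, ContinuousOn g (Icc 0 1) → MemLp g ⊤ unitMeasure := fun hg =>
    memLp_of_continuousOn hg
  refine ⟨⟨hf.smul h.absolutelyContinuous, MemLp.ae_eq hd.symm ?_, by simp [h.zero_left],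
    by simp [h.zero_right]⟩, hd⟩
  exact ((hb h.continuousOn).mul' hfd).add (h.memLp_deriv.mul' (hb hfc))

theorem IsH10.conj {φ : ℝ → ℂ} (h : IsH10 φ) :
    AbsolutelyContinuousOnInterval (fun x => conj (φ x)) 0 1 ∧
      (deriv fun x => conj (φ x)) =ᵐ[unitMeasure] fun x => conj (deriv φ x) := by
  refine ⟨absolutelyContinuous_of_dist_le h.absolutelyContinuous 1 fun x _ y _ => ?_, ?_⟩
  · rw [one_mul, Complex.dist_conj_conj]
  · filter_upwards [h.ae_differentiableAt] with x hx
    exact (Complex.conjCLE.hasFDerivAt.comp_hasDerivAt x hx.hasDerivAt).deriv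

/-- Integration by parts for functions vanishing at the end points. -/
theorem inner_weakDeriv_add (φ χ : formDomain V) :
    ⟪weakDeriv V φ, embed V χ⟫_ℂ + ⟪embed V φ, weakDeriv V χ⟫_ℂ = 0 := by
  obtain ⟨h1, h2⟩ := φ.2.isH10.conj
  have hm : MemLp (fun x => conj (deriv φ.1 x)) 2 unitMeasure := φ.2.isH10.memLp_deriv.star
  obtain ⟨h3, h4⟩ := IsH10.mul_left h1 (hm.ae_eq h2.symm) χ.2.isH10
  have e1 : ⟪weakDeriv V φ, embed V χ⟫_ℂ = _ := inner_toLp φ.2.isH10.memLp_deriv χ.2.isH10.memLp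
  have e2 : ⟪embed V φ, weakDeriv V χ⟫_ℂ = _ := inner_toLp φ.2.isH10.memLp χ.2.isH10.memLp_deriv
  have h5 := h3.eq_integral_deriv (x := 1) (by simp)
  rw [χ.2.isH10.zero_right, mul_zero, ← integral_unitMeasure] at h5
  rw [e1, e2, ← integral_add, h5]
  · refine integral_congr_ae ?_
    filter_upwards [h2, h4] with x h6 h7
    rw [h7, h6]
  · exact MemLp.integrable_mul (p := 2) (q := 2) hm χ.2.isH10.memLp
  · exact MemLp.integrable_mul (p := 2) (q := 2) φ.2.isH10.memLp.star χ.2.isH10.memLp_deriv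

theorem isH10_shift_mul (a : ℝ) {φ : ℝ → ℂ} (h : IsH10 φ) :
    IsH10 (fun x => ((x - a : ℝ) : ℂ) * φ x) ∧
      deriv (fun x => ((x - a : ℝ) : ℂ) * φ x) =ᵐ[unitMeasure]
        fun x => φ x + ((x - a : ℝ) : ℂ) * deriv φ x := by
  have hd : ∀ x, deriv (fun x : ℝ => ((x - a : ℝ) : ℂ)) x = 1 := fun x => by
    have := ((hasDerivAt_id x).sub_const a).ofReal_comp
    simpa using this.deriv
  have hac : AbsolutelyContinuousOnInterval (fun x : ℝ => ((x - a : ℝ) : ℂ)) 0 1 := by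
    have hL : LipschitzWith 1 (fun x : ℝ => ((x - a : ℝ) : ℂ)) := by
      refine LipschitzWith.of_dist_le_mul fun x y => ?_
      rw [Complex.dist_eq, ← Complex.ofReal_sub, Complex.norm_real, Real.norm_eq_abs,
        NNReal.coe_one, one_mul, Real.dist_eq, sub_sub_sub_cancel_right]
    exact hL.lipschitzOnWith.absolutelyContinuousOnInterval
  obtain ⟨h1, h2⟩ := IsH10.mul_left hac (by simp_rw [funext hd]; exact memLp_const 1) h
  refine ⟨h1, h2.trans (ae_of_all _ fun x => ?_)⟩
  simp only [hd, one_mul]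

/-- Multiplication by `x - a` on the form domain. -/
def shiftMul (hV : IsPotential V) (a : ℝ) (φ : formDomain V) : formDomain V :=
  ⟨fun x => ((x - a : ℝ) : ℂ) * φ.1 x, (isH10_shift_mul a φ.2.isH10).1, by
    have hm : MemLp (fun x : ℝ => ((x - a : ℝ) : ℂ)) ⊤ V := by
      refine memLp_top_of_bound (Continuous.aestronglyMeasurable (by fun_prop)) (1 + |a|) ?_
      filter_upwards [hV.ae_mem] with x hx
      rw [Complex.norm_real, Real.norm_eq_abs]
      refine (abs_sub _ _).trans ?_
      rw [abs_of_pos hx.1]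
      linarith [hx.2]
    exact φ.2.memLp_potential.mul' hm⟩

/-- A crude Poincaré inequality: `|φ|²` is bounded pointwise by `∫ |φ'|²`. -/
theorem one_le_norm_weakDeriv {φ : formDomain V} (h : ‖embed V φ‖ = 1) :
    1 ≤ ‖weakDeriv V φ‖ ^ 2 := by
  have h1 : ‖embed V φ‖ ^ 2 = 1 := by rw [h, one_pow]
  rw [norm_embed_sq] at h1
  rw [← h1, norm_weakDeriv_sq]
  have h2 := integral_mono_ae (φ.2.isH10.memLp.integrable_norm_pow two_ne_zero)
    (integrable_const (∫ t, ‖deriv φ.1 t‖ ^ 2 ∂unitMeasure)) (by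
      filter_upwards [ae_mem_Ioo] with x hx
      exact φ.2.isH10.norm_sq_le (Ioo_subset_Icc_self hx))
  simpa using h2

namespace IsGPMinimizer

theorem norm_weakDeriv_le_energy (hV : IsPotential V) (hγ : 0 ≤ γ) (h : IsGPMinimizer V γ ψ) :
    ‖weakDeriv V (h.elem hV hγ)‖ ^ 2 ≤ h.energy hV hγ := by
  rw [h.energy_eq]
  nlinarith [sq_nonneg ‖potentialEmbed V (h.elem hV hγ)‖, selfEnergy_nonneg (ψ := ψ) hγ]

theorem one_le_energy (hV : IsPotential V) (hγ : 0 ≤ γ) (h : IsGPMinimizer V γ ψ) :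
    1 ≤ h.energy hV hγ :=
  (one_le_norm_weakDeriv (h.norm_elem hV hγ)).trans (h.norm_weakDeriv_le_energy hV hγ)

theorem selfEnergy_le_energy (hV : IsPotential V) (hγ : 0 ≤ γ) (h : IsGPMinimizer V γ ψ) :
    selfEnergy γ ψ ≤ h.energy hV hγ := by
  rw [h.energy_eq]
  nlinarith [sq_nonneg ‖potentialEmbed V (h.elem hV hγ)‖, sq_nonneg ‖weakDeriv V (h.elem hV hγ)‖]

theorem integral_sq (hV : IsPotential V) (hγ : 0 ≤ γ) (h : IsGPMinimizer V γ ψ) :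
    ∫ x, ψ x ^ 2 ∂unitMeasure = 1 := by
  have h1 : ‖embed V (h.elem hV hγ)‖ ^ 2 = 1 := by rw [h.norm_elem, one_pow]
  rw [norm_embed_sq] at h1
  simpa [elem] using h1

theorem half_le_selfEnergy (hV : IsPotential V) (hγ : 0 ≤ γ) (h : IsGPMinimizer V γ ψ) :
    γ / 2 ≤ selfEnergy γ ψ := by
  have h1 := h.integral_sq hV hγ
  have i2 : Integrable (fun x => ψ x ^ 2) unitMeasure :=
    integrable_of_continuousOn (h.continuousOn.pow 2)
  have i4 : Integrable (fun x => ψ x ^ 4) unitMeasure :=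
    integrable_of_continuousOn (h.continuousOn.pow 4)
  have h2 : 2 * ∫ x, ψ x ^ 2 ∂unitMeasure ≤ ∫ x, (ψ x ^ 4 + 1) ∂unitMeasure := by
    rw [← integral_const_mul]
    refine integral_mono (i2.const_mul _) (i4.add (integrable_const 1)) fun x => ?_
    nlinarith [sq_nonneg (ψ x ^ 2 - 1)]
  rw [integral_add i4 (integrable_const 1), h1] at h2
  simp only [integral_const, probReal_univ, smul_eq_mul, mul_one] at h2
  rw [selfEnergy]
  nlinarith

/-- The trial function `(x - a) ψ`, with `a = ∫ x ψ²`, is orthogonal to `ψ`; its energy above the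
ground state energy is `1`, and its norm is bounded below by Heisenberg's uncertainty
principle. -/
theorem exists_trial (hV : IsPotential V) (hγ : 0 ≤ γ) (h : IsGPMinimizer V γ ψ) :
    ∃ χ : formDomain V, ⟪embed V (h.elem hV hγ), embed V χ⟫_ℂ = 0 ∧
    ‖energyMap V γ h.isH10 χ‖ ^ 2 = h.chemicalPotential hV hγ * ‖embed V χ‖ ^ 2 + 1 ∧
    1 ≤ 4 * ‖embed V χ‖ ^ 2 * h.energy hV hγ := by
  set Ψ := h.elem hV hγ with hΨ
  set a : ℝ := ∫ x, x * ψ x ^ 2 ∂unitMeasure with ha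
  set χ := shiftMul hV a Ψ with hχ
  set χ' := shiftMul hV a χ with hχ'
  have dχ := (isH10_shift_mul a Ψ.2.isH10).2
  have dχ' := (isH10_shift_mul a χ.2.isH10).2
  have i2 : Integrable (fun x => ψ x ^ 2) unitMeasure :=
    integrable_of_continuousOn (h.continuousOn.pow 2)
  have ix : Integrable (fun x => x * ψ x ^ 2) unitMeasure :=
    integrable_of_continuousOn (continuousOn_id.mul (h.continuousOn.pow 2))
  have h1 := h.integral_sq hV hγ
  have o1 : ⟪embed V Ψ, embed V χ⟫_ℂ = 0 := by
    refine (inner_toLp Ψ.2.isH10.memLp χ.2.isH10.memLp).trans ?_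
    have : ∀ x, conj (Ψ.1 x) * χ.1 x = ((x * ψ x ^ 2 - a * ψ x ^ 2 : ℝ) : ℂ) := fun x => by
      simp only [hΨ, hχ, elem, shiftMul, Complex.conj_ofReal]
      push_cast
      ring
    simp_rw [this]
    rw [integral_complex_ofReal, integral_sub ix (i2.const_mul _), integral_const_mul, h1, ← ha]
    simp
  have o2 : ⟪embed V χ', embed V Ψ⟫_ℂ = ⟪embed V χ, embed V χ⟫_ℂ := by
    refine (inner_toLp χ'.2.isH10.memLp Ψ.2.isH10.memLp).trans
      (Eq.trans ?_ (inner_toLp χ.2.isH10.memLp χ.2.isH10.memLp).symm)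
    refine integral_congr_ae (ae_of_all _ fun x => ?_)
    simp only [hΨ, hχ', hχ, elem, shiftMul, Complex.conj_ofReal, map_mul]
    ring
  have o3 : ⟪potentialEmbed V χ', potentialEmbed V Ψ⟫_ℂ =
      ⟪potentialEmbed V χ, potentialEmbed V χ⟫_ℂ := by
    refine (inner_toLp χ'.2.memLp_potential Ψ.2.memLp_potential).trans
      (Eq.trans ?_ (inner_toLp χ.2.memLp_potential χ.2.memLp_potential).symm)
    refine integral_congr_ae (ae_of_all _ fun x => ?_)
    simp only [hΨ, hχ', hχ, elem, shiftMul, Complex.conj_ofReal, map_mul]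
    ring
  have o4 : ⟪weightedEmbed V γ h.isH10 χ', weightedEmbed V γ h.isH10 Ψ⟫_ℂ =
      ⟪weightedEmbed V γ h.isH10 χ, weightedEmbed V γ h.isH10 χ⟫_ℂ := by
    refine (inner_toLp (memLp_weighted h.isH10 χ'.2.isH10)
      (memLp_weighted h.isH10 Ψ.2.isH10)).trans (Eq.trans ?_ (inner_toLp
        (memLp_weighted h.isH10 χ.2.isH10) (memLp_weighted h.isH10 χ.2.isH10)).symm)
    refine integral_congr_ae (ae_of_all _ fun x => ?_)
    simp only [hΨ, hχ', hχ, elem, shiftMul, Complex.conj_ofReal, map_mul]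
    ring
  have hint : ∀ {f g : formDomain V}, Integrable (fun x => conj (deriv f.1 x) * deriv g.1 x)
      unitMeasure := fun {f g} =>
    MemLp.integrable_mul (p := 2) (q := 2) f.2.isH10.memLp_deriv.star g.2.isH10.memLp_deriv
  have o5 : (⟪weakDeriv V χ, weakDeriv V χ⟫_ℂ - ⟪weakDeriv V χ', weakDeriv V Ψ⟫_ℂ).re = 1 := by
    have e1 : ⟪weakDeriv V χ, weakDeriv V χ⟫_ℂ = _ :=
      inner_toLp χ.2.isH10.memLp_deriv χ.2.isH10.memLp_deriv
    have e2 : ⟪weakDeriv V χ', weakDeriv V Ψ⟫_ℂ = _ :=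
      inner_toLp χ'.2.isH10.memLp_deriv Ψ.2.isH10.memLp_deriv
    rw [e1, e2, ← integral_sub hint hint, ← h1]
    refine (integral_re (𝕜 := ℂ) (hint.sub hint)).symm.trans (integral_congr_ae ?_)
    filter_upwards [dχ, dχ'] with x h3 h4
    have h3' : deriv χ.1 x = (ψ x : ℂ) + ((x - a : ℝ) : ℂ) * deriv Ψ.1 x := h3
    have h4' : deriv χ'.1 x = χ.1 x + ((x - a : ℝ) : ℂ) * deriv χ.1 x := h4
    have h5 : χ.1 x = ((x - a : ℝ) : ℂ) * (ψ x : ℂ) := rfl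
    change (conj (deriv χ.1 x) * deriv χ.1 x - conj (deriv χ'.1 x) * deriv Ψ.1 x).re = _
    rw [h4', h3', h5]
    simp only [map_add, map_mul, Complex.conj_ofReal, Complex.sub_re,
      Complex.add_re, Complex.mul_re, Complex.ofReal_re, Complex.ofReal_im, Complex.conj_re,
      Complex.conj_im, Complex.add_im, Complex.mul_im]
    ring
  have hn : ∀ {E : Type} [NormedAddCommGroup E] [InnerProductSpace ℂ E] (v : E),
      ‖v‖ ^ 2 = (⟪v, v⟫_ℂ).re := fun v => norm_sq_eq_re_inner (𝕜 := ℂ) v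
  have hE := h.inner_energyMap hV hγ χ'
  rw [DisorderedBEC.inner_energyMap, ← hΨ, o2, o3, o4] at hE
  refine ⟨χ, o1, ?_, ?_⟩
  · have hE' := congrArg Complex.re hE
    rw [Complex.re_ofReal_mul, ← hn, Complex.add_re, Complex.add_re, ← hn, ← hn] at hE'
    rw [Complex.sub_re, ← hn] at o5
    rw [norm_energyMap_sq]
    linarith
  · have p1 := inner_weakDeriv_add χ Ψ
    have p2 : ⟪weakDeriv V χ, embed V Ψ⟫_ℂ =
        ⟪embed V Ψ, embed V Ψ⟫_ℂ + ⟪weakDeriv V Ψ, embed V χ⟫_ℂ := by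
      have e1 : ⟪weakDeriv V χ, embed V Ψ⟫_ℂ = _ :=
        inner_toLp χ.2.isH10.memLp_deriv Ψ.2.isH10.memLp
      have e2 : ⟪embed V Ψ, embed V Ψ⟫_ℂ = _ := inner_toLp Ψ.2.isH10.memLp Ψ.2.isH10.memLp
      have e3 : ⟪weakDeriv V Ψ, embed V χ⟫_ℂ = _ :=
        inner_toLp Ψ.2.isH10.memLp_deriv χ.2.isH10.memLp
      rw [e1, e2, e3, ← integral_add]
      · refine integral_congr_ae ?_
        filter_upwards [dχ] with x h3
        have h3' : deriv χ.1 x = Ψ.1 x + ((x - a : ℝ) : ℂ) * deriv Ψ.1 x := h3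
        have h5 : χ.1 x = ((x - a : ℝ) : ℂ) * Ψ.1 x := rfl
        rw [h3', h5, map_add, map_mul, Complex.conj_ofReal]
        ring
      · exact MemLp.integrable_mul (p := 2) (q := 2) Ψ.2.isH10.memLp.star Ψ.2.isH10.memLp
      · exact MemLp.integrable_mul (p := 2) (q := 2) Ψ.2.isH10.memLp_deriv.star χ.2.isH10.memLp
    rw [p2] at p1
    have p3 := congrArg Complex.re p1
    rw [Complex.add_re, Complex.add_re, ← hn, h.norm_elem] at p3
    have p4 : (⟪weakDeriv V Ψ, embed V χ⟫_ℂ).re = (⟪embed V χ, weakDeriv V Ψ⟫_ℂ).re :=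
      inner_re_symm (𝕜 := ℂ) _ _
    have p5 : |(⟪embed V χ, weakDeriv V Ψ⟫_ℂ).re| ≤ ‖embed V χ‖ * ‖weakDeriv V Ψ‖ :=
      (Complex.abs_re_le_norm _).trans (norm_inner_le_norm _ _)
    rw [p4, Complex.zero_re] at p3
    have p6 : 1 ≤ 2 * (‖embed V χ‖ * ‖weakDeriv V Ψ‖) := by
      have := (abs_le.1 p5).1
      linarith
    have p7 : 1 ≤ 4 * ‖embed V χ‖ ^ 2 * ‖weakDeriv V Ψ‖ ^ 2 := by nlinarith
    have p8 := h.norm_weakDeriv_le_energy hV hγ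
    exact p7.trans (mul_le_mul_of_nonneg_left p8 (by positivity))

/-- There is a normalized first excited state. Its energy is at most `4 e₀` above `e₀`. -/
theorem exists_excited (hV : IsPotential V) (hγ : 0 ≤ γ) (h : IsGPMinimizer V γ ψ) :
    ∃ φ : formDomain V, ⟪embed V (h.elem hV hγ), embed V φ⟫_ℂ = 0 ∧
    ‖embed V φ‖ = 1 ∧ (∀ χ : formDomain V, ⟪embed V (h.elem hV hγ), embed V χ⟫_ℂ = 0 →
      ‖energyMap V γ h.isH10 φ‖ ^ 2 * ‖embed V χ‖ ^ 2 ≤ ‖energyMap V γ h.isH10 χ‖ ^ 2) ∧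
    ‖energyMap V γ h.isH10 φ‖ ^ 2 ≤ h.chemicalPotential hV hγ + 4 * h.energy hV hγ := by
  obtain ⟨χ, h1, h2, h3⟩ := h.exists_trial hV hγ
  have h0 : ‖embed V χ‖ ≠ 0 := by
    intro h0
    rw [h0] at h3
    norm_num at h3
  have hpos : 0 < ‖embed V χ‖ ^ 2 := by positivity
  obtain ⟨φ, f1, f2, f3⟩ := exists_minimizer_of_compact (energyMap V γ h.isH10) (embed V)
    (embed V (h.elem hV hγ)) (exists_subseq_tendsto_embed h.isH10)
    (fun φ k v hk hv => exists_energyMap_eq h.isH10 φ k v hk hv hV)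
    ⟨((‖embed V χ‖⁻¹ : ℝ) : ℂ) • χ, by rw [map_smul, inner_smul_right, h1, mul_zero], by
      rw [map_smul, norm_smul, Complex.norm_real, norm_inv, norm_norm, inv_mul_cancel₀ h0]⟩
  refine ⟨φ, f1, f2, f3, ?_⟩
  have f4 := f3 χ h1
  rw [h2] at f4
  refine le_of_mul_le_mul_right (f4.trans ?_) hpos
  nlinarith

end IsGPMinimizer

end

/-! ### Unique continuation and simplicity of the ground state -/

section

variable {V : Measure ℝ} {γ : ℝ} {ψ : ℝ → ℝ}

/-- The tent of height `b - a` at `a`, which decreases to `0` at `b` with slope `-1` and to the left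
of `a` is supported in `[a/2, a]`. -/
def tent (a b x : ℝ) : ℝ := max 0 (min ((b - a) * (2 * x / a - 1)) (b - x))

theorem tent_of_mem {a b x : ℝ} (ha : 0 < a) (hab : a ≤ b) (hx : x ∈ Icc a b) :
    tent a b x = b - x := by
  have h1 : 1 ≤ 2 * x / a - 1 := by
    rw [le_sub_iff_add_le, le_div_iff₀ ha]; linarith [hx.1]
  have h2 : b - x ≤ (b - a) * (2 * x / a - 1) := by nlinarith [hx.1]
  rw [tent, min_eq_right h2, max_eq_right (by linarith [hx.2])]

theorem tent_of_ge {a b x : ℝ} (hx : b ≤ x) : tent a b x = 0 :=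
  max_eq_left ((min_le_right _ _).trans (by linarith))

theorem tent_of_le {a b x : ℝ} (ha : 0 < a) (hab : a ≤ b) (hx : x ≤ a / 2) : tent a b x = 0 := by
  refine max_eq_left ((min_le_left _ _).trans ?_)
  have : 2 * x / a - 1 ≤ 0 := by
    rw [sub_nonpos, div_le_one ha]; linarith
  exact mul_nonpos_of_nonneg_of_nonpos (by linarith) this

theorem inFormDomain_tent (hV : IsPotential V) {a b : ℝ} (ha : 0 < a) (hab : a ≤ b) (hb : b < 1) :
    InFormDomain V fun x => (tent a b x : ℂ) := by
  have h1 : LipschitzWith (Real.toNNReal |(b - a) * (2 / a)|)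
      (fun x : ℝ => (b - a) * (2 * x / a - 1)) := by
    refine LipschitzWith.of_dist_le_mul fun x y => ?_
    rw [Real.coe_toNNReal _ (abs_nonneg _), Real.dist_eq, Real.dist_eq, ← abs_mul]
    refine le_of_eq (congrArg _ ?_)
    ring
  have h2 : LipschitzWith 1 (fun x : ℝ => b - x) := by
    refine LipschitzWith.of_dist_le_mul fun x y => ?_
    rw [NNReal.coe_one, one_mul, Real.dist_eq, Real.dist_eq, abs_sub_comm x y]
    refine le_of_eq (congrArg _ ?_)
    ring
  refine inFormDomain_of_lipschitz hV
    (Complex.isometry_ofReal.lipschitz.comp ((h1.min h2).const_max 0))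
    (K := Icc (a / 2) b) isCompact_Icc (fun x hx => ⟨by linarith [hx.1], by linarith [hx.2]⟩)
    fun x hx => ?_
  have : tent a b x = 0 := by
    rcases le_or_gt x (a / 2) with h | h
    · exact tent_of_le ha hab h
    · refine tent_of_ge (le_of_not_ge fun h' => hx ⟨h.le, h'⟩)
  exact congrArg _ this

theorem deriv_eq_zero_of_forall_Icc {φ : ℝ → ℂ} {a x : ℝ} (h : ∀ y ∈ Icc 0 a, φ y = 0)
    (hx : x ∈ Ioo 0 a) : deriv φ x = 0 := by
  have : φ =ᶠ[𝓝 x] fun _ => 0 := by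
    filter_upwards [Icc_mem_nhds hx.1 hx.2] with y hy using h y hy
  rw [this.deriv_eq, deriv_const]

/-- Testing against the tent recovers the value at `b` of a function that vanishes on `[0,a]`. -/
theorem inner_weakDeriv_tent (hV : IsPotential V) {a b : ℝ} (ha : 0 < a) (hab : a ≤ b) (hb : b < 1)
    (φ : formDomain V) (hφ : ∀ x ∈ Icc 0 a, φ.1 x = 0) :
    ⟪weakDeriv V ⟨_, inFormDomain_tent hV ha hab hb⟩, weakDeriv V φ⟫_ℂ = -φ.1 b := by
  have e1 := inner_toLp (inFormDomain_tent hV ha hab hb).isH10.memLp_deriv φ.2.isH10.memLp_deriv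
  refine e1.trans ?_
  have h2 : ∀ᵐ x ∂unitMeasure, conj (deriv (fun x => (tent a b x : ℂ)) x) * deriv φ.1 x =
      (Ioc a b).indicator (fun x => -deriv φ.1 x) x := by
    rw [ae_unitMeasure_iff]
    have ha' : ∀ᵐ x : ℝ, x ≠ a := by simp [ae_iff, measure_singleton]
    have hb' : ∀ᵐ x : ℝ, x ≠ b := by simp [ae_iff, measure_singleton]
    filter_upwards [ha', hb'] with x hxa hxb hx
    rcases lt_or_gt_of_ne hxa with h | h
    · rw [deriv_eq_zero_of_forall_Icc hφ ⟨hx.1, h⟩, mul_zero, indicator_of_notMem]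
      exact fun h' => absurd h'.1 (not_lt.2 h.le)
    · rcases lt_or_gt_of_ne hxb with h' | h'
      · have : deriv (fun x => (tent a b x : ℂ)) x = -1 := by
          have h3 : (fun x => (tent a b x : ℂ)) =ᶠ[𝓝 x] fun x => ((b - x : ℝ) : ℂ) := by
            filter_upwards [Icc_mem_nhds h h'] with y hy
            rw [tent_of_mem ha hab hy]
          rw [h3.deriv_eq]
          have := ((hasDerivAt_id x).const_sub b).ofReal_comp
          simpa using this.deriv
        rw [this, indicator_of_mem (show x ∈ Ioc a b from ⟨h, h'.le⟩)]
        simp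
      · have : deriv (fun x => (tent a b x : ℂ)) x = 0 := by
          have h3 : (fun x => (tent a b x : ℂ)) =ᶠ[𝓝 x] fun x => 0 := by
            filter_upwards [Ioi_mem_nhds h'] with y hy
            rw [tent_of_ge (le_of_lt hy), Complex.ofReal_zero]
          rw [h3.deriv_eq, deriv_const]
        rw [this, map_zero, zero_mul, indicator_of_notMem]
        exact fun h'' => absurd h''.2 (not_le.2 h')
  rw [integral_congr_ae h2, integral_indicator measurableSet_Ioc, integral_neg, unitMeasure,
    Measure.restrict_restrict measurableSet_Ioc,
    inter_eq_left.2 (Ioc_subset_Icc_self.trans (Icc_subset_Icc ha.le hb.le)),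
    ← intervalIntegral.integral_of_le hab, ← φ.2.isH10.sub_eq_integral_deriv
      ⟨ha.le, hab.trans hb.le⟩ ⟨ha.le.trans hab, hb.le⟩, hφ a ⟨ha.le, le_rfl⟩, sub_zero]

/-- The equation `(-∂² + V + γ ψ²) φ = lam φ` in weak form. -/
def WeakSolution (γ : ℝ) (hψ : IsH10 fun x => (ψ x : ℂ)) (lam : ℝ) (φ : formDomain V) : Prop :=
  ∀ χ : formDomain V, ⟪energyMap V γ hψ χ, energyMap V γ hψ φ⟫_ℂ =
    lam * ⟪embed V χ, embed V φ⟫_ℂ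

theorem norm_integral_le_of_support {μ : Measure ℝ} {f : ℝ → ℂ} {S : Set ℝ} (hS : MeasurableSet S)
    (hfin : μ S ≠ ⊤) {C : ℝ} (h : ∀ x ∈ S, ‖f x‖ ≤ C) (h0 : ∀ᵐ x ∂μ, x ∉ S → f x = 0) :
    ‖∫ x, f x ∂μ‖ ≤ C * μ.real S := by
  have h1 : ∫ x, f x ∂μ = ∫ x in S, f x ∂μ := by
    rw [← integral_indicator hS]
    refine integral_congr_ae ?_
    filter_upwards [h0] with x hx
    by_cases hxS : x ∈ S
    · rw [indicator_of_mem hxS]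
    · rw [indicator_of_notMem hxS, hx hxS]
  rw [h1]
  exact norm_setIntegral_le_of_norm_le_const hfin.lt_top h

/-- One step of unique continuation: a solution vanishing on `[0,a]` vanishes on `[0,a+δ]`, with
`δ` uniform in `a` away from the end points. -/
theorem WeakSolution.exists_step (hV : IsPotential V) (hγ : 0 ≤ γ) {hψ : IsH10 fun x => (ψ x : ℂ)}
    {lam : ℝ} {φ : formDomain V} (hφ : WeakSolution γ hψ lam φ) {x₀ b : ℝ} (hx₀ : 0 < x₀)
    (hb : b < 1) : ∃ δ > 0, ∀ a ∈ Icc x₀ b, (∀ x ∈ Icc 0 a, φ.1 x = 0) →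
      ∀ x ∈ Icc 0 (a + δ), φ.1 x = 0 := by
  set b' := (1 + b) / 2 with hb'
  obtain ⟨B, hB⟩ := isCompact_Icc.exists_bound_of_continuousOn hψ.continuousOn
  have hcpt : V (Icc x₀ b') < ⊤ :=
    hV.lt_top _ isCompact_Icc fun x hx => ⟨hx₀.trans_le hx.1, by linarith [hx.2]⟩
  set C := V.real (Icc x₀ b') + γ * B ^ 2 + |lam| with hC
  have hC0 : 0 ≤ C := by positivity
  refine ⟨min ((1 - b) / 2) (1 / (2 * (C + 1))), lt_min (by linarith) (by positivity), ?_⟩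
  intro a ha hzero
  set δ := min ((1 - b) / 2) (1 / (2 * (C + 1))) with hδ
  have hδ0 : 0 < δ := lt_min (by linarith) (by positivity)
  have hδ1 : a + δ ≤ b' := by
    have := min_le_left ((1 - b) / 2) (1 / (2 * (C + 1)))
    have := ha.2
    linarith
  have ha0 : 0 < a := hx₀.trans_le ha.1
  have hsub : Icc a (a + δ) ⊆ Icc 0 1 := fun x hx => ⟨by linarith [hx.1], by linarith [hx.2]⟩
  obtain ⟨x₁, hx₁, hmax⟩ := isCompact_Icc.exists_isMaxOn (nonempty_Icc.2 (by linarith))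
    (φ.2.isH10.continuousOn.norm.mono hsub)
  have hmax' : ∀ x ∈ Icc a (a + δ), ‖φ.1 x‖ ≤ ‖φ.1 x₁‖ := fun x hx => hmax hx
  suffices hM : ‖φ.1 x₁‖ = 0 by
    intro x hx
    rcases le_or_gt x a with h | h
    · exact hzero x ⟨hx.1, h⟩
    · exact norm_le_zero_iff.1 ((hmax' x ⟨h.le, hx.2⟩).trans hM.le)
  have hx1 : x₁ < 1 := by linarith [hx₁.2]
  set χ : formDomain V := ⟨_, inFormDomain_tent hV ha0 hx₁.1 hx1⟩ with hχ
  set D := (x₁ - a) * ‖φ.1 x₁‖ with hD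
  have hD0 : 0 ≤ D := mul_nonneg (by linarith [hx₁.1]) (norm_nonneg _)
  have hb1 : ∀ x ∈ Icc a x₁, ‖conj (χ.1 x) * φ.1 x‖ ≤ D := by
    intro x hx
    rw [norm_mul, RCLike.norm_conj, hD]
    refine mul_le_mul ?_ (hmax' x ⟨hx.1, hx.2.trans hx₁.2⟩) (norm_nonneg _) (by linarith [hx₁.1])
    simp only [hχ, Complex.norm_real, tent_of_mem ha0 hx₁.1 hx, Real.norm_eq_abs]
    rw [abs_of_nonneg (by linarith [hx.2])]
    linarith [hx.1]
  have hb2 : ∀ x ∈ Ioo (0 : ℝ) 1, x ∉ Icc a x₁ → conj (χ.1 x) * φ.1 x = 0 := by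
    intro x hx hx'
    rcases le_or_gt x a with h | h
    · rw [hzero x ⟨hx.1.le, h⟩, mul_zero]
    · have : x₁ ≤ x := le_of_not_ge fun h' => hx' ⟨h.le, h'⟩
      simp only [hχ, tent_of_ge this, Complex.ofReal_zero, map_zero, zero_mul]
  have i1 := inner_weakDeriv_tent hV ha0 hx₁.1 hx1 φ hzero
  have i2 : ⟪potentialEmbed V χ, potentialEmbed V φ⟫_ℂ = _ :=
    inner_toLp χ.2.memLp_potential φ.2.memLp_potential
  have i3 : ⟪weightedEmbed V γ hψ χ, weightedEmbed V γ hψ φ⟫_ℂ = _ :=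
    inner_toLp (memLp_weighted hψ χ.2.isH10) (memLp_weighted hψ φ.2.isH10)
  have i4 : ⟪embed V χ, embed V φ⟫_ℂ = _ := inner_toLp χ.2.isH10.memLp φ.2.isH10.memLp
  have hvol : unitMeasure.real (Icc a x₁) ≤ 1 := measureReal_le_one
  have n2 : ‖⟪potentialEmbed V χ, potentialEmbed V φ⟫_ℂ‖ ≤ D * V.real (Icc x₀ b') := by
    rw [i2]
    have hs : Icc a x₁ ⊆ Icc x₀ b' := Icc_subset_Icc ha.1 (hx₁.2.trans hδ1)
    refine (norm_integral_le_of_support measurableSet_Icc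
      ((measure_mono hs).trans_lt hcpt).ne hb1 ?_).trans
      (mul_le_mul_of_nonneg_left (measureReal_mono hs hcpt.ne) hD0)
    filter_upwards [hV.ae_mem] with x hx using hb2 x hx
  have n4 : ‖⟪embed V χ, embed V φ⟫_ℂ‖ ≤ D := by
    rw [i4]
    refine (norm_integral_le_of_support measurableSet_Icc (measure_ne_top _ _) hb1 ?_).trans
      (mul_le_of_le_one_right hD0 hvol)
    filter_upwards [ae_mem_Ioo] with x hx using hb2 x hx
  have hrw : ∀ x, conj (((√γ : ℝ) : ℂ) * (ψ x : ℂ) * χ.1 x) *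
      (((√γ : ℝ) : ℂ) * (ψ x : ℂ) * φ.1 x) = ((γ * ψ x ^ 2 : ℝ) : ℂ) * (conj (χ.1 x) * φ.1 x) := by
    intro x
    simp only [map_mul, Complex.conj_ofReal]
    have : (γ : ℂ) = ((√γ : ℝ) : ℂ) * ((√γ : ℝ) : ℂ) := by
      rw [← Complex.ofReal_mul, Real.mul_self_sqrt hγ]
    push_cast
    rw [this]
    ring
  have n3 : ‖⟪weightedEmbed V γ hψ χ, weightedEmbed V γ hψ φ⟫_ℂ‖ ≤ D * (γ * B ^ 2) := by
    rw [i3]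
    simp_rw [hrw]
    refine (norm_integral_le_of_support (C := γ * B ^ 2 * D) measurableSet_Icc
      (measure_ne_top _ (Icc a x₁)) (fun x hx => ?_) ?_).trans
      ((mul_le_of_le_one_right (by positivity) hvol).trans (le_of_eq (mul_comm _ _)))
    · rw [norm_mul]
      refine mul_le_mul ?_ (hb1 x hx) (norm_nonneg _) (by positivity)
      rw [Complex.norm_real, Real.norm_of_nonneg (by positivity)]
      refine mul_le_mul_of_nonneg_left ?_ hγ
      have := hB x (hsub ⟨hx.1, hx.2.trans hx₁.2⟩)
      rw [Complex.norm_real, Real.norm_eq_abs] at this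
      rw [← sq_abs]
      exact pow_le_pow_left₀ (abs_nonneg _) this 2
    · filter_upwards [ae_mem_Ioo] with x hx hx'
      rw [hb2 x hx hx', mul_zero]
  have heq := hφ χ
  rw [inner_energyMap, i1] at heq
  have heq' : φ.1 x₁ = ⟪potentialEmbed V χ, potentialEmbed V φ⟫_ℂ +
      ⟪weightedEmbed V γ hψ χ, weightedEmbed V γ hψ φ⟫_ℂ - lam * ⟪embed V χ, embed V φ⟫_ℂ := by
    rw [← heq]; ring
  have hfin : ‖φ.1 x₁‖ ≤ D * C := by
    conv_lhs => rw [heq']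
    refine (norm_sub_le _ _).trans ?_
    have := norm_add_le ⟪potentialEmbed V χ, potentialEmbed V φ⟫_ℂ
      ⟪weightedEmbed V γ hψ χ, weightedEmbed V γ hψ φ⟫_ℂ
    have h5 : ‖(lam : ℂ) * ⟪embed V χ, embed V φ⟫_ℂ‖ ≤ |lam| * D := by
      rw [norm_mul, Complex.norm_real, Real.norm_eq_abs]
      exact mul_le_mul_of_nonneg_left n4 (abs_nonneg _)
    rw [hC]
    nlinarith
  have hsmall : (x₁ - a) * C ≤ 1 / 2 := by
    have h1 : x₁ - a ≤ 1 / (2 * (C + 1)) := by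
      have := min_le_right ((1 - b) / 2) (1 / (2 * (C + 1)))
      linarith [hx₁.2]
    rw [le_div_iff₀ (by positivity)] at h1
    nlinarith [hx₁.1]
  have := norm_nonneg (φ.1 x₁)
  rw [hD] at hfin
  nlinarith

/-- Unique continuation to the right. -/
theorem WeakSolution.eq_zero_of_forall_Icc (hV : IsPotential V) (hγ : 0 ≤ γ)
    {hψ : IsH10 fun x => (ψ x : ℂ)} {lam : ℝ} {φ : formDomain V} (hφ : WeakSolution γ hψ lam φ)
    {x₀ : ℝ} (hx₀ : 0 < x₀) (h : ∀ x ∈ Icc 0 x₀, φ.1 x = 0) {x : ℝ} (hx : x ∈ Icc (0 : ℝ) 1) :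
    φ.1 x = 0 := by
  rcases hx.2.eq_or_lt with rfl | hx1
  · exact φ.2.isH10.zero_right
  rcases le_or_gt x x₀ with hxx | hxx
  · exact h x ⟨hx.1, hxx⟩
  obtain ⟨δ, hδ, hstep⟩ := hφ.exists_step hV hγ hx₀ hx1
  have hind : ∀ n : ℕ, ∀ y ∈ Icc 0 (min (x₀ + n * δ) x), φ.1 y = 0 := by
    intro n
    induction n with
    | zero => exact fun y hy => h y ⟨hy.1, hy.2.trans ((min_le_left _ _).trans (by simp))⟩
    | succ n ih =>
      intro y hy
      refine hstep (min (x₀ + n * δ) x) ⟨le_min ?_ hxx.le, min_le_right _ _⟩ ih y ⟨hy.1, ?_⟩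
      · have : 0 ≤ (n : ℝ) * δ := by positivity
        linarith
      · refine hy.2.trans ?_
        rw [← min_add_add_right]
        refine min_le_min ?_ (by linarith)
        push_cast
        linarith
  obtain ⟨n, hn⟩ := exists_nat_ge ((x - x₀) / δ)
  rw [div_le_iff₀ hδ] at hn
  exact hind n x ⟨hx.1, le_min (by linarith) le_rfl⟩

/-- The restriction of an element of the form domain to the right of one of its zeros. -/
def restrictRight {φ : formDomain V} {a : ℝ} (ha : a ∈ Icc (0 : ℝ) 1) (h : φ.1 a = 0) :
    formDomain V :=
  ⟨(Ioi a).indicator φ.1, (φ.2.isH10.indicator_Ioi ha h).1,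
    φ.2.memLp_potential.indicator measurableSet_Ioi⟩

namespace WeakSolution

variable {hψ : IsH10 fun x => (ψ x : ℂ)} {lam : ℝ} {φ χ : formDomain V}

theorem norm_sq (h : WeakSolution γ hψ lam φ) :
    ‖energyMap V γ hψ φ‖ ^ 2 = lam * ‖embed V φ‖ ^ 2 := by
  have := congrArg Complex.re (h φ)
  rw [Complex.re_ofReal_mul] at this
  rw [norm_sq_eq_re_inner (𝕜 := ℂ), norm_sq_eq_re_inner (𝕜 := ℂ) (embed V φ)]
  exact this

theorem add (h : WeakSolution γ hψ lam φ) (h' : WeakSolution γ hψ lam χ) :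
    WeakSolution γ hψ lam (φ + χ) := fun η => by
  rw [map_add, map_add, inner_add_right, inner_add_right, h, h', mul_add]

theorem smul (c : ℂ) (h : WeakSolution γ hψ lam φ) : WeakSolution γ hψ lam (c • φ) := fun η => by
  rw [map_smul, map_smul, inner_smul_right, inner_smul_right, h, mul_left_comm]

end WeakSolution

theorem IsGPMinimizer.weakSolution_of_eq (hV : IsPotential V) (hγ : 0 ≤ γ)
    (h : IsGPMinimizer V γ ψ) {φ : formDomain V} (heq : ‖energyMap V γ h.isH10 φ‖ ^ 2 =
      h.chemicalPotential hV hγ * ‖embed V φ‖ ^ 2) :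
    WeakSolution γ h.isH10 (h.chemicalPotential hV hγ) φ := fun _ =>
  inner_eq_of_minimizer _ _ (fun _ => h.le_energyMap hV hγ _) heq

/-- If a ground state vanishes at an interior point, its part to the right of this point is a
ground state, too, and then vanishes by unique continuation. -/
theorem IsGPMinimizer.eq_zero_right (hV : IsPotential V) (hγ : 0 ≤ γ)
    (h : IsGPMinimizer V γ ψ) {φ : formDomain V}
    (hφ : WeakSolution γ h.isH10 (h.chemicalPotential hV hγ) φ) {x₀ : ℝ} (hx₀ : x₀ ∈ Ioo (0 : ℝ) 1)
    (h0 : φ.1 x₀ = 0) {x : ℝ} (hx : x ∈ Icc x₀ 1) : φ.1 x = 0 := by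
  have hx₀' : x₀ ∈ Icc (0 : ℝ) 1 := Ioo_subset_Icc_self hx₀
  set R : formDomain V := restrictRight hx₀' h0 with hR
  set L : formDomain V := φ - R with hL
  have hLR : φ = L + R := by rw [hL]; abel
  have hpt : ∀ x, conj (L.1 x) * R.1 x = 0 := fun x => by
    simp only [hL, hR, restrictRight, Submodule.coe_sub, Pi.sub_apply]
    by_cases hx : x ∈ Ioi x₀
    · rw [indicator_of_mem hx, sub_self, map_zero, zero_mul]
    · rw [indicator_of_notMem hx, mul_zero]
  have o1 : ⟪weakDeriv V L, weakDeriv V R⟫_ℂ = 0 := by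
    refine (inner_toLp L.2.isH10.memLp_deriv R.2.isH10.memLp_deriv).trans ?_
    refine integral_eq_zero_of_ae ?_
    have e1 := (φ.2.isH10.indicator_Ioi hx₀' h0).2
    have e2 := (L.2.isH10.add R.2.isH10).2
    filter_upwards [e1, e2] with x h1 h2
    have h1' : deriv R.1 x = (Ioi x₀).indicator (deriv φ.1) x := h1
    have h2' : deriv φ.1 x = deriv L.1 x + deriv R.1 x := by
      have : φ.1 = L.1 + R.1 := congrArg Subtype.val hLR
      rw [this]; exact h2
    by_cases hx : x ∈ Ioi x₀
    · rw [indicator_of_mem hx] at h1'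
      have : deriv L.1 x = 0 := by rw [h2'] at h1'; simpa using h1'
      simp [this]
    · rw [indicator_of_notMem hx] at h1'
      simp [h1']
  have o2 : ⟪potentialEmbed V L, potentialEmbed V R⟫_ℂ = 0 := by
    refine (inner_toLp L.2.memLp_potential R.2.memLp_potential).trans ?_
    simp [hpt]
  have o3 : ⟪weightedEmbed V γ h.isH10 L, weightedEmbed V γ h.isH10 R⟫_ℂ = 0 := by
    refine (inner_toLp (memLp_weighted h.isH10 L.2.isH10)
      (memLp_weighted h.isH10 R.2.isH10)).trans (integral_eq_zero_of_ae (ae_of_all _ fun x => ?_))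
    have : ∀ c : ℂ, conj (c * L.1 x) * (c * R.1 x) = conj c * c * (conj (L.1 x) * R.1 x) :=
      fun c => by rw [map_mul]; ring
    simp only [this, hpt, mul_zero, Pi.zero_apply]
  have o4 : ⟪embed V L, embed V R⟫_ℂ = 0 := by
    refine (inner_toLp L.2.isH10.memLp R.2.isH10.memLp).trans ?_
    simp [hpt]
  have p1 := hφ.norm_sq
  have p2 : ‖energyMap V γ h.isH10 φ‖ ^ 2 =
      ‖energyMap V γ h.isH10 L‖ ^ 2 + ‖energyMap V γ h.isH10 R‖ ^ 2 := by
    conv_lhs => rw [hLR]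
    rw [map_add, norm_add_sq (𝕜 := ℂ), DisorderedBEC.inner_energyMap, o1, o2, o3]
    simp
  have p3 : ‖embed V φ‖ ^ 2 = ‖embed V L‖ ^ 2 + ‖embed V R‖ ^ 2 := by
    conv_lhs => rw [hLR]
    rw [map_add, norm_add_sq (𝕜 := ℂ), o4]
    simp
  have p4 := h.le_energyMap hV hγ L
  have p5 := h.le_energyMap hV hγ R
  have hRsol := h.weakSolution_of_eq hV hγ (φ := R) (by
    refine le_antisymm ?_ p5
    rw [p2, p3] at p1
    linarith)
  rcases hx.1.eq_or_lt with rfl | hlt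
  · exact h0
  have := hRsol.eq_zero_of_forall_Icc hV hγ hx₀.1 (fun y hy => indicator_of_notMem (by
    simpa using hy.2) _) (x := x) ⟨hx₀.1.le.trans hx.1, hx.2⟩
  simpa only [hR, restrictRight, indicator_of_mem (show x ∈ Ioi x₀ from hlt)] using this

/-- The ground state of the mean-field Hamiltonian is simple. -/
theorem IsGPMinimizer.ground_state_unique (hV : IsPotential V) (hγ : 0 ≤ γ)
    (h : IsGPMinimizer V γ ψ) {φ : formDomain V}
    (hφ : WeakSolution γ h.isH10 (h.chemicalPotential hV hγ) φ)
    (horth : ⟪embed V (h.elem hV hγ), embed V φ⟫_ℂ = 0) : embed V φ = 0 := by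
  set Ψ := h.elem hV hγ with hΨ
  have hΨsol : WeakSolution γ h.isH10 (h.chemicalPotential hV hγ) Ψ := h.inner_energyMap hV hγ
  obtain ⟨y, hy, hyne⟩ : ∃ y ∈ Icc (0 : ℝ) 1, Ψ.1 y ≠ 0 := by
    by_contra! hc
    have h1 : embed V Ψ = 0 := by
      rw [← norm_eq_zero, ← sq_eq_zero_iff, norm_embed_sq]
      refine integral_eq_zero_of_ae ?_
      filter_upwards [ae_mem_Ioo] with x hx
      simp [hc x (Ioo_subset_Icc_self hx)]
    have := h.norm_elem hV hγ
    rw [← hΨ, h1, norm_zero] at this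
    exact zero_ne_one this
  have hy0 : 0 < y := lt_of_le_of_ne hy.1 fun h0 => hyne (by rw [← h0]; exact Ψ.2.isH10.zero_left)
  set κ := φ.1 y / Ψ.1 y with hκ
  have hprop : ∀ x ∈ Ioo 0 y, φ.1 x = κ * Ψ.1 x ∧ ∀ z ∈ Icc x 1, φ.1 z = κ * Ψ.1 z := by
    intro x hx
    have hx' : x ∈ Ioo (0 : ℝ) 1 := ⟨hx.1, hx.2.trans_le hy.2⟩
    have hne : Ψ.1 x ≠ 0 := fun h0 => hyne (h.eq_zero_right hV hγ hΨsol hx' h0 ⟨hx.2.le, hy.2⟩)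
    set c := φ.1 x / Ψ.1 x with hc
    have hz := fun z (hz : z ∈ Icc x 1) => h.eq_zero_right hV hγ (hφ.add (hΨsol.smul (-c))) hx' (by
      simp only [Submodule.coe_add, Submodule.coe_smul, Pi.add_apply, Pi.smul_apply, smul_eq_mul]
      rw [hc]; field_simp; ring) hz
    have hz' : ∀ z ∈ Icc x 1, φ.1 z = c * Ψ.1 z := fun z hz1 => by
      have := hz z hz1
      simp only [Submodule.coe_add, Submodule.coe_smul, Pi.add_apply, Pi.smul_apply,
        smul_eq_mul] at this
      linear_combination this
    have hcκ : c = κ := by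
      rw [hκ, hz' y ⟨hx.2.le, hy.2⟩, mul_div_cancel_right₀ _ hyne]
    rw [hcκ] at hz'
    exact ⟨hz' x ⟨le_rfl, hx'.2.le⟩, hz'⟩
  have heq : embed V φ = κ • embed V Ψ := by
    rw [← map_smul, ← sub_eq_zero, ← map_sub, ← norm_eq_zero, ← sq_eq_zero_iff, norm_embed_sq]
    refine integral_eq_zero_of_ae ?_
    filter_upwards [ae_mem_Ioo] with x hx
    have : φ.1 x = κ * Ψ.1 x := by
      rcases lt_or_ge x y with hxy | hxy
      · exact (hprop x ⟨hx.1, hxy⟩).1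
      · exact (hprop (y / 2) ⟨by linarith, by linarith⟩).2 x ⟨by linarith, hx.2.le⟩
    simp [this]
  rw [heq, inner_smul_right, inner_self_eq_norm_sq_to_K, h.norm_elem] at horth
  rw [heq]
  have : κ = 0 := by simpa using horth
  rw [this, zero_smul]

end

/-! ### The two lowest eigenvalues of the mean-field Hamiltonian -/

section

variable {V : Measure ℝ} {γ : ℝ} {ψ : ℝ → ℝ}

theorem solvesEigenEquation_iff (hγ : 0 ≤ γ) (hψ : IsH10 fun x => (ψ x : ℂ)) (E : ℝ)
    (φ : formDomain V) : SolvesEigenEquation V γ ψ E φ.1 ↔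
      WeakSolution γ hψ (E + selfEnergy γ ψ) φ := by
  have key : ∀ χ : formDomain V, meanFieldForm V γ ψ χ.1 φ.1 =
      E * ∫ x, conj (χ.1 x) * φ.1 x ∂unitMeasure ↔
      ⟪energyMap V γ hψ χ, energyMap V γ hψ φ⟫_ℂ =
        ((E + selfEnergy γ ψ : ℝ) : ℂ) * ⟪embed V χ, embed V φ⟫_ℂ := fun χ => by
    have h4 : ⟪embed V χ, embed V φ⟫_ℂ = _ := inner_toLp χ.2.isH10.memLp φ.2.isH10.memLp
    rw [meanFieldForm_eq hγ hψ, ← h4, ← selfEnergy, Complex.ofReal_add, add_mul, sub_eq_iff_eq_add]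
  exact ⟨fun h χ => (key χ).1 (h.eq χ.1 χ.2), fun h => ⟨φ.2, fun χ hχ => (key ⟨χ, hχ⟩).2 (h _)⟩⟩

theorem SolvesEigenEquation.le (hV : IsPotential V) (hγ : 0 ≤ γ) (h : IsGPMinimizer V γ ψ)
    {E : ℝ} {φ : formDomain V} (hs : SolvesEigenEquation V γ ψ E φ.1) (hn : ‖embed V φ‖ = 1) :
    h.energy hV hγ ≤ E := by
  have h1 := ((solvesEigenEquation_iff hγ h.isH10 E φ).1 hs).norm_sq
  have h2 := h.le_energyMap hV hγ φ
  rw [h1, hn] at h2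
  rw [IsGPMinimizer.energy]
  linarith

/-- The spectral data of the mean-field Hamiltonian that enter the proof of condensation: the two
lowest eigenvalues exist, the lowest one is simple, their distance is at most `4 e₀`, and the
form is bounded below accordingly on the whole form domain. -/
theorem IsGPMinimizer.exists_gap (hV : IsPotential V) (hγ : 0 ≤ γ) (h : IsGPMinimizer V γ ψ) :
    ∃ e₁ : ℝ, IsMeanFieldEigenvalue V γ ψ 0 (h.energy hV hγ) ∧ IsMeanFieldEigenvalue V γ ψ 1 e₁ ∧
      h.energy hV hγ < e₁ ∧ e₁ - h.energy hV hγ ≤ 4 * h.energy hV hγ ∧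
      ∀ φ : formDomain V, (e₁ + selfEnergy γ ψ) * ‖embed V φ‖ ^ 2 ≤
        ‖energyMap V γ h.isH10 φ‖ ^ 2 +
          (e₁ - h.energy hV hγ) * ‖⟪embed V (h.elem hV hγ), embed V φ⟫_ℂ‖ ^ 2 := by
  obtain ⟨φ₁, ho, hn, hmin, hub⟩ := h.exists_excited hV hγ
  set Ψ := h.elem hV hγ with hΨ
  set μ := h.chemicalPotential hV hγ with hμ
  set lam := ‖energyMap V γ h.isH10 φ₁‖ ^ 2 with hlam
  have heΨ : h.energy hV hγ + selfEnergy γ ψ = μ := by rw [energy]; ring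
  have hΨsol : WeakSolution γ h.isH10 μ Ψ := h.inner_energyMap hV hγ
  have hΨn := h.norm_elem hV hγ
  have hself : ⟪embed V Ψ, embed V Ψ⟫_ℂ = 1 := by
    rw [inner_self_eq_norm_sq_to_K, hΨn]; simp
  -- The decomposition along the ground state.
  have hdec : ∀ φ : formDomain V, ∃ (c : ℂ) (φ' : formDomain V), φ = c • Ψ + φ' ∧
      c = ⟪embed V Ψ, embed V φ⟫_ℂ ∧ ⟪embed V Ψ, embed V φ'⟫_ℂ = 0 := fun φ => by
    refine ⟨_, φ - ⟪embed V Ψ, embed V φ⟫_ℂ • Ψ, by abel, rfl, ?_⟩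
    rw [map_sub, map_smul, inner_sub_right, inner_smul_right, hself, mul_one, sub_self]
  have hφ₁sol : WeakSolution γ h.isH10 lam φ₁ := by
    intro χ
    obtain ⟨c, χ', rfl, -, hχ'⟩ := hdec χ
    have h1 : ⟪energyMap V γ h.isH10 χ', energyMap V γ h.isH10 φ₁⟫_ℂ =
        lam * ⟪embed V χ', embed V φ₁⟫_ℂ :=
      inner_eq_of_minimizer _ _ (fun t => hmin _ (by
        rw [map_add, map_smul, inner_add_right, inner_smul_right, ho, hχ', mul_zero, add_zero]))
        (by rw [hn, one_pow, mul_one])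
    have h2 : ⟪energyMap V γ h.isH10 Ψ, energyMap V γ h.isH10 φ₁⟫_ℂ = 0 := by
      rw [← inner_conj_symm, hΨsol φ₁, ← inner_conj_symm (embed V φ₁), ho]
      simp
    rw [map_add, map_smul, inner_add_left, inner_smul_left, h1, h2, map_add, map_smul,
      inner_add_left, inner_smul_left, ho]
    ring
  have hμlam : μ ≤ lam := by
    have := h.le_energyMap hV hγ φ₁
    rwa [hn, one_pow, mul_one] at this
  have hlt : μ < lam := by
    refine lt_of_le_of_ne hμlam fun he => ?_
    rw [← he] at hφ₁sol
    have := h.ground_state_unique hV hγ hφ₁sol ho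
    rw [this, norm_zero] at hn
    exact zero_ne_one hn
  set e₁ := lam - selfEnergy γ ψ with he₁
  have he₁' : e₁ + selfEnergy γ ψ = lam := by rw [he₁]; ring
  have hgap : e₁ - h.energy hV hγ = lam - μ := by rw [← heΨ, he₁]; ring
  have hinner : ∀ φ χ : formDomain V,
      ∫ x, conj (φ.1 x) * χ.1 x ∂unitMeasure = ⟪embed V φ, embed V χ⟫_ℂ := fun φ χ =>
    (inner_toLp φ.2.isH10.memLp χ.2.isH10.memLp).symm
  have hnorm : ∀ φ : formDomain V, ⟪embed V φ, embed V φ⟫_ℂ = 1 → ‖embed V φ‖ = 1 := fun φ hφ => by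
    have h1 : ‖embed V φ‖ ^ 2 = 1 := by
      rw [norm_sq_eq_re_inner (𝕜 := ℂ), hφ]; simp
    rwa [pow_eq_one_iff_of_nonneg (norm_nonneg _) two_ne_zero] at h1
  have hΨeig : SolvesEigenEquation V γ ψ (h.energy hV hγ) Ψ.1 :=
    (solvesEigenEquation_iff hγ h.isH10 _ Ψ).2 (by rw [heΨ]; exact hΨsol)
  have hφ₁eig : SolvesEigenEquation V γ ψ e₁ φ₁.1 :=
    (solvesEigenEquation_iff hγ h.isH10 _ φ₁).2 (by rw [he₁']; exact hφ₁sol)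
  refine ⟨e₁, ⟨⟨fun _ => Ψ.1, fun _ => ⟨_, le_rfl, hΨeig⟩, fun i j => ?_⟩, ?_⟩,
    ⟨⟨![Ψ.1, φ₁.1], ?_, ?_⟩, ?_⟩, by linarith, by linarith, fun φ => ?_⟩
  · rw [hinner, hself, if_pos (Subsingleton.elim (α := Fin 1) i j)]
  · rintro ν ⟨φ, hφ, hφo⟩
    obtain ⟨ν', hν', hs⟩ := hφ 0
    have h1 := hφo 0 0
    rw [if_pos rfl] at h1
    exact (SolvesEigenEquation.le hV hγ h (φ := ⟨φ 0, hs.inFormDomain⟩) hs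
      (hnorm _ (by rw [← hinner]; exact h1))).trans hν'
  · intro i
    fin_cases i
    · exact ⟨_, by linarith, hΨeig⟩
    · exact ⟨_, le_rfl, hφ₁eig⟩
  · have hself₁ : ⟪embed V φ₁, embed V φ₁⟫_ℂ = 1 := by
      rw [inner_self_eq_norm_sq_to_K, hn]; simp
    have ho' : ⟪embed V φ₁, embed V Ψ⟫_ℂ = 0 := by rw [← inner_conj_symm, ho, map_zero]
    intro i j
    fin_cases i <;> fin_cases j
    · exact (hinner Ψ Ψ).trans hself
    · exact (hinner Ψ φ₁).trans ho
    · exact (hinner φ₁ Ψ).trans ho'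
    · exact (hinner φ₁ φ₁).trans hself₁
  · -- Some normalized combination of two orthonormal eigenfunctions is orthogonal to `ψ`.
    rintro ν ⟨φ, hφ, hφo⟩
    obtain ⟨ν₀, hν₀, hs₀⟩ := hφ 0
    obtain ⟨ν₁, hν₁, hs₁⟩ := hφ 1
    set a : formDomain V := ⟨φ 0, hs₀.inFormDomain⟩
    set b : formDomain V := ⟨φ 1, hs₁.inFormDomain⟩
    have haa : ‖embed V a‖ = 1 := hnorm a (by rw [← hinner]; exact (hφo 0 0).trans (if_pos rfl))
    have hbb : ‖embed V b‖ = 1 := hnorm b (by rw [← hinner]; exact (hφo 1 1).trans (if_pos rfl))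
    have hab : ⟪embed V a, embed V b⟫_ℂ = 0 := by
      rw [← hinner]; exact (hφo 0 1).trans (if_neg (by decide))
    have hsa := (solvesEigenEquation_iff hγ h.isH10 ν₀ a).1 hs₀
    have hsb := (solvesEigenEquation_iff hγ h.isH10 ν₁ b).1 hs₁
    have key : ∀ c d : ℂ, ⟪embed V Ψ, embed V (c • a + d • b)⟫_ℂ = 0 →
        lam * (‖c‖ ^ 2 + ‖d‖ ^ 2) ≤ (ν + selfEnergy γ ψ) * (‖c‖ ^ 2 + ‖d‖ ^ 2) := by
      intro c d hcd
      have h1 := hmin _ hcd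
      have h2 : ‖embed V (c • a + d • b)‖ ^ 2 = ‖c‖ ^ 2 + ‖d‖ ^ 2 := by
        rw [map_add, map_smul, map_smul, norm_add_sq (𝕜 := ℂ), inner_smul_left, inner_smul_right,
          hab, norm_smul, norm_smul, haa, hbb]
        simp
      have h3 : ‖energyMap V γ h.isH10 (c • a + d • b)‖ ^ 2 =
          (ν₀ + selfEnergy γ ψ) * ‖c‖ ^ 2 + (ν₁ + selfEnergy γ ψ) * ‖d‖ ^ 2 := by
        rw [map_add, map_smul, map_smul, norm_add_sq (𝕜 := ℂ), inner_smul_left, inner_smul_right,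
          hsb a, hab, norm_smul, norm_smul, mul_pow, mul_pow, hsa.norm_sq, hsb.norm_sq, haa, hbb]
        simp
        ring
      rw [h2, h3] at h1
      refine h1.trans ?_
      rw [mul_add]
      gcongr
    have hfin : lam ≤ ν + selfEnergy γ ψ := by
      by_cases h0 : ⟪embed V Ψ, embed V a⟫_ℂ = 0
      · simpa using key 1 0 (by simpa using h0)
      · have := key (-⟪embed V Ψ, embed V b⟫_ℂ) ⟪embed V Ψ, embed V a⟫_ℂ (by
          rw [map_add, map_smul, map_smul, inner_add_right, inner_smul_right, inner_smul_right]
          ring)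
        have hpos : 0 < ‖-⟪embed V Ψ, embed V b⟫_ℂ‖ ^ 2 + ‖⟪embed V Ψ, embed V a⟫_ℂ‖ ^ 2 := by
          have := norm_pos_iff.2 h0
          positivity
        exact le_of_mul_le_mul_right this hpos
    linarith
  · rw [he₁', hgap]
    obtain ⟨c, φ', hφ, hc, hφ'⟩ := hdec φ
    rw [← hc]
    have hφ'Ψ : ⟪embed V φ', embed V Ψ⟫_ℂ = 0 := by rw [← inner_conj_symm, hφ', map_zero]
    have h1 := hmin φ' hφ'
    have h2 : ‖embed V φ‖ ^ 2 = ‖c‖ ^ 2 + ‖embed V φ'‖ ^ 2 := by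
      rw [hφ, map_add, map_smul, norm_add_sq (𝕜 := ℂ), inner_smul_left, hφ', norm_smul, hΨn]
      simp
    have h3 : ‖energyMap V γ h.isH10 φ‖ ^ 2 = μ * ‖c‖ ^ 2 + ‖energyMap V γ h.isH10 φ'‖ ^ 2 := by
      have : RCLike.re ⟪c • energyMap V γ h.isH10 Ψ, energyMap V γ h.isH10 φ'⟫_ℂ = 0 := by
        rw [inner_re_symm (𝕜 := ℂ), inner_smul_right, hΨsol φ', hφ'Ψ]
        simp
      rw [hφ, map_add, map_smul, norm_add_sq (𝕜 := ℂ), this, norm_smul, mul_pow, hΨsol.norm_sq,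
        hΨn]
      ring
    rw [h2, h3]
    nlinarith

end

/-! ### Slices of test functions -/

section

variable {V : Measure ℝ} {γ : ℝ} {ψ : ℝ → ℝ} {N : ℕ}

/-- Overwriting one coordinate by an independent one preserves Lebesgue measure on the cube. -/
theorem measurePreserving_update (i : Fin N) :
    MeasurePreserving (fun p : (Fin N → ℝ) × ℝ => Function.update p.1 i p.2)
      ((cubeMeasure N).prod unitMeasure) (cubeMeasure N) := by
  have hm : Measurable (fun p : (Fin N → ℝ) × ℝ => Function.update p.1 i p.2) := by
    refine measurable_pi_lambda _ fun j => ?_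
    by_cases h : j = i
    · subst h; simpa using measurable_snd
    · simp only [Function.update_of_ne h]
      exact (measurable_pi_apply j).comp measurable_fst
  refine ⟨hm, ?_⟩
  unfold cubeMeasure
  refine (Measure.pi_eq fun s hs => ?_).symm
  have hpre : (fun p : (Fin N → ℝ) × ℝ => Function.update p.1 i p.2) ⁻¹' univ.pi s =
      (univ.pi (Function.update s i univ)) ×ˢ s i := by
    ext p
    simp only [mem_preimage, mem_univ_pi, mem_prod]
    constructor
    · refine fun h => ⟨fun j => ?_, by simpa using h i⟩
      by_cases hj : j = i
      · subst hj; simp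
      · simpa [Function.update_of_ne hj] using h j
    · rintro ⟨h1, h2⟩ j
      by_cases hj : j = i
      · subst hj; simpa using h2
      · simpa [Function.update_of_ne hj] using h1 j
  rw [Measure.map_apply hm (MeasurableSet.univ_pi hs), hpre, Measure.prod_prod, Measure.pi_pi]
  have h1 : ∀ j, unitMeasure (Function.update s i univ j) =
      Function.update (fun j => unitMeasure (s j)) i 1 j := fun j => by
    by_cases hj : j = i
    · subst hj; simp
    · simp [Function.update_of_ne hj]
  simp_rw [h1]
  rw [Finset.prod_update_of_mem (Finset.mem_univ i), one_mul,
    ← Finset.prod_sdiff (Finset.subset_univ {i}), Finset.prod_singleton]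

theorem lintegral_update (i : Fin N) {F : (Fin N → ℝ) → ℝ≥0∞} (hF : Measurable F) :
    ∫⁻ z, F z ∂cubeMeasure N =
      ∫⁻ z, ∫⁻ x, F (Function.update z i x) ∂unitMeasure ∂cubeMeasure N := by
  have h := measurePreserving_update i
  rw [← h.lintegral_comp hF]
  exact lintegral_prod _ (hF.comp h.measurable).aemeasurable

theorem ae_mem_cube : ∀ᵐ z ∂cubeMeasure N, ∀ i, z i ∈ Ioo (0 : ℝ) 1 := by
  rw [ae_all_iff]
  intro i
  exact Measure.tendsto_eval_ae_ae (μ := fun _ : Fin N => unitMeasure) (i := i) ae_mem_Ioo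

namespace IsBosonicTestFunction

variable {Φ : (Fin N → ℝ) → ℂ}

theorem continuous (h : IsBosonicTestFunction Φ) : Continuous Φ := h.contDiff.continuous

theorem exists_bound (h : IsBosonicTestFunction Φ) : ∃ C : ℝ≥0, ∀ z, ‖Φ z‖ₑ ≤ C := by
  obtain ⟨C, hC⟩ := h.continuous.bounded_above_of_compact_support h.hasCompactSupport
  refine ⟨C.toNNReal, fun z => ?_⟩
  rw [← ofReal_norm, ENNReal.ofNNReal_toNNReal]
  exact ENNReal.ofReal_le_ofReal (hC z)

theorem exists_lipschitz (h : IsBosonicTestFunction Φ) : ∃ C : ℝ≥0, LipschitzWith C Φ :=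
  (h.contDiff.of_le (by exact_mod_cast le_top (a := (1 : ℕ∞)))).lipschitzWith_of_hasCompactSupport
    h.hasCompactSupport one_ne_zero

theorem differentiable (h : IsBosonicTestFunction Φ) : Differentiable ℝ Φ :=
  h.contDiff.differentiable (by simp)

theorem continuous_fderiv (h : IsBosonicTestFunction Φ) (i : Fin N) :
    Continuous fun z => fderiv ℝ Φ z (Pi.single i 1) :=
  (h.contDiff.continuous_fderiv (by simp)).clm_apply continuous_const

theorem exists_bound_fderiv (h : IsBosonicTestFunction Φ) (i : Fin N) :
    ∃ C : ℝ≥0, ∀ z, ‖fderiv ℝ Φ z (Pi.single i 1)‖ₑ ≤ C := by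
  obtain ⟨C, hC⟩ := h.exists_lipschitz
  refine ⟨C * ‖(Pi.single i 1 : Fin N → ℝ)‖₊, fun z => ?_⟩
  rw [← ofReal_norm]
  refine (ENNReal.ofReal_le_ofReal ((ContinuousLinearMap.le_opNorm _ _).trans
    (mul_le_mul_of_nonneg_right (norm_fderiv_le_of_lipschitz ℝ hC) (norm_nonneg _)))).trans ?_
  rw [ENNReal.ofReal_mul C.coe_nonneg, ofReal_norm]
  simp [enorm]

theorem deriv_slice (h : IsBosonicTestFunction Φ) (z : Fin N → ℝ) (i : Fin N) (x : ℝ) :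
    deriv (fun x => Φ (Function.update z i x)) x =
      fderiv ℝ Φ (Function.update z i x) (Pi.single i 1) :=
  ((h.differentiable _).hasFDerivAt.comp_hasDerivAt x (hasDerivAt_update z i x)).deriv

theorem exists_support (h : IsBosonicTestFunction Φ) (i : Fin N) :
    ∃ K : Set ℝ, IsCompact K ∧ K ⊆ Ioo 0 1 ∧ ∀ z, ∀ x ∉ K, Φ (Function.update z i x) = 0 := by
  refine ⟨(fun z => z i) '' tsupport Φ, IsCompact.image h.hasCompactSupport (continuous_apply i),
    ?_, fun z x hx => ?_⟩
  · rintro _ ⟨z, hz, rfl⟩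
    exact h.tsupport_subset hz i (mem_univ i)
  · by_contra h0
    exact hx ⟨Function.update z i x, subset_tsupport _ h0, by simp⟩

theorem inFormDomain_slice (hV : IsPotential V) (h : IsBosonicTestFunction Φ) (z : Fin N → ℝ)
    (i : Fin N) : InFormDomain V fun x => Φ (Function.update z i x) := by
  obtain ⟨C, hC⟩ := h.exists_lipschitz
  obtain ⟨K, hK, hK', h0⟩ := h.exists_support i
  have hu : LipschitzWith 1 (Function.update z i) := by
    refine LipschitzWith.of_dist_le_mul fun x y => ?_
    rw [NNReal.coe_one, one_mul, dist_pi_le_iff dist_nonneg]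
    intro j
    by_cases hj : j = i
    · subst hj; simp
    · simp [Function.update_of_ne hj]
  exact inFormDomain_of_lipschitz hV (hC.comp hu) hK hK' (h0 z)

theorem continuous_slice (h : IsBosonicTestFunction Φ) (i : Fin N) :
    Continuous fun p : (Fin N → ℝ) × ℝ => Φ (Function.update p.1 i p.2) :=
  h.continuous.comp (continuous_fst.update i continuous_snd)

end IsBosonicTestFunction

/-! ### The one-body energy of a test function -/

/-- The density `ψ²`, set to `0` outside `[0,1]`. -/
def density (ψ : ℝ → ℝ) : ℝ → ℝ := (Icc 0 1).indicator fun x => ψ x ^ 2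

theorem density_of_mem {x : ℝ} (hx : x ∈ Icc (0 : ℝ) 1) : density ψ x = ψ x ^ 2 :=
  indicator_of_mem hx _

theorem density_nonneg (x : ℝ) : 0 ≤ density ψ x :=
  indicator_nonneg (fun _ _ => by positivity) x

theorem measurable_indicator_of_continuousOn {E : Type*} [NormedAddCommGroup E]
    [MeasurableSpace E] [BorelSpace E] {f : ℝ → E} (h : ContinuousOn f (Icc 0 1)) :
    Measurable ((Icc (0 : ℝ) 1).indicator f) := by
  rw [← piecewise_eq_indicator]
  exact h.measurable_piecewise (continuousOn_const (c := (0 : E))) measurableSet_Icc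

theorem IsGPMinimizer.measurable_density (h : IsGPMinimizer V γ ψ) : Measurable (density ψ) :=
  measurable_indicator_of_continuousOn (h.continuousOn.pow 2)

theorem IsGPMinimizer.exists_density_le (h : IsGPMinimizer V γ ψ) :
    ∃ C : ℝ≥0, ∀ x, ENNReal.ofReal (density ψ x) ≤ C := by
  obtain ⟨C, hC⟩ := isCompact_Icc.exists_bound_of_continuousOn (h.continuousOn.pow 2)
  refine ⟨C.toNNReal, fun x => ?_⟩
  rw [ENNReal.ofNNReal_toNNReal]
  by_cases hx : x ∈ Icc (0 : ℝ) 1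
  · rw [density_of_mem hx]
    exact ENNReal.ofReal_le_ofReal ((le_abs_self _).trans (hC x hx))
  · rw [density, indicator_of_notMem hx]; simp

theorem IsGPMinimizer.lintegral_density (hV : IsPotential V) (hγ : 0 ≤ γ)
    (h : IsGPMinimizer V γ ψ) : ∫⁻ x, ENNReal.ofReal (density ψ x) ∂unitMeasure = 1 := by
  have h1 : ∫ x, density ψ x ∂unitMeasure = 1 := by
    rw [← h.integral_sq hV hγ]
    refine integral_congr_ae ?_
    filter_upwards [ae_mem_Ioo] with x hx using density_of_mem (Ioo_subset_Icc_self hx)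
  rw [← ofReal_integral_eq_lintegral_ofReal, h1, ENNReal.ofReal_one]
  · refine (integrable_of_continuousOn (h.continuousOn.pow 2)).congr ?_
    filter_upwards [ae_mem_Ioo] with x hx using (density_of_mem (Ioo_subset_Icc_self hx)).symm
  · exact ae_of_all _ density_nonneg

variable {Φ : (Fin N → ℝ) → ℂ}

/-- The kinetic energy of particle `i`. -/
def kinetic (Φ : (Fin N → ℝ) → ℂ) (i : Fin N) : ℝ≥0∞ :=
  ∫⁻ z, ‖fderiv ℝ Φ z (Pi.single i 1)‖ₑ ^ 2 ∂cubeMeasure N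

/-- The potential energy of particle `i`. -/
def potential (V : Measure ℝ) (Φ : (Fin N → ℝ) → ℂ) (i : Fin N) : ℝ≥0∞ :=
  ∫⁻ z, ∫⁻ x, ‖Φ (Function.update z i x)‖ₑ ^ 2 ∂V ∂cubeMeasure N

/-- The expectation value of the multiplication operator `w(zᵢ)`. -/
def expectation (w : ℝ → ℝ≥0∞) (Φ : (Fin N → ℝ) → ℂ) (i : Fin N) : ℝ≥0∞ :=
  ∫⁻ z, w (z i) * ‖Φ z‖ₑ ^ 2 ∂cubeMeasure N

/-- The probability that particle `i` is in the state `ψ`. -/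
def projection (ψ : ℝ → ℝ) (Φ : (Fin N → ℝ) → ℂ) (i : Fin N) : ℝ≥0∞ :=
  ∫⁻ z, ‖∫ x, (ψ x : ℂ) * Φ (Function.update z i x) ∂unitMeasure‖ₑ ^ 2 ∂cubeMeasure N

namespace IsBosonicTestFunction

theorem measurable_enorm_sq (hΦ : IsBosonicTestFunction Φ) : Measurable fun z => ‖Φ z‖ₑ ^ 2 :=
  (hΦ.continuous.measurable.enorm).pow_const 2

theorem kinetic_eq (hΦ : IsBosonicTestFunction Φ) (i : Fin N) :
    kinetic Φ i = ∫⁻ z, ∫⁻ x, ‖deriv (fun x => Φ (Function.update z i x)) x‖ₑ ^ 2 ∂unitMeasure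
      ∂cubeMeasure N := by
  rw [kinetic, lintegral_update i ((hΦ.continuous_fderiv i).measurable.enorm.pow_const 2)]
  simp_rw [hΦ.deriv_slice]

theorem expectation_eq (hΦ : IsBosonicTestFunction Φ) {w : ℝ → ℝ≥0∞} (hw : Measurable w)
    (i : Fin N) : expectation w Φ i = ∫⁻ z, ∫⁻ x, w x * ‖Φ (Function.update z i x)‖ₑ ^ 2
      ∂unitMeasure ∂cubeMeasure N := by
  have hm : Measurable fun z : Fin N → ℝ => w (z i) * ‖Φ z‖ₑ ^ 2 :=
    (hw.comp (measurable_pi_apply i)).mul hΦ.measurable_enorm_sq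
  rw [expectation, lintegral_update i hm]
  simp

theorem measurable_projection (h : IsGPMinimizer V γ ψ) (hΦ : IsBosonicTestFunction Φ)
    (i : Fin N) :
    Measurable fun z => ‖∫ x, (ψ x : ℂ) * Φ (Function.update z i x) ∂unitMeasure‖ₑ ^ 2 := by
  have hψm : Measurable ((Icc (0 : ℝ) 1).indicator fun x => (ψ x : ℂ)) :=
    measurable_indicator_of_continuousOn h.isH10.continuousOn
  have he : ∀ z, ∫ x, (ψ x : ℂ) * Φ (Function.update z i x) ∂unitMeasure =
      ∫ x, (Icc (0 : ℝ) 1).indicator (fun x => (ψ x : ℂ)) x * Φ (Function.update z i x)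
        ∂unitMeasure := fun z => by
    refine integral_congr_ae ?_
    filter_upwards [ae_mem_Ioo] with x hx
    rw [indicator_of_mem (Ioo_subset_Icc_self hx)]
  simp_rw [he]
  have : StronglyMeasurable fun z => ∫ x, (Icc (0 : ℝ) 1).indicator (fun x => (ψ x : ℂ)) x *
      Φ (Function.update z i x) ∂unitMeasure := by
    refine StronglyMeasurable.integral_prod_right' (f := fun p : (Fin N → ℝ) × ℝ =>
      (Icc (0 : ℝ) 1).indicator (fun x => (ψ x : ℂ)) p.2 * Φ (Function.update p.1 i p.2)) ?_
    exact ((hψm.comp measurable_snd).mul (hΦ.continuous_slice i).measurable).stronglyMeasurable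
  exact this.measurable.enorm.pow_const 2

/-- The spectral lower bound on the mean-field Hamiltonian, applied to one particle. -/
theorem spectral_bound (hV : IsPotential V) (hγ : 0 ≤ γ) (h : IsGPMinimizer V γ ψ) {a d : ℝ}
    (hd : 0 ≤ d) (hgap : ∀ φ : formDomain V, a * ‖embed V φ‖ ^ 2 ≤
      ‖energyMap V γ h.isH10 φ‖ ^ 2 + d * ‖⟪embed V (h.elem hV hγ), embed V φ⟫_ℂ‖ ^ 2)
    (hΦ : IsBosonicTestFunction Φ) (i : Fin N) :
    ENNReal.ofReal a * ∫⁻ z, ‖Φ z‖ₑ ^ 2 ∂cubeMeasure N ≤ kinetic Φ i +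
      (ENNReal.ofReal γ * expectation (fun x => ENNReal.ofReal (density ψ x)) Φ i +
        (ENNReal.ofReal d * projection ψ Φ i + potential V Φ i)) := by
  have hrho : Measurable fun x => ENNReal.ofReal (density ψ x) := h.measurable_density.ennreal_ofReal
  have hm1 : Measurable fun z => ∫⁻ x, ‖deriv (fun x => Φ (Function.update z i x)) x‖ₑ ^ 2
      ∂unitMeasure := by
    simp_rw [hΦ.deriv_slice]
    refine Measurable.lintegral_prod_right' (f := fun p : (Fin N → ℝ) × ℝ =>
      ‖fderiv ℝ Φ (Function.update p.1 i p.2) (Pi.single i 1)‖ₑ ^ 2) ?_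
    exact (((hΦ.continuous_fderiv i).comp (continuous_fst.update i continuous_snd)).measurable
      |>.enorm.pow_const 2)
  have hm2 : Measurable fun z => ENNReal.ofReal γ * ∫⁻ x, ENNReal.ofReal (density ψ x) *
      ‖Φ (Function.update z i x)‖ₑ ^ 2 ∂unitMeasure := by
    refine (Measurable.lintegral_prod_right' (f := fun p : (Fin N → ℝ) × ℝ =>
      ENNReal.ofReal (density ψ p.2) * ‖Φ (Function.update p.1 i p.2)‖ₑ ^ 2) ?_).const_mul _
    exact (hrho.comp measurable_snd).mul ((hΦ.continuous_slice i).measurable.enorm.pow_const 2)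
  have hm3 : Measurable fun z => ENNReal.ofReal d *
      ‖∫ x, (ψ x : ℂ) * Φ (Function.update z i x) ∂unitMeasure‖ₑ ^ 2 := by
    exact (hΦ.measurable_projection h i).const_mul _
  rw [lintegral_update i hΦ.measurable_enorm_sq, hΦ.kinetic_eq, hΦ.expectation_eq hrho, projection,
    potential, ← lintegral_const_mul' _ _ ENNReal.ofReal_ne_top,
    ← lintegral_const_mul' _ _ ENNReal.ofReal_ne_top,
    ← lintegral_const_mul' _ _ ENNReal.ofReal_ne_top,
    ← lintegral_add_left hm3, ← lintegral_add_left hm2, ← lintegral_add_left hm1]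
  refine lintegral_mono fun z => ?_
  set φ : formDomain V := ⟨_, hΦ.inFormDomain_slice hV z i⟩ with hφ
  have h1 := hgap φ
  have e1 : ∫⁻ x, ‖Φ (Function.update z i x)‖ₑ ^ 2 ∂unitMeasure =
      ENNReal.ofReal (‖embed V φ‖ ^ 2) := by
    rw [norm_embed_sq]; exact lintegral_enorm_sq φ.2.isH10.memLp
  have e2 : ∫⁻ x, ‖deriv (fun x => Φ (Function.update z i x)) x‖ₑ ^ 2 ∂unitMeasure =
      ENNReal.ofReal (‖weakDeriv V φ‖ ^ 2) := by
    rw [norm_weakDeriv_sq]; exact lintegral_enorm_sq φ.2.isH10.memLp_deriv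
  have e3 : ∫⁻ x, ‖Φ (Function.update z i x)‖ₑ ^ 2 ∂V =
      ENNReal.ofReal (‖potentialEmbed V φ‖ ^ 2) := by
    rw [norm_potentialEmbed_sq]; exact lintegral_enorm_sq φ.2.memLp_potential
  have e4 : ENNReal.ofReal γ * ∫⁻ x, ENNReal.ofReal (density ψ x) *
      ‖Φ (Function.update z i x)‖ₑ ^ 2 ∂unitMeasure =
      ENNReal.ofReal (‖weightedEmbed V γ h.isH10 φ‖ ^ 2) := by
    have hi : Integrable (fun x => ψ x ^ 2 * ‖φ.1 x‖ ^ 2) unitMeasure :=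
      integrable_of_continuousOn ((h.continuousOn.pow 2).mul (φ.2.isH10.continuousOn.norm.pow 2))
    rw [norm_weightedEmbed_sq hγ, ENNReal.ofReal_mul hγ,
      ofReal_integral_eq_lintegral_ofReal hi (ae_of_all _ fun _ => by positivity)]
    congr 1
    refine lintegral_congr_ae ?_
    filter_upwards [ae_mem_Ioo] with x hx
    rw [density_of_mem (Ioo_subset_Icc_self hx), ← ofReal_norm,
      ← ENNReal.ofReal_pow (norm_nonneg _), ← ENNReal.ofReal_mul (by positivity)]
  have e5 : ‖∫ x, (ψ x : ℂ) * Φ (Function.update z i x) ∂unitMeasure‖ₑ ^ 2 =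
      ENNReal.ofReal (‖⟪embed V (h.elem hV hγ), embed V φ⟫_ℂ‖ ^ 2) := by
    have : ⟪embed V (h.elem hV hγ), embed V φ⟫_ℂ = _ :=
      inner_toLp (h.elem hV hγ).2.isH10.memLp φ.2.isH10.memLp
    rw [this, ENNReal.ofReal_pow (norm_nonneg _), ofReal_norm]
    simp only [IsGPMinimizer.elem, Complex.conj_ofReal, hφ]
  rw [e1, e2, e3, e4, e5, ← ENNReal.ofReal_mul' (by positivity), ← ENNReal.ofReal_mul hd,
    ← ENNReal.ofReal_add (by positivity) (by positivity),
    ← ENNReal.ofReal_add (by positivity) (by positivity),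
    ← ENNReal.ofReal_add (by positivity) (by positivity)]
  refine ENNReal.ofReal_le_ofReal (h1.trans (le_of_eq ?_))
  rw [norm_energyMap_sq]
  ring

/-- In one dimension the kinetic energy dominates the multiplication by a probability density. -/
theorem expectation_le_kinetic (hV : IsPotential V) (hΦ : IsBosonicTestFunction Φ)
    {w : ℝ → ℝ≥0∞} (hw : Measurable w) (hw1 : ∫⁻ x, w x ∂unitMeasure ≤ 1) (i : Fin N) :
    expectation w Φ i ≤ kinetic Φ i := by
  rw [hΦ.expectation_eq hw, hΦ.kinetic_eq]
  refine lintegral_mono fun z => ?_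
  have hs := (hΦ.inFormDomain_slice hV z i).isH10
  have h1 : ∀ᵐ x ∂unitMeasure, w x * ‖Φ (Function.update z i x)‖ₑ ^ 2 ≤
      w x * ∫⁻ x, ‖deriv (fun x => Φ (Function.update z i x)) x‖ₑ ^ 2 ∂unitMeasure := by
    filter_upwards [ae_mem_Ioo] with x hx
    gcongr
    rw [lintegral_enorm_sq hs.memLp_deriv, ← ofReal_norm, ← ENNReal.ofReal_pow (norm_nonneg _)]
    exact ENNReal.ofReal_le_ofReal (hs.norm_sq_le (Ioo_subset_Icc_self hx))
  refine (lintegral_mono_ae h1).trans ?_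
  rw [lintegral_mul_const _ hw]
  exact mul_le_of_le_one_left' hw1

end IsBosonicTestFunction

end

/-! ### Smearing the interaction over the cells of a partition -/

section

variable {V : Measure ℝ} {γ : ℝ} {ψ : ℝ → ℝ} {N : ℕ} {M : ℕ}

/-- The index of the cell `[k/M, (k+1)/M)` that contains `x`. -/
def cell (M : ℕ) (x : ℝ) : ℕ := ⌊(M : ℝ) * x⌋₊

/-- The indicator function of pairs of points in the same cell. -/
def sameCell (M : ℕ) (x y : ℝ) : ℝ≥0∞ := if cell M x = cell M y then 1 else 0

/-- The average of `w` over the cell that contains `x`. -/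
def cellAverage (M : ℕ) (w : ℝ → ℝ≥0∞) (x : ℝ) : ℝ≥0∞ :=
  M * ∫⁻ y, sameCell M x y * w y ∂unitMeasure

theorem measurable_cell (M : ℕ) : Measurable (cell M) :=
  Nat.measurable_floor.comp (measurable_const_mul _)

theorem measurable_sameCell (M : ℕ) : Measurable fun p : ℝ × ℝ => sameCell M p.1 p.2 :=
  Measurable.ite (measurableSet_eq_fun ((measurable_cell M).comp measurable_fst)
    ((measurable_cell M).comp measurable_snd)) measurable_const measurable_const

theorem measurable_sameCell_right (M : ℕ) (x : ℝ) : Measurable (sameCell M x) :=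
  (measurable_sameCell M).comp measurable_prodMk_left

theorem measurable_cellAverage {w : ℝ → ℝ≥0∞} (hw : Measurable w) :
    Measurable (cellAverage M w) := by
  refine Measurable.const_mul ?_ _
  refine Measurable.lintegral_prod_right' (f := fun p : ℝ × ℝ => sameCell M p.1 p.2 * w p.2) ?_
  exact (measurable_sameCell M).mul (hw.comp measurable_snd)

theorem sameCell_le_one (x y : ℝ) : sameCell M x y ≤ 1 := by
  unfold sameCell; split_ifs <;> simp

theorem cell_lt (hM : 0 < M) {x : ℝ} (hx : x ∈ Ioo (0 : ℝ) 1) : cell M x < M := by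
  have hM' : (0 : ℝ) < M := by exact_mod_cast hM
  rw [cell, Nat.floor_lt (by have := hx.1; positivity)]
  nlinarith [hx.2]

theorem cell_eq_iff (hM : 0 < M) {y : ℝ} (hy : 0 ≤ y) (k : ℕ) :
    cell M y = k ↔ (k : ℝ) / M ≤ y ∧ y < (k + 1) / M := by
  have hM' : (0 : ℝ) < M := by exact_mod_cast hM
  rw [cell, Nat.floor_eq_iff (by positivity), div_le_iff₀ hM', lt_div_iff₀ hM', mul_comm y]

theorem unitMeasure_cell (hM : 0 < M) {k : ℕ} (hk : k < M) :
    (M : ℝ≥0∞) * unitMeasure {y | cell M y = k} = 1 := by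
  have hM' : (0 : ℝ) < M := by exact_mod_cast hM
  have hk' : (k : ℝ) + 1 ≤ M := by exact_mod_cast hk
  have h1 : unitMeasure {y | cell M y = k} = volume (Ico ((k : ℝ) / M) ((k + 1) / M)) := by
    rw [unitMeasure, Measure.restrict_apply
      (show MeasurableSet {y | cell M y = k} from (measurable_cell M) (measurableSet_singleton k))]
    refine measure_congr ?_
    have h1 : ∀ᵐ x : ℝ, x ≠ 1 := by simp [ae_iff, measure_singleton]
    filter_upwards [h1] with x hx1
    refine propext ⟨fun h => (cell_eq_iff hM h.2.1 k).1 h.1, fun h => ?_⟩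
    have h0 : 0 ≤ x := le_trans (by positivity) h.1
    refine ⟨(cell_eq_iff hM h0 k).2 h, h0, h.2.le.trans ?_⟩
    rw [div_le_one hM']
    exact hk'
  rw [h1, Real.volume_Ico, ← sub_div, add_sub_cancel_left, ← ENNReal.ofReal_natCast,
    ← ENNReal.ofReal_mul hM'.le, mul_one_div_cancel hM'.ne', ENNReal.ofReal_one]

theorem lintegral_sameCell (hM : 0 < M) {x : ℝ} (hx : x ∈ Ioo (0 : ℝ) 1) :
    (M : ℝ≥0∞) * ∫⁻ y, sameCell M x y ∂unitMeasure = 1 := by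
  rw [← unitMeasure_cell hM (cell_lt hM hx), ← lintegral_indicator_one
    (show MeasurableSet {y | cell M y = cell M x} from
      (measurable_cell M) (measurableSet_singleton _))]
  congr 1
  refine lintegral_congr fun y => ?_
  simp [sameCell, indicator, eq_comm]

theorem one_sub_mul_sq_le {s a b d : ℝ} (hs : 0 < s) (hs1 : s ≤ 1) (ha : 0 ≤ a)
    (h : a ≤ b + d) : (1 - s) * a ^ 2 ≤ b ^ 2 + d ^ 2 / s := by
  have h1 : a ^ 2 ≤ (b + d) ^ 2 := pow_le_pow_left₀ ha h 2
  have h2 : (b + d) ^ 2 ≤ (1 + s) * b ^ 2 + (1 + 1 / s) * d ^ 2 := by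
    have : 0 ≤ (s * b - d) ^ 2 / s := by positivity
    have e : (s * b - d) ^ 2 / s = s * b ^ 2 - 2 * b * d + d ^ 2 / s := by
      field_simp
      ring
    rw [e] at this
    have e2 : (1 + 1 / s) * d ^ 2 = d ^ 2 + d ^ 2 / s := by ring
    rw [e2]
    nlinarith
  have h3 : (1 - s) * a ^ 2 ≤ (1 - s) * ((1 + s) * b ^ 2 + (1 + 1 / s) * d ^ 2) :=
    mul_le_mul_of_nonneg_left (h1.trans h2) (by linarith)
  have h4 : (1 - s) * ((1 + s) * b ^ 2 + (1 + 1 / s) * d ^ 2) =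
      b ^ 2 + d ^ 2 / s - s ^ 2 * b ^ 2 - s * d ^ 2 := by
    field_simp
    ring
  nlinarith [sq_nonneg (s * b), mul_nonneg hs.le (sq_nonneg d),
    mul_nonneg (sq_nonneg s) (sq_nonneg b)]

/-- The values of a function of class `H¹₀` at two points of the same cell differ little in
terms of the kinetic energy in this cell. -/
theorem IsH10.sameCell_bound (hM : 0 < M) {s : ℝ} (hs : 0 < s) (hs1 : s ≤ 1) {φ : ℝ → ℂ}
    (h : IsH10 φ) {x z : ℝ} (hx : x ∈ Ioo (0 : ℝ) 1) (hz : z ∈ Ioo (0 : ℝ) 1)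
    (hxz : cell M x = cell M z) :
    ENNReal.ofReal (1 - s) * ‖φ x‖ₑ ^ 2 ≤ ‖φ z‖ₑ ^ 2 +
      ENNReal.ofReal (1 / (s * M)) * ∫⁻ y, sameCell M z y * ‖deriv φ y‖ₑ ^ 2 ∂unitMeasure := by
  have hM' : (0 : ℝ) < M := by exact_mod_cast hM
  set S : Set ℝ := {y | cell M y = cell M z} with hS
  have hSm : MeasurableSet S := (measurable_cell M) (measurableSet_singleton _)
  have hI : ∫⁻ y, sameCell M z y * ‖deriv φ y‖ₑ ^ 2 ∂unitMeasure =
      ENNReal.ofReal (∫ y in S, ‖deriv φ y‖ ^ 2 ∂unitMeasure) := by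
    rw [← lintegral_enorm_sq (h.memLp_deriv.restrict S), ← lintegral_indicator hSm]
    refine lintegral_congr fun y => ?_
    by_cases hy : y ∈ S
    · rw [indicator_of_mem hy, sameCell, if_pos (Eq.symm hy), one_mul]
    · rw [indicator_of_notMem hy, sameCell, if_neg (fun h => hy (Eq.symm h)), zero_mul]
  have hcl : ∀ y ∈ Icc (min x z) (max x z), y ∈ S := by
    intro y hy
    have hy0 : 0 ≤ y := (le_min hx.1.le hz.1.le).trans hy.1
    have h1 := (cell_eq_iff hM hx.1.le _).1 hxz
    have h2 := (cell_eq_iff hM hz.1.le _).1 rfl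
    exact (cell_eq_iff hM hy0 _).2 ⟨(le_min h1.1 h2.1).trans hy.1, hy.2.trans_lt (max_lt h1.2 h2.2)⟩
  have hI0 : 0 ≤ ∫ y in S, ‖deriv φ y‖ ^ 2 ∂unitMeasure := integral_nonneg fun _ => by positivity
  have hdiff : ‖φ x - φ z‖ ^ 2 ≤ 1 / M * ∫ y in S, ‖deriv φ y‖ ^ 2 ∂unitMeasure := by
    have h1 : ‖φ x - φ z‖ ^ 2 ≤ (max x z - min x z) *
        ∫ t in Icc (min x z) (max x z), ‖deriv φ t‖ ^ 2 := by
      rcases le_total x z with hle | hle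
      · rw [max_eq_right hle, min_eq_left hle, norm_sub_rev]
        exact h.norm_sub_sq_le hx.1.le hz.2.le hle
      · rw [max_eq_left hle, min_eq_right hle]
        exact h.norm_sub_sq_le hz.1.le hx.2.le hle
    have h2 : max x z - min x z ≤ 1 / M := by
      have h1 := (cell_eq_iff hM hx.1.le _).1 hxz
      have h2 := (cell_eq_iff hM hz.1.le _).1 rfl
      have h3 := max_lt h1.2 h2.2
      have h4 := le_min h1.1 h2.1
      rw [add_div] at h3
      linarith
    have h3 : ∫ t in Icc (min x z) (max x z), ‖deriv φ t‖ ^ 2 ≤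
        ∫ y in S, ‖deriv φ y‖ ^ 2 ∂unitMeasure := by
      have hsub : Icc (min x z) (max x z) ⊆ Icc 0 1 :=
        Icc_subset_Icc (le_min hx.1.le hz.1.le) (max_le hx.2.le hz.2.le)
      have e : volume.restrict (Icc (min x z) (max x z)) =
          unitMeasure.restrict (Icc (min x z) (max x z)) := by
        rw [unitMeasure, Measure.restrict_restrict measurableSet_Icc, inter_eq_left.2 hsub]
      rw [e]
      exact setIntegral_mono_set h.integrable_norm_deriv_sq.integrableOn
        (ae_of_all _ fun _ => by positivity) (ae_of_all _ hcl)
    exact h1.trans (mul_le_mul h2 h3 (integral_nonneg fun _ => by positivity) (by positivity))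
  have hreal := one_sub_mul_sq_le hs hs1 (norm_nonneg (φ x)) (b := ‖φ z‖) (d := ‖φ x - φ z‖) (by
    have := norm_add_le (φ z) (φ x - φ z)
    rwa [add_sub_cancel] at this)
  have hreal2 : (1 - s) * ‖φ x‖ ^ 2 ≤
      ‖φ z‖ ^ 2 + 1 / (s * M) * ∫ y in S, ‖deriv φ y‖ ^ 2 ∂unitMeasure := by
    refine hreal.trans (add_le_add le_rfl ?_)
    rw [div_le_iff₀ hs]
    refine hdiff.trans (le_of_eq ?_)
    field_simp
  rw [hI, ← ofReal_norm, ← ofReal_norm, ← ENNReal.ofReal_pow (norm_nonneg _),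
    ← ENNReal.ofReal_pow (norm_nonneg _), ← ENNReal.ofReal_mul (by linarith),
    ← ENNReal.ofReal_mul (by positivity), ← ENNReal.ofReal_add (by positivity) (by positivity)]
  exact ENNReal.ofReal_le_ofReal hreal2

/-- At the price of a little kinetic energy, the delta function at `z` dominates `M` times the indicator
function of the cell of `z`. -/
theorem IsH10.smeared_delta_le (hM : 0 < M) {s : ℝ} (hs : 0 < s) (hs1 : s ≤ 1) {φ : ℝ → ℂ}
    (h : IsH10 φ) {z : ℝ} (hz : z ∈ Ioo (0 : ℝ) 1) :
    ENNReal.ofReal (1 - s) * ∫⁻ x, M * sameCell M z x * ‖φ x‖ₑ ^ 2 ∂unitMeasure ≤ ‖φ z‖ₑ ^ 2 +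
      ENNReal.ofReal (1 / (s * M)) * ∫⁻ y, ‖deriv φ y‖ₑ ^ 2 ∂unitMeasure := by
  set I := ∫⁻ y, sameCell M z y * ‖deriv φ y‖ₑ ^ 2 ∂unitMeasure with hI
  have hI' : I ≤ ∫⁻ y, ‖deriv φ y‖ₑ ^ 2 ∂unitMeasure :=
    lintegral_mono fun y => mul_le_of_le_one_left' (sameCell_le_one _ _)
  have h1 : ∀ᵐ x ∂unitMeasure, ENNReal.ofReal (1 - s) * (M * sameCell M z x * ‖φ x‖ₑ ^ 2) ≤
      M * sameCell M z x * (‖φ z‖ₑ ^ 2 + ENNReal.ofReal (1 / (s * M)) * I) := by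
    filter_upwards [ae_mem_Ioo] with x hx
    by_cases hc : cell M z = cell M x
    · rw [mul_left_comm]
      gcongr
      exact h.sameCell_bound hM hs hs1 hx hz hc.symm
    · simp [sameCell, hc]
  rw [← lintegral_const_mul' _ _ ENNReal.ofReal_ne_top]
  refine (lintegral_mono_ae h1).trans ?_
  rw [lintegral_mul_const _ ((measurable_sameCell_right M z).const_mul _),
    lintegral_const_mul _ (measurable_sameCell_right M z), lintegral_sameCell hM hz, one_mul]
  gcongr

/-- At the price of a little kinetic energy, a density may be replaced by its averages over the cells. -/
theorem IsH10.le_cellAverage (hM : 0 < M) {s : ℝ} (hs : 0 < s) (hs1 : s ≤ 1) {φ : ℝ → ℂ}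
    (h : IsH10 φ) (hφ : Continuous φ) {w : ℝ → ℝ≥0∞} (hw : Measurable w)
    (hw1 : ∫⁻ x, w x ∂unitMeasure ≤ 1) :
    ENNReal.ofReal (1 - s) * ∫⁻ x, w x * ‖φ x‖ₑ ^ 2 ∂unitMeasure ≤
      ∫⁻ x, cellAverage M w x * ‖φ x‖ₑ ^ 2 ∂unitMeasure +
      ENNReal.ofReal (1 / (s * M)) * ∫⁻ y, ‖deriv φ y‖ₑ ^ 2 ∂unitMeasure := by
  set c := ENNReal.ofReal (1 / (s * M)) with hc
  have hφm : Measurable fun x => ‖φ x‖ₑ ^ 2 := hφ.measurable.enorm.pow_const 2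
  have hsymm : ∀ x y, sameCell M x y = sameCell M y x := fun x y => by
    simp only [sameCell, eq_comm]
  have hdm : Measurable fun x => ‖deriv φ x‖ₑ ^ 2 := (measurable_deriv φ).enorm.pow_const 2
  have h1 : ∀ᵐ x ∂unitMeasure, ENNReal.ofReal (1 - s) * (w x * ‖φ x‖ₑ ^ 2) ≤
      w x * (M * ∫⁻ y, sameCell M x y * ‖φ y‖ₑ ^ 2 ∂unitMeasure) +
        w x * (c * ∫⁻ y, ‖deriv φ y‖ₑ ^ 2 ∂unitMeasure) := by
    filter_upwards [ae_mem_Ioo] with x hx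
    rw [mul_left_comm, ← mul_add]
    gcongr
    set I := ∫⁻ y, sameCell M x y * ‖deriv φ y‖ₑ ^ 2 ∂unitMeasure with hI
    have hI' : I ≤ ∫⁻ y, ‖deriv φ y‖ₑ ^ 2 ∂unitMeasure :=
      lintegral_mono fun y => mul_le_of_le_one_left' (sameCell_le_one _ _)
    have h2 : ∀ᵐ y ∂unitMeasure, sameCell M x y * (ENNReal.ofReal (1 - s) * ‖φ x‖ₑ ^ 2) ≤
        sameCell M x y * ‖φ y‖ₑ ^ 2 + sameCell M x y * (c * I) := by
      filter_upwards [ae_mem_Ioo] with y hy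
      by_cases hcc : cell M x = cell M y
      · rw [← mul_add]
        gcongr
        refine (h.sameCell_bound hM hs hs1 hx hy hcc).trans (le_of_eq ?_)
        simp only [hI, sameCell, hcc, hc]
      · simp [sameCell, hcc]
    have h3 := lintegral_mono_ae h2
    have hm : Measurable fun y => sameCell M x y * ‖φ y‖ₑ ^ 2 :=
      (measurable_sameCell_right M x).mul hφm
    rw [lintegral_add_left hm,
      lintegral_mul_const _ (measurable_sameCell_right M x),
      lintegral_mul_const _ (measurable_sameCell_right M x)] at h3
    have h4 := mul_le_mul_right h3 (M : ℝ≥0∞)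
    rw [mul_add, ← mul_assoc, ← mul_assoc, ← mul_assoc _ (∫⁻ y, sameCell M x y ∂unitMeasure),
      lintegral_sameCell hM hx, one_mul, one_mul] at h4
    exact h4.trans (by gcongr)
  rw [← lintegral_const_mul' _ _ ENNReal.ofReal_ne_top]
  refine (lintegral_mono_ae h1).trans ?_
  rw [lintegral_add_right _ (hw.mul_const _), lintegral_mul_const _ hw]
  refine add_le_add (le_of_eq ?_) (mul_le_of_le_one_left' hw1)
  have e1 : ∀ x, w x * (M * ∫⁻ y, sameCell M x y * ‖φ y‖ₑ ^ 2 ∂unitMeasure) =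
      ∫⁻ y, M * (sameCell M x y * w x * ‖φ y‖ₑ ^ 2) ∂unitMeasure := fun x => by
    have hm : Measurable fun y => sameCell M x y * ‖φ y‖ₑ ^ 2 :=
      (measurable_sameCell_right M x).mul hφm
    have hm2 : Measurable fun y => sameCell M x y * w x * ‖φ y‖ₑ ^ 2 :=
      ((measurable_sameCell_right M x).mul_const _).mul hφm
    rw [lintegral_const_mul _ hm2, mul_left_comm, ← lintegral_const_mul _ hm]
    congr 1
    refine lintegral_congr fun y => ?_
    ring
  have e2 : ∀ y, cellAverage M w y * ‖φ y‖ₑ ^ 2 =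
      ∫⁻ x, M * (sameCell M x y * w x * ‖φ y‖ₑ ^ 2) ∂unitMeasure := fun y => by
    have hm : Measurable fun x => sameCell M y x * w x := (measurable_sameCell_right M y).mul hw
    rw [cellAverage, mul_assoc, ← lintegral_mul_const _ hm, ← lintegral_const_mul _
      (hm.mul_const _)]
    simp_rw [hsymm y]
  simp_rw [e1, e2]
  refine lintegral_lintegral_swap (Measurable.aemeasurable ?_)
  exact (((measurable_sameCell M).mul (hw.comp measurable_fst)).mul
    (hφm.comp measurable_snd)).const_mul _

/-! ### The smeared interaction is positive definite -/

theorem sum_pairs_eq {n : ℕ} (f : Fin n → Fin n → ℝ) (hf : ∀ i j, f i j = f j i) :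
    ∑ i, ∑ j, f i j = ∑ i, f i i + 2 * ∑ i, ∑ j ∈ Finset.Ioi i, f i j := by
  have h1 : ∀ i, ∑ j, f i j = f i i + ∑ j ∈ Finset.Ioi i, f i j + ∑ j ∈ Finset.Iio i, f i j := by
    intro i
    rw [← Finset.sum_filter_add_sum_filter_not Finset.univ (fun j => j < i)]
    have e1 : Finset.univ.filter (fun j => j < i) = Finset.Iio i := by ext; simp
    have e2 : Finset.univ.filter (fun j => ¬ j < i) = insert i (Finset.Ioi i) := by
      ext j; simp [le_iff_eq_or_lt]
    rw [e1, e2, Finset.sum_insert (by simp)]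
    ring
  have h2 : ∑ i, ∑ j ∈ Finset.Iio i, f i j = ∑ i, ∑ j ∈ Finset.Ioi i, f i j := by
    rw [Finset.sum_comm' (t' := Finset.univ) (s' := fun j => Finset.Ioi j) (by simp)]
    exact Finset.sum_congr rfl fun i _ => Finset.sum_congr rfl fun j _ => hf j i
  simp_rw [h1]
  rw [Finset.sum_add_distrib, Finset.sum_add_distrib, h2]
  ring

/-- The mean-field lower bound for a positive definite pair interaction: completing a square in each
cell bounds the number of pairs in the same cell below by a one-body quantity. -/
theorem sum_sameCell_ge {n : ℕ} (κ : Fin n → ℕ) (hκ : ∀ i, κ i < M) (R : ℕ → ℝ) :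
    n * ∑ i, R (κ i) ≤ ∑ i, ∑ j ∈ Finset.Ioi i, (if κ i = κ j then (1 : ℝ) else 0) + n / 2 +
      n ^ 2 / 2 * ∑ k ∈ Finset.range M, R k ^ 2 := by
  have h1 : 0 ≤ ∑ k ∈ Finset.range M, ((∑ i, if κ i = k then (1 : ℝ) else 0) - n * R k) ^ 2 :=
    Finset.sum_nonneg fun _ _ => sq_nonneg _
  have h2 : ∑ k ∈ Finset.range M, ((∑ i, if κ i = k then (1 : ℝ) else 0) - n * R k) ^ 2 =
      ∑ k ∈ Finset.range M, (∑ i, if κ i = k then (1 : ℝ) else 0) ^ 2 -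
        2 * n * ∑ k ∈ Finset.range M, (∑ i, if κ i = k then (1 : ℝ) else 0) * R k +
        n ^ 2 * ∑ k ∈ Finset.range M, R k ^ 2 := by
    rw [Finset.mul_sum, Finset.mul_sum, ← Finset.sum_sub_distrib, ← Finset.sum_add_distrib]
    refine Finset.sum_congr rfl fun k _ => ?_
    ring
  have h3 : ∑ k ∈ Finset.range M, (∑ i, if κ i = k then (1 : ℝ) else 0) * R k = ∑ i, R (κ i) := by
    simp_rw [Finset.sum_mul]
    rw [Finset.sum_comm]
    refine Finset.sum_congr rfl fun i _ => ?_
    simp [hκ i]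
  have h4 : ∑ k ∈ Finset.range M, (∑ i, if κ i = k then (1 : ℝ) else 0) ^ 2 =
      ∑ i, ∑ j, (if κ i = κ j then (1 : ℝ) else 0) := by
    simp_rw [sq, Finset.sum_mul_sum]
    rw [Finset.sum_comm]
    refine Finset.sum_congr rfl fun i _ => ?_
    rw [Finset.sum_comm]
    refine Finset.sum_congr rfl fun j _ => ?_
    simp only [ite_mul, one_mul, zero_mul]
    rw [Finset.sum_ite_eq, if_pos (Finset.mem_range.2 (hκ i))]
    simp only [eq_comm]
  have h5 := sum_pairs_eq (fun i j => if κ i = κ j then (1 : ℝ) else 0) fun i j => by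
    simp only [eq_comm]
  simp only [if_true, Finset.sum_const, Finset.card_univ, Fintype.card_fin, nsmul_eq_mul,
    mul_one] at h5
  rw [h2, h3, h4, h5] at h1
  linarith

end

/-! ### The many-body energy of a test function -/

section

variable {V : Measure ℝ} {γ : ℝ} {ψ : ℝ → ℝ} {N : ℕ} {M : ℕ} {Φ : (Fin N → ℝ) → ℂ}

/-- The mass of the density `ψ²` in the cell number `k`. -/
def cellMass (M : ℕ) (ψ : ℝ → ℝ) (k : ℕ) : ℝ :=
  ∫ y in {y | cell M y = k}, density ψ y ∂unitMeasure

theorem cellMass_nonneg (k : ℕ) : 0 ≤ cellMass M ψ k := integral_nonneg density_nonneg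

theorem measurableSet_cell (M k : ℕ) : MeasurableSet {y | cell M y = k} :=
  (measurable_cell M) (measurableSet_singleton k)

namespace IsGPMinimizer

theorem memLp_density (h : IsGPMinimizer V γ ψ) : MemLp (density ψ) 2 unitMeasure := by
  obtain ⟨C, hC⟩ := h.exists_density_le
  refine MemLp.of_bound h.measurable_density.aestronglyMeasurable C (ae_of_all _ fun x => ?_)
  rw [Real.norm_of_nonneg (density_nonneg x)]
  have := hC x
  rwa [ENNReal.ofReal_le_coe] at this

theorem cellAverage_density (h : IsGPMinimizer V γ ψ) (x : ℝ) :
    cellAverage M (fun x => ENNReal.ofReal (density ψ x)) x =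
      ENNReal.ofReal (M * cellMass M ψ (cell M x)) := by
  have hi : Integrable (density ψ) unitMeasure := h.memLp_density.integrable one_le_two
  rw [ENNReal.ofReal_mul (by positivity), ENNReal.ofReal_natCast, cellAverage, cellMass,
    ofReal_integral_eq_lintegral_ofReal hi.integrableOn (ae_of_all _ density_nonneg),
    ← lintegral_indicator (measurableSet_cell M _)]
  congr 1
  refine lintegral_congr fun y => ?_
  by_cases hy : cell M x = cell M y
  · rw [indicator_of_mem (show y ∈ {y | cell M y = cell M x} from hy.symm), sameCell, if_pos hy,
      one_mul]
  · rw [indicator_of_notMem (show y ∉ {y | cell M y = cell M x} from fun h => hy h.symm), sameCell,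
      if_neg hy, zero_mul]

theorem sum_cellMass_sq_le (h : IsGPMinimizer V γ ψ) (hM : 0 < M) :
    M * ∑ k ∈ Finset.range M, cellMass M ψ k ^ 2 ≤ ∫ x, ψ x ^ 4 ∂unitMeasure := by
  have hM' : (0 : ℝ) < M := by exact_mod_cast hM
  have hi : Integrable (fun x => density ψ x ^ 2) unitMeasure := h.memLp_density.integrable_sq
  have h1 : ∀ k ∈ Finset.range M, M * cellMass M ψ k ^ 2 ≤
      ∫ y in {y | cell M y = k}, density ψ y ^ 2 ∂unitMeasure := by
    intro k hk
    have h2 := sq_integral_norm_le (h.memLp_density.restrict {y | cell M y = k})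
    simp only [Real.norm_of_nonneg (density_nonneg _)] at h2
    have h3 : (M : ℝ) * (unitMeasure.restrict {y | cell M y = k}).real univ = 1 := by
      have := congrArg ENNReal.toReal (unitMeasure_cell hM (Finset.mem_range.1 hk))
      simpa [Measure.real] using this
    calc M * cellMass M ψ k ^ 2 ≤ M * ((unitMeasure.restrict {y | cell M y = k}).real univ *
          ∫ y in {y | cell M y = k}, density ψ y ^ 2 ∂unitMeasure) :=
          mul_le_mul_of_nonneg_left h2 hM'.le
      _ = _ := by rw [← mul_assoc, h3, one_mul]
  have h2 : ∑ k ∈ Finset.range M, ∫ y in {y | cell M y = k}, density ψ y ^ 2 ∂unitMeasure =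
      ∫ y in ⋃ k ∈ Finset.range M, {y | cell M y = k}, density ψ y ^ 2 ∂unitMeasure := by
    rw [integral_biUnion_finset _ (fun k _ => measurableSet_cell M k)]
    · intro k _ l _ hkl
      exact disjoint_left.2 fun y hy hy' => hkl (hy.symm.trans hy')
    · exact fun k _ => hi.integrableOn
  rw [Finset.mul_sum]
  refine (Finset.sum_le_sum h1).trans ?_
  rw [h2]
  refine (setIntegral_le_integral hi (ae_of_all _ fun _ => by positivity)).trans (le_of_eq ?_)
  refine integral_congr_ae ?_
  filter_upwards [ae_mem_Ioo] with x hx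
  rw [density_of_mem (Ioo_subset_Icc_self hx)]
  ring

end IsGPMinimizer

/-- The interaction energy of the particles `i`, `j` for the delta interaction. -/
def contact (Φ : (Fin N → ℝ) → ℂ) (i j : Fin N) : ℝ≥0∞ :=
  ∫⁻ z, ‖Φ (Function.update z j (z i))‖ₑ ^ 2 ∂cubeMeasure N

/-- The interaction energy of the particles `i`, `j` for the delta interaction smeared over the
cells. -/
def smeared (M : ℕ) (Φ : (Fin N → ℝ) → ℂ) (i j : Fin N) : ℝ≥0∞ :=
  ∫⁻ z, M * sameCell M (z i) (z j) * ‖Φ z‖ₑ ^ 2 ∂cubeMeasure N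

/-- The square of the `L²` norm. -/
def mass (Φ : (Fin N → ℝ) → ℂ) : ℝ≥0∞ := ∫⁻ z, ‖Φ z‖ₑ ^ 2 ∂cubeMeasure N

theorem manyBodyEnergy_eq : manyBodyEnergy V γ Φ = ∑ i, kinetic Φ i + ∑ i, potential V Φ i +
    ENNReal.ofReal (γ / N) * ∑ i, ∑ j ∈ Finset.Ioi i, contact Φ i j := rfl

theorem measurable_sameCell_apply (i j : Fin N) :
    Measurable fun z : Fin N → ℝ => (M : ℝ≥0∞) * sameCell M (z i) (z j) :=
  Measurable.const_mul ((measurable_sameCell M).comp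
    (f := fun z : Fin N → ℝ => (z i, z j))
    ((measurable_pi_apply i).prodMk (measurable_pi_apply j))) _

namespace IsBosonicTestFunction

theorem mass_lt_top (hΦ : IsBosonicTestFunction Φ) : mass Φ < ⊤ := by
  obtain ⟨C, hC⟩ := hΦ.exists_bound
  refine (lintegral_mono fun z => pow_le_pow_left' (hC z) 2).trans_lt ?_
  simp

theorem smeared_le (i j : Fin N) : smeared M Φ i j ≤ M * mass Φ := by
  rw [mass, ← lintegral_const_mul' _ _ (by simp)]
  refine lintegral_mono fun z => ?_
  gcongr
  exact mul_le_of_le_one_right' (sameCell_le_one _ _)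

theorem contact_lt_top (hΦ : IsBosonicTestFunction Φ) (i j : Fin N) : contact Φ i j < ⊤ := by
  obtain ⟨C, hC⟩ := hΦ.exists_bound
  refine (lintegral_mono fun z => pow_le_pow_left' (hC _) 2).trans_lt ?_
  simp

theorem kinetic_lt_top (hΦ : IsBosonicTestFunction Φ) (i : Fin N) : kinetic Φ i < ⊤ := by
  obtain ⟨C, hC⟩ := hΦ.exists_bound_fderiv i
  refine (lintegral_mono fun z => pow_le_pow_left' (hC _) 2).trans_lt ?_
  simp

theorem potential_lt_top (hV : IsPotential V) (hΦ : IsBosonicTestFunction Φ) (i : Fin N) :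
    potential V Φ i < ⊤ := by
  obtain ⟨C, hC⟩ := hΦ.exists_bound
  obtain ⟨K, hK, hK', h0⟩ := hΦ.exists_support i
  have h1 : ∀ z, ∫⁻ x, ‖Φ (Function.update z i x)‖ₑ ^ 2 ∂V ≤ C ^ 2 * V K := fun z => by
    rw [← lintegral_indicator_const hK.measurableSet]
    refine lintegral_mono fun x => ?_
    by_cases hx : x ∈ K
    · rw [indicator_of_mem hx]; exact pow_le_pow_left' (hC _) 2
    · simp [h0 z x hx]
  refine (lintegral_mono h1).trans_lt ?_
  simpa using ENNReal.mul_lt_top (by simp) (hV.lt_top K hK hK')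

/-- The delta interaction dominates the smeared one, up to a little kinetic energy. -/
theorem smeared_le_contact (hV : IsPotential V) (hΦ : IsBosonicTestFunction Φ) (hM : 0 < M) {s : ℝ}
    (hs : 0 < s) (hs1 : s ≤ 1) {i j : Fin N} (hij : i ≠ j) :
    ENNReal.ofReal (1 - s) * smeared M Φ i j ≤
      contact Φ i j + ENNReal.ofReal (1 / (s * M)) * kinetic Φ j := by
  have hm : Measurable fun z => M * sameCell M (z i) (z j) * ‖Φ z‖ₑ ^ 2 :=
    (measurable_sameCell_apply i j).mul hΦ.measurable_enorm_sq
  have hm2 : Measurable fun z : Fin N → ℝ => ‖Φ (Function.update z j (z i))‖ₑ ^ 2 :=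
    ((hΦ.continuous_slice j).comp (continuous_id.prodMk (continuous_apply i))).measurable.enorm.pow_const
      2
  rw [smeared, lintegral_update j hm, hΦ.kinetic_eq, contact,
    ← lintegral_const_mul' _ _ ENNReal.ofReal_ne_top,
    ← lintegral_const_mul' _ _ ENNReal.ofReal_ne_top, ← lintegral_add_left hm2]
  refine lintegral_mono_ae ?_
  filter_upwards [ae_mem_cube] with z hz
  have h1 := (hΦ.inFormDomain_slice hV z j).isH10.smeared_delta_le hM hs hs1 (hz i)
  simpa [Function.update_of_ne hij] using h1

theorem expectation_le_cellAverage (hV : IsPotential V) (hΦ : IsBosonicTestFunction Φ) (hM : 0 < M)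
    {s : ℝ} (hs : 0 < s) (hs1 : s ≤ 1) {w : ℝ → ℝ≥0∞} (hw : Measurable w)
    (hw1 : ∫⁻ x, w x ∂unitMeasure ≤ 1) (i : Fin N) :
    ENNReal.ofReal (1 - s) * expectation w Φ i ≤
      expectation (cellAverage M w) Φ i + ENNReal.ofReal (1 / (s * M)) * kinetic Φ i := by
  have hc : Measurable (cellAverage M w) := measurable_cellAverage hw
  have hm : Measurable fun z => ∫⁻ x, cellAverage M w x * ‖Φ (Function.update z i x)‖ₑ ^ 2
      ∂unitMeasure := by
    refine Measurable.lintegral_prod_right' (f := fun p : (Fin N → ℝ) × ℝ =>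
      cellAverage M w p.2 * ‖Φ (Function.update p.1 i p.2)‖ₑ ^ 2) ?_
    exact (hc.comp measurable_snd).mul ((hΦ.continuous_slice i).measurable.enorm.pow_const 2)
  rw [hΦ.expectation_eq hw, hΦ.expectation_eq hc, hΦ.kinetic_eq,
    ← lintegral_const_mul' _ _ ENNReal.ofReal_ne_top,
    ← lintegral_const_mul' _ _ ENNReal.ofReal_ne_top, ← lintegral_add_left hm]
  refine lintegral_mono fun z => ?_
  exact (hΦ.inFormDomain_slice hV z i).isH10.le_cellAverage hM hs hs1
    ((hΦ.continuous_slice i).comp (Continuous.prodMk_right z)) hw hw1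

/-- The smeared interaction dominates the mean-field interaction with the averaged density, up to the
self-interaction and the interaction energy of the density `ψ²` itself. -/
theorem sum_cellAverage_le (h : IsGPMinimizer V γ ψ) (hΦ : IsBosonicTestFunction Φ) (hM : 0 < M) :
    N * ∑ i, expectation (cellAverage M fun x => ENNReal.ofReal (density ψ x)) Φ i ≤
      ∑ i, ∑ j ∈ Finset.Ioi i, smeared M Φ i j +
      ENNReal.ofReal (N * M / 2 + N ^ 2 / 2 * ∫ x, ψ x ^ 4 ∂unitMeasure) * mass Φ := by
  have hm1 : ∀ i : Fin N, Measurable fun z : Fin N → ℝ =>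
      cellAverage M (fun x => ENNReal.ofReal (density ψ x)) (z i) * ‖Φ z‖ₑ ^ 2 := fun i =>
    ((measurable_cellAverage h.measurable_density.ennreal_ofReal).comp (measurable_pi_apply i)).mul
      hΦ.measurable_enorm_sq
  have hm2 : ∀ i j : Fin N, Measurable fun z : Fin N → ℝ =>
      M * sameCell M (z i) (z j) * ‖Φ z‖ₑ ^ 2 := fun i j =>
    (measurable_sameCell_apply i j).mul hΦ.measurable_enorm_sq
  simp only [expectation, smeared, mass]
  rw [← lintegral_finsetSum _ (fun i _ => hm1 i)]
  simp_rw [← lintegral_finsetSum (Finset.Ioi _) (fun j _ => hm2 _ j)]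
  rw [← lintegral_finsetSum _ (fun i _ => Finset.measurable_sum _ fun j _ => hm2 i j),
    ← lintegral_const_mul' _ _ (by simp), ← lintegral_const_mul' _ _ ENNReal.ofReal_ne_top,
    ← lintegral_add_left (Finset.measurable_sum _ fun i _ => Finset.measurable_sum _ fun j _ => hm2 i j)]
  refine lintegral_mono_ae ?_
  filter_upwards [ae_mem_cube] with z hz
  simp_rw [← Finset.sum_mul]
  rw [← mul_assoc, ← add_mul]
  gcongr
  simp_rw [h.cellAverage_density]
  have e1 : ∀ i j, (M : ℝ≥0∞) * sameCell M (z i) (z j) =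
      ENNReal.ofReal (M * if cell M (z i) = cell M (z j) then 1 else 0) := fun i j => by
    unfold sameCell
    split_ifs <;> simp
  have hM0 : (0 : ℝ) ≤ M := Nat.cast_nonneg M
  have hp : ∀ i j, 0 ≤ (M : ℝ) * if cell M (z i) = cell M (z j) then (1 : ℝ) else 0 := fun i j => by
    split_ifs <;> simp
  have hQ : 0 ≤ ∫ x, ψ x ^ 4 ∂unitMeasure := integral_nonneg fun x => by positivity
  simp_rw [e1]
  simp_rw [← ENNReal.ofReal_sum_of_nonneg fun j (_ : j ∈ Finset.Ioi _) => hp _ j]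
  rw [← ENNReal.ofReal_sum_of_nonneg fun i _ => mul_nonneg hM0 (cellMass_nonneg _),
    ← ENNReal.ofReal_sum_of_nonneg fun i _ => Finset.sum_nonneg fun j _ => hp i j,
    ← ENNReal.ofReal_natCast, ← ENNReal.ofReal_mul (by positivity),
    ← ENNReal.ofReal_add (Finset.sum_nonneg fun i _ => Finset.sum_nonneg fun j _ => hp i j)
      (by positivity)]
  refine ENNReal.ofReal_le_ofReal ?_
  have h1 := mul_le_mul_of_nonneg_left (sum_sameCell_ge (M := M) (fun i => cell M (z i))
    (fun i => cell_lt hM (hz i)) (cellMass M ψ)) hM0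
  have h2 := mul_le_mul_of_nonneg_left (h.sum_cellMass_sq_le hM)
    (show (0 : ℝ) ≤ N ^ 2 / 2 by positivity)
  simp_rw [← Finset.mul_sum]
  nlinarith

end IsBosonicTestFunction

end

/-! ### The lower bound on the many-body energy -/

section

variable {V : Measure ℝ} {γ : ℝ} {ψ : ℝ → ℝ} {N : ℕ} {M : ℕ} {Φ : (Fin N → ℝ) → ℂ}

namespace IsBosonicTestFunction

theorem projection_le_mass (hV : IsPotential V) (hγ : 0 ≤ γ) (h : IsGPMinimizer V γ ψ)
    (hΦ : IsBosonicTestFunction Φ) (i : Fin N) : projection ψ Φ i ≤ mass Φ := by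
  rw [mass, lintegral_update i hΦ.measurable_enorm_sq]
  refine lintegral_mono fun z => ?_
  set φ : formDomain V := ⟨_, hΦ.inFormDomain_slice hV z i⟩ with hφ
  have e1 : ∫⁻ x, ‖Φ (Function.update z i x)‖ₑ ^ 2 ∂unitMeasure =
      ENNReal.ofReal (‖embed V φ‖ ^ 2) := by
    rw [norm_embed_sq]; exact lintegral_enorm_sq φ.2.isH10.memLp
  have e5 : ‖∫ x, (ψ x : ℂ) * Φ (Function.update z i x) ∂unitMeasure‖ₑ ^ 2 =
      ENNReal.ofReal (‖⟪embed V (h.elem hV hγ), embed V φ⟫_ℂ‖ ^ 2) := by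
    have : ⟪embed V (h.elem hV hγ), embed V φ⟫_ℂ = _ :=
      inner_toLp (h.elem hV hγ).2.isH10.memLp φ.2.isH10.memLp
    rw [this, ENNReal.ofReal_pow (norm_nonneg _), ofReal_norm]
    simp only [IsGPMinimizer.elem, Complex.conj_ofReal, hφ]
  rw [e1, e5]
  refine ENNReal.ofReal_le_ofReal (pow_le_pow_left₀ (norm_nonneg _) ?_ 2)
  have := norm_inner_le_norm (𝕜 := ℂ) (embed V (h.elem hV hγ)) (embed V φ)
  rwa [h.norm_elem, one_mul] at this

/-- The lower bound on the many-body energy. The parameters are the number `M` of cells and the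
fraction `s` that is lost when values of the wave function in the same cell are compared. -/
theorem le_manyBodyEnergy (hV : IsPotential V) (hγ : 0 ≤ γ) (h : IsGPMinimizer V γ ψ)
    {e₁ d : ℝ} (hd : 0 ≤ d) (he₁ : 0 ≤ e₁)
    (hgap : ∀ φ : formDomain V, (e₁ + selfEnergy γ ψ) * ‖embed V φ‖ ^ 2 ≤
      ‖energyMap V γ h.isH10 φ‖ ^ 2 + d * ‖⟪embed V (h.elem hV hγ), embed V φ⟫_ℂ‖ ^ 2)
    (hN : 0 < N) (hM : 0 < M) {s η : ℝ} (hs : 0 < s) (hs1 : s ≤ 1) (hη1 : η ≤ 1)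
    (hη : 2 * (γ / (s * M)) + 2 * s ≤ η ∨ 2 * (γ / (s * M)) + 2 * s * γ ≤ η)
    (hΦ : IsBosonicTestFunction Φ) :
    (1 - η) * (N * e₁ * (mass Φ).toReal - d * (∑ i, projection ψ Φ i).toReal) -
      (η * N * selfEnergy γ ψ + γ * M / 2) * (mass Φ).toReal ≤ (manyBodyEnergy V γ Φ).toReal := by
  have hN' : (0 : ℝ) < N := by exact_mod_cast hN
  have hM' : (0 : ℝ) < M := by exact_mod_cast hM
  set w : ℝ → ℝ≥0∞ := fun x => ENNReal.ofReal (density ψ x) with hw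
  have hwm : Measurable w := h.measurable_density.ennreal_ofReal
  have hw1 : ∫⁻ x, w x ∂unitMeasure ≤ 1 := (h.lintegral_density hV hγ).le
  have hQ : 0 ≤ ∫ x, ψ x ^ 4 ∂unitMeasure := integral_nonneg fun x => by positivity
  have fK : ∑ i, kinetic Φ i ≠ ⊤ := ENNReal.sum_ne_top.2 fun i _ => (hΦ.kinetic_lt_top i).ne
  have fU : ∑ i, potential V Φ i ≠ ⊤ := ENNReal.sum_ne_top.2 fun i _ => (hΦ.potential_lt_top hV i).ne
  have fA : mass Φ ≠ ⊤ := hΦ.mass_lt_top.ne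
  have fB : ∑ i, projection ψ Φ i ≠ ⊤ := ENNReal.sum_ne_top.2 fun i _ =>
    ne_top_of_le_ne_top fA (hΦ.projection_le_mass hV hγ h i)
  have fP : ∑ i, expectation w Φ i ≠ ⊤ := ENNReal.sum_ne_top.2 fun i _ =>
    ne_top_of_le_ne_top (hΦ.kinetic_lt_top i).ne (hΦ.expectation_le_kinetic hV hwm hw1 i)
  have fD : ∑ i, ∑ j ∈ Finset.Ioi i, contact Φ i j ≠ ⊤ := ENNReal.sum_ne_top.2 fun i _ =>
    ENNReal.sum_ne_top.2 fun j _ => (hΦ.contact_lt_top i j).ne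
  have fW : ∑ i, ∑ j ∈ Finset.Ioi i, smeared M Φ i j ≠ ⊤ := ENNReal.sum_ne_top.2 fun i _ =>
    ENNReal.sum_ne_top.2 fun j _ => ne_top_of_le_ne_top (ENNReal.mul_ne_top (by simp) fA)
      (smeared_le i j)
  have hc := hΦ.sum_cellAverage_le h hM
  have fPb : ∑ i, expectation (cellAverage M w) Φ i ≠ ⊤ := by
    refine ne_top_of_le_ne_top (ENNReal.add_ne_top.2 ⟨fW, ENNReal.mul_ne_top ENNReal.ofReal_ne_top fA⟩)
      (le_trans (le_mul_of_one_le_left' ?_) hc)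
    exact_mod_cast hN
  -- The estimates, summed over the particles.
  have ha : ENNReal.ofReal (1 - s) * ∑ i, ∑ j ∈ Finset.Ioi i, smeared M Φ i j ≤
      ∑ i, ∑ j ∈ Finset.Ioi i, contact Φ i j +
        ENNReal.ofReal (1 / (s * M)) * (N * ∑ i, kinetic Φ i) := by
    have h1 : ∑ i : Fin N, ∑ j ∈ Finset.Ioi i, kinetic Φ j ≤ N * ∑ j, kinetic Φ j := by
      refine (Finset.sum_le_sum fun i _ => Finset.sum_le_sum_of_subset
        (Finset.subset_univ (Finset.Ioi i))).trans (le_of_eq ?_)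
      simp
    refine le_trans ?_ (add_le_add_right (mul_le_mul_right h1 _) _)
    simp_rw [Finset.mul_sum]
    rw [← Finset.sum_add_distrib]
    refine Finset.sum_le_sum fun i _ => ?_
    rw [← Finset.sum_add_distrib]
    exact Finset.sum_le_sum fun j hj => hΦ.smeared_le_contact hV hM hs hs1 (Finset.mem_Ioi.1 hj).ne
  have hb : ENNReal.ofReal (1 - s) * ∑ i, expectation w Φ i ≤
      ∑ i, expectation (cellAverage M w) Φ i +
        ENNReal.ofReal (1 / (s * M)) * ∑ i, kinetic Φ i := by
    simp_rw [Finset.mul_sum]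
    rw [← Finset.sum_add_distrib]
    exact Finset.sum_le_sum fun i _ => hΦ.expectation_le_cellAverage hV hM hs hs1 hwm hw1 i
  have hd' : N * (ENNReal.ofReal (e₁ + selfEnergy γ ψ) * mass Φ) ≤ ∑ i, kinetic Φ i +
      (ENNReal.ofReal γ * ∑ i, expectation w Φ i +
        (ENNReal.ofReal d * ∑ i, projection ψ Φ i + ∑ i, potential V Φ i)) := by
    have h1 := Finset.sum_le_sum fun i (_ : i ∈ Finset.univ) =>
      hΦ.spectral_bound hV hγ h hd hgap i
    simp only [Finset.sum_add_distrib, Finset.sum_const, Finset.card_univ, Fintype.card_fin,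
      nsmul_eq_mul] at h1
    simp only [Finset.mul_sum]
    exact h1
  have he : ∑ i, expectation w Φ i ≤ ∑ i, kinetic Φ i :=
    Finset.sum_le_sum fun i _ => hΦ.expectation_le_kinetic hV hwm hw1 i
  rw [manyBodyEnergy_eq]
  have hself : selfEnergy γ ψ = γ / 2 * ∫ x, ψ x ^ 4 ∂unitMeasure := rfl
  have hself0 : 0 ≤ selfEnergy γ ψ := selfEnergy_nonneg hγ
  generalize (∑ i, kinetic Φ i) = K at *
  generalize (∑ i, potential V Φ i) = U at *
  generalize (∑ i, projection ψ Φ i) = B at *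
  generalize (∑ i, expectation w Φ i) = P at *
  generalize (∑ i, expectation (cellAverage M w) Φ i) = Pb at *
  generalize (∑ i, ∑ j ∈ Finset.Ioi i, contact Φ i j) = D at *
  generalize (∑ i, ∑ j ∈ Finset.Ioi i, smeared M Φ i j) = W at *
  generalize mass Φ = A at *
  generalize (∫ x, ψ x ^ 4 ∂unitMeasure) = Q at *
  generalize selfEnergy γ ψ = c at *
  lift K to ℝ≥0 using fK
  lift U to ℝ≥0 using fU
  lift B to ℝ≥0 using fB
  lift P to ℝ≥0 using fP
  lift Pb to ℝ≥0 using fPb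
  lift D to ℝ≥0 using fD
  lift W to ℝ≥0 using fW
  lift A to ℝ≥0 using fA
  have e : ∀ x : ℝ≥0, (x : ℝ≥0∞) = ENNReal.ofReal x := fun x => (ENNReal.ofReal_coe_nnreal).symm
  have eN : (N : ℝ≥0∞) = ENNReal.ofReal N := (ENNReal.ofReal_natCast N).symm
  have hK := K.coe_nonneg
  have hU := U.coe_nonneg
  have hB := B.coe_nonneg
  have hP := P.coe_nonneg
  have hPb := Pb.coe_nonneg
  have hD := D.coe_nonneg
  have hW := W.coe_nonneg
  have hA := A.coe_nonneg
  simp only [e, eN] at ha hb hc hd' he ⊢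
  generalize (K : ℝ) = K at *
  generalize (U : ℝ) = U at *
  generalize (B : ℝ) = B at *
  generalize (P : ℝ) = P at *
  generalize (Pb : ℝ) = Pb at *
  generalize (D : ℝ) = D at *
  generalize (W : ℝ) = W at *
  generalize (A : ℝ) = A at *
  rw [ENNReal.ofReal_le_ofReal_iff hK] at he
  have hs' : 0 ≤ 1 - s := by linarith
  rw [← ENNReal.ofReal_mul hs', ← ENNReal.ofReal_mul hN'.le, ← ENNReal.ofReal_mul (by positivity),
    ← ENNReal.ofReal_add (by positivity) (by positivity), ENNReal.ofReal_le_ofReal_iff (by positivity)]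
    at ha
  rw [← ENNReal.ofReal_mul hs', ← ENNReal.ofReal_mul (by positivity),
    ← ENNReal.ofReal_add (by positivity) (by positivity), ENNReal.ofReal_le_ofReal_iff (by positivity)]
    at hb
  rw [← ENNReal.ofReal_mul hN'.le, ← ENNReal.ofReal_mul (by positivity),
    ← ENNReal.ofReal_add (by positivity) (by positivity), ENNReal.ofReal_le_ofReal_iff (by positivity)]
    at hc
  rw [← ENNReal.ofReal_mul (by positivity), ← ENNReal.ofReal_mul hN'.le, ← ENNReal.ofReal_mul hγ,
    ← ENNReal.ofReal_mul hd,
    ← ENNReal.ofReal_add (by positivity) (by positivity),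
    ← ENNReal.ofReal_add (by positivity) (by positivity),
    ← ENNReal.ofReal_add (by positivity) (by positivity), ENNReal.ofReal_le_ofReal_iff (by positivity)]
    at hd'
  rw [← ENNReal.ofReal_mul (by positivity),
    ← ENNReal.ofReal_add (by positivity) (by positivity),
    ← ENNReal.ofReal_add (by positivity) (by positivity), ENNReal.toReal_ofReal hA,
    ENNReal.toReal_ofReal hB, ENNReal.toReal_ofReal (by positivity)]
  set β := γ / (s * M) with hβ
  have hβ0 : 0 ≤ β := by positivity
  have ha' : (1 - s) * (γ / N * W) ≤ γ / N * D + β * K := by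
    have := mul_le_mul_of_nonneg_left ha (show 0 ≤ γ / N by positivity)
    calc _ = γ / N * ((1 - s) * W) := by ring
      _ ≤ _ := this
      _ = _ := by rw [hβ]; field_simp
  have hb' : (1 - s) * (γ * P) ≤ γ * Pb + β * K := by
    have := mul_le_mul_of_nonneg_left hb hγ
    calc _ = γ * ((1 - s) * P) := by ring
      _ ≤ _ := this
      _ = _ := by rw [hβ]; ring
  have hc' : γ * Pb ≤ γ / N * W + (γ * M / 2 + N * c) * A := by
    have := mul_le_mul_of_nonneg_left hc (show 0 ≤ γ / N by positivity)
    calc _ = γ / N * (N * Pb) := by field_simp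
      _ ≤ _ := this
      _ = _ := by rw [hself]; field_simp
  have h1 : (1 - 2 * β) * K + U + (1 - 2 * s) * (γ * P) - (γ * M / 2 + N * c) * A ≤
      K + U + γ / N * D := by
    have t1 := mul_le_mul_of_nonneg_left hc' hs'
    have t2 := mul_le_mul_of_nonneg_left hb' hs'
    have t3 : 0 ≤ s * ((γ * M / 2 + N * c) * A) := by positivity
    have t4 : 0 ≤ s * (β * K) := by positivity
    have t5 : 0 ≤ s * s * (γ * P) := by positivity
    linarith
  have h2 : (1 - η) * (K + γ * P + U) ≤ (1 - 2 * β) * K + U + (1 - 2 * s) * (γ * P) := by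
    have hγP : 0 ≤ γ * P := by positivity
    have hsγP : s * γ * P ≤ s * γ * K := mul_le_mul_of_nonneg_left he (by positivity)
    have hsγ : 0 ≤ s * γ := by positivity
    rcases hη with hη | hη
    · have t1 := mul_nonneg (show 0 ≤ η - 2 * β by linarith) hK
      have t2 := mul_nonneg (show 0 ≤ η - 2 * s by linarith) hγP
      have t3 := mul_nonneg (show 0 ≤ η by linarith) hU
      linarith
    · have t1 := mul_nonneg (show 0 ≤ η - 2 * β - 2 * s * γ by linarith) hK
      have t2 := mul_nonneg (show 0 ≤ η by linarith) hγP
      have t3 := mul_nonneg (show 0 ≤ η by linarith) hU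
      linarith
  have h3 : (1 - η) * (N * ((e₁ + c) * A) - d * B) ≤ (1 - η) * (K + γ * P + U) :=
    mul_le_mul_of_nonneg_left (by linarith) (by linarith)
  linarith

end IsBosonicTestFunction

end

/-! ### Occupancy of the condensate -/

section

variable {V : Measure ℝ} {γ : ℝ} {ψ : ℝ → ℝ} {n : ℕ} {M : ℕ}

theorem measurePreserving_perm {N : ℕ} (s : Equiv.Perm (Fin N)) :
    MeasurePreserving (fun z : Fin N → ℝ => z ∘ s) (cubeMeasure N) (cubeMeasure N) := by
  have h := measurePreserving_piCongrLeft (fun _ : Fin N => unitMeasure) s.symm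
  have e : (MeasurableEquiv.piCongrLeft (fun _ : Fin N => ℝ) s.symm : (Fin N → ℝ) → Fin N → ℝ) =
      fun z => z ∘ s := by
    funext z i
    obtain ⟨j, rfl⟩ := s.symm.surjective i
    rw [MeasurableEquiv.coe_piCongrLeft, Equiv.piCongrLeft_apply_apply]
    simp
  rw [e] at h
  exact h

theorem occupancy_reducedDensityMatrix (Ψ : ManyParticle (n + 1)) (f : OneParticle) :
    occupancy (reducedDensityMatrix Ψ) f = ((n + 1 : ℕ) : ℝ) * ‖overlap Ψ f‖ ^ 2 := by
  rw [occupancy, reducedDensityMatrix, _root_.smul_apply, inner_smul_right,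
    ContinuousLinearMap.comp_apply, ContinuousLinearMap.adjoint_inner_right, inner_self_eq_norm_sq_to_K]
  simp [← Complex.ofReal_pow]

theorem norm_overlap_le (Ψ : ManyParticle (n + 1)) (f : OneParticle) :
    ‖overlap Ψ f‖ ≤ ‖Ψ‖ * ‖f‖ :=
  (ContinuousLinearMap.le_opNorm _ _).trans (mul_le_mul_of_nonneg_right
    (LinearMap.mkContinuous_norm_le _ (norm_nonneg _) _) (norm_nonneg _))

theorem coeFn_overlap (Ψ : ManyParticle (n + 1)) (f : OneParticle) :
    overlap Ψ f =ᵐ[cubeMeasure n] overlapFun Ψ f := MemLp.coeFn_toLp (memLp_overlapFun Ψ f)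

/-- Functions that agree almost everywhere on the cube agree almost everywhere on almost every
slice. -/
theorem ae_slice_eq {f g : (Fin (n + 1) → ℝ) → ℂ} (h : f =ᵐ[cubeMeasure (n + 1)] g) :
    ∀ᵐ z ∂cubeMeasure n, (fun y => f (Fin.cons y z)) =ᵐ[unitMeasure] fun y => g (Fin.cons y z) := by
  have h1 := (measurePreserving_cons n).quasiMeasurePreserving.ae_eq_comp h
  exact Measure.ae_ae_of_ae_prod (Measure.measurePreserving_swap.quasiMeasurePreserving.ae h1)

theorem overlap_sub (Ψ Ψ' : ManyParticle (n + 1)) (f : OneParticle) :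
    overlap (Ψ - Ψ') f = overlap Ψ f - overlap Ψ' f := by
  refine Lp.ext ?_
  filter_upwards [coeFn_overlap (Ψ - Ψ') f, Lp.coeFn_sub (overlap Ψ f) (overlap Ψ' f),
    coeFn_overlap Ψ f, coeFn_overlap Ψ' f, ae_slice_eq (Lp.coeFn_sub Ψ Ψ'), ae_integrable_slice Ψ,
    ae_integrable_slice Ψ'] with z h1 h2 h3 h4 h5 h6 h7
  rw [h1, h2, Pi.sub_apply, h3, h4, overlapFun, overlapFun, overlapFun, ← integral_sub (h6 f) (h7 f)]
  refine integral_congr_ae ?_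
  filter_upwards [h5] with y hy
  rw [hy, Pi.sub_apply, map_sub, sub_mul]

theorem tendsto_overlap {Ψ : ManyParticle (n + 1)} {Ψk : ℕ → ManyParticle (n + 1)}
    (h : Tendsto Ψk atTop (𝓝 Ψ)) (f : OneParticle) :
    Tendsto (fun k => overlap (Ψk k) f) atTop (𝓝 (overlap Ψ f)) := by
  rw [tendsto_iff_norm_sub_tendsto_zero] at h ⊢
  refine squeeze_zero (fun _ => norm_nonneg _) (fun k => ?_) (by simpa using h.mul_const ‖f‖)
  rw [← overlap_sub]
  exact norm_overlap_le _ _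

namespace IsBosonicTestFunction

variable {Φ : (Fin (n + 1) → ℝ) → ℂ}

theorem memLp {N : ℕ} {Φ : (Fin N → ℝ) → ℂ} (hΦ : IsBosonicTestFunction Φ) :
    MemLp Φ 2 (cubeMeasure N) := by
  obtain ⟨C, hC⟩ := hΦ.exists_bound
  refine MemLp.of_bound hΦ.continuous.aestronglyMeasurable C (ae_of_all _ fun z => ?_)
  have := hC z
  rw [← ofReal_norm, ENNReal.ofReal_le_coe] at this
  exact this

theorem mass_eq {N : ℕ} {Φ : (Fin N → ℝ) → ℂ} (hΦ : IsBosonicTestFunction Φ) :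
    mass Φ = ENNReal.ofReal (‖hΦ.memLp.toLp‖ ^ 2) := by
  rw [norm_toLp_sq]
  exact lintegral_enorm_sq hΦ.memLp

theorem projection_eq_zero (h : IsGPMinimizer V γ ψ) (hΦ : IsBosonicTestFunction Φ)
    (i : Fin (n + 1)) : projection ψ Φ i = projection ψ Φ 0 := by
  rw [projection, projection, ← (measurePreserving_perm (Equiv.swap 0 i)).lintegral_comp
    (hΦ.measurable_projection h 0)]
  refine lintegral_congr fun z => ?_
  congr 3
  funext x
  rw [← hΦ.symm (Equiv.swap 0 i) (Function.update z i x)]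
  congr 2
  funext j
  by_cases hj : j = 0
  · subst hj; simp
  · have : (Equiv.swap 0 i) j ≠ i := fun h => hj (by simpa using congrArg (Equiv.swap 0 i) h)
    simp [Function.update_of_ne hj, Function.update_of_ne this]

theorem projection_zero_eq (h : IsGPMinimizer V γ ψ) (hΦ : IsBosonicTestFunction Φ) :
    projection ψ Φ 0 = ENNReal.ofReal (‖overlap hΦ.memLp.toLp h.state‖ ^ 2) := by
  have h1 : ∀ᵐ z ∂cubeMeasure n, ‖overlapFun hΦ.memLp.toLp h.state z‖ₑ ^ 2 =
      ‖∫ x, (ψ x : ℂ) * Φ (Fin.cons x z) ∂unitMeasure‖ₑ ^ 2 := by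
    filter_upwards [ae_slice_eq hΦ.memLp.coeFn_toLp] with z hz
    have h2 : overlapFun hΦ.memLp.toLp h.state z =
        conj (∫ x, (ψ x : ℂ) * Φ (Fin.cons x z) ∂unitMeasure) := by
      rw [overlapFun, ← integral_conj]
      refine integral_congr_ae ?_
      filter_upwards [hz, h.isH10.memLp.coeFn_toLp] with y hy hy2
      rw [hy, IsGPMinimizer.state, hy2, map_mul, Complex.conj_ofReal, mul_comm]
    rw [h2, RCLike.enorm_conj]
  have h3 : ENNReal.ofReal (‖overlap hΦ.memLp.toLp h.state‖ ^ 2) =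
      ∫⁻ z, ‖∫ x, (ψ x : ℂ) * Φ (Fin.cons x z) ∂unitMeasure‖ₑ ^ 2 ∂cubeMeasure n := by
    rw [← lintegral_congr_ae h1, lintegral_enorm_sq (memLp_overlapFun _ _),
      ← norm_toLp_sq (memLp_overlapFun _ _)]
    rfl
  have hm := hΦ.measurable_projection h 0
  have e : ∀ y (z : Fin n → ℝ) x, Function.update (Fin.cons y z : Fin (n + 1) → ℝ) 0 x =
      Fin.cons x z := fun y z x => by simp [Fin.update_cons_zero]
  rw [h3, projection, ← (measurePreserving_cons n).lintegral_comp hm]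
  simp_rw [e]
  refine (measurePreserving_snd (μ := unitMeasure) (ν := cubeMeasure n)).lintegral_comp
    (f := fun z => ‖∫ x, (ψ x : ℂ) * Φ (Fin.cons x z) ∂unitMeasure‖ₑ ^ 2) ?_
  have := hm.comp ((measurePreserving_cons n).measurable.comp (measurable_prodMk_left (x := 0)))
  simpa only [Function.comp_def, e] using this

/-- The sum of the projections is the occupancy of the condensate. -/
theorem sum_projection_eq (h : IsGPMinimizer V γ ψ) (hΦ : IsBosonicTestFunction Φ) :
    (∑ i, projection ψ Φ i).toReal = occupancy (reducedDensityMatrix hΦ.memLp.toLp) h.state := by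
  simp_rw [hΦ.projection_eq_zero h, hΦ.projection_zero_eq h]
  rw [occupancy_reducedDensityMatrix, Finset.sum_const, Finset.card_univ, Fintype.card_fin,
    nsmul_eq_mul, ENNReal.toReal_mul, ENNReal.toReal_natCast, ENNReal.toReal_ofReal (by positivity)]

end IsBosonicTestFunction

/-- The lower bound on the many-body energy for the closed quadratic form. -/
theorem le_closedEnergy (hV : IsPotential V) (hγ : 0 ≤ γ) (h : IsGPMinimizer V γ ψ)
    {e₁ d : ℝ} (hd : 0 ≤ d) (he₁ : 0 ≤ e₁)
    (hgap : ∀ φ : formDomain V, (e₁ + selfEnergy γ ψ) * ‖embed V φ‖ ^ 2 ≤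
      ‖energyMap V γ h.isH10 φ‖ ^ 2 + d * ‖⟪embed V (h.elem hV hγ), embed V φ⟫_ℂ‖ ^ 2)
    (hM : 0 < M) {s η : ℝ} (hs : 0 < s) (hs1 : s ≤ 1) (hη1 : η ≤ 1)
    (hη : 2 * (γ / (s * M)) + 2 * s ≤ η ∨ 2 * (γ / (s * M)) + 2 * s * γ ≤ η)
    {Ψ : ManyParticle (n + 1)} (hΨ : ‖Ψ‖ = 1) {E : ℝ}
    (hE : closedEnergy V γ Ψ ≤ ENNReal.ofReal E) :
    (1 - η) * ((n + 1 : ℕ) * e₁ - d * occupancy (reducedDensityMatrix Ψ) h.state) -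
      (η * (n + 1 : ℕ) * selfEnergy γ ψ + γ * M / 2) ≤ max E 0 := by
  refine le_of_forall_pos_le_add fun ε hε => ?_
  have h1 : closedEnergy V γ Ψ < ENNReal.ofReal (max E 0 + ε) := by
    refine hE.trans_lt ((ENNReal.ofReal_lt_ofReal_iff (by positivity)).2 ?_)
    linarith [le_max_left E 0]
  simp only [closedEnergy, iInf_lt_iff] at h1
  obtain ⟨Φ, hΦ, hlim, hlt⟩ := h1
  have hfr := frequently_lt_of_liminf_lt (by isBoundedDefault) hlt
  have hconv : Tendsto (fun k => (hΦ k).memLp.toLp) atTop (𝓝 Ψ) := by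
    rw [tendsto_iff_edist_tendsto_0]
    refine hlim.congr fun k => ?_
    rw [Lp.edist_def]
    refine eLpNorm_congr_ae ?_
    filter_upwards [(hΦ k).memLp.coeFn_toLp] with z hz
    rw [Pi.sub_apply, hz]
  have hA : Tendsto (fun k => (mass (Φ k)).toReal) atTop (𝓝 1) := by
    have := (hconv.norm.pow 2)
    rw [hΨ, one_pow] at this
    refine this.congr fun k => ?_
    rw [(hΦ k).mass_eq, ENNReal.toReal_ofReal (by positivity)]
  have hB : Tendsto (fun k => (∑ i, projection ψ (Φ k) i).toReal) atTop
      (𝓝 (occupancy (reducedDensityMatrix Ψ) h.state)) := by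
    simp_rw [(hΦ _).sum_projection_eq h, occupancy_reducedDensityMatrix]
    exact ((tendsto_overlap hconv _).norm.pow 2).const_mul _
  have hlimit : Tendsto (fun k => (1 - η) * ((n + 1 : ℕ) * e₁ * (mass (Φ k)).toReal -
      d * (∑ i, projection ψ (Φ k) i).toReal) -
      (η * (n + 1 : ℕ) * selfEnergy γ ψ + γ * M / 2) * (mass (Φ k)).toReal) atTop
      (𝓝 ((1 - η) * ((n + 1 : ℕ) * e₁ * 1 - d * occupancy (reducedDensityMatrix Ψ) h.state) -
      (η * (n + 1 : ℕ) * selfEnergy γ ψ + γ * M / 2) * 1)) :=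
    (((hA.const_mul _).sub (hB.const_mul _)).const_mul _).sub (hA.const_mul _)
  rw [mul_one, mul_one] at hlimit
  refine le_of_tendsto_of_frequently hlimit (hfr.mono fun k hk => ?_)
  refine ((hΦ k).le_manyBodyEnergy hV hγ h hd he₁ hgap n.succ_pos hM hs hs1 hη1 hη).trans ?_
  have := ENNReal.toReal_mono ENNReal.ofReal_ne_top hk.le
  rwa [ENNReal.toReal_ofReal (by positivity)] at this

end

/-! ### Smooth approximation of the condensate wave function -/

section

variable {V : Measure ℝ} {γ : ℝ} {ψ : ℝ → ℝ}

theorem norm_integral_sub_le {g f : ℝ → ℂ} (hg : MemLp g 2 unitMeasure) (hf : MemLp f 2 unitMeasure)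
    {x : ℝ} (hx : x ∈ Icc (0 : ℝ) 1) :
    ‖(∫ t in (0 : ℝ)..x, g t) - ∫ t in (0 : ℝ)..x, f t‖ ≤ (eLpNorm (g - f) 2 unitMeasure).toReal := by
  have hi : Integrable (g - f) unitMeasure := (hg.sub hf).integrable one_le_two
  have h1 : ‖(∫ t in (0 : ℝ)..x, g t) - ∫ t in (0 : ℝ)..x, f t‖ ≤
      ∫ t, ‖(g - f) t‖ ∂unitMeasure := by
    rw [← intervalIntegral.integral_sub
      (intervalIntegrable_of_integrable (hg.integrable one_le_two) (by simp) hx)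
      (intervalIntegrable_of_integrable (hf.integrable one_le_two) (by simp) hx),
      intervalIntegral.integral_of_le hx.1]
    refine (norm_integral_le_integral_norm _).trans ?_
    rw [unitMeasure]
    refine setIntegral_mono_set ?_ (ae_of_all _ fun _ => norm_nonneg _) (ae_of_all _ ?_)
    · exact hi.norm
    · exact fun t ht => ⟨ht.1.le, ht.2.trans hx.2⟩
  have h2 := sq_integral_norm_le (hg.sub hf)
  rw [probReal_univ, one_mul, ← norm_toLp_sq (hg.sub hf)] at h2
  have h3 := abs_le_of_sq_le_sq h2 (norm_nonneg _)
  rw [Lp.norm_toLp] at h3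
  exact h1.trans ((le_abs_self _).trans h3)

theorem exists_cutoff {K : Set ℝ} (hK : IsCompact K) (hK' : K ⊆ Ioo 0 1) :
    ∃ θ : ℝ → ℝ, ContDiff ℝ ∞ θ ∧ HasCompactSupport θ ∧ tsupport θ ⊆ Ioo 0 1 ∧
      (∀ x, |θ x| ≤ 1) ∧ ∀ x ∈ K, θ x = 1 := by
  have hb : Ioo (0 : ℝ) 1 = Metric.ball (1 / 2) (1 / 2) := by rw [Real.ball_eq_Ioo]; norm_num
  rw [hb] at hK' ⊢
  obtain ⟨r, hr, hKr⟩ := exists_pos_lt_subset_ball (by norm_num) hK.isClosed hK'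
  let θ : ContDiffBump (1 / 2 : ℝ) := ⟨r, (r + 1 / 2) / 2, hr.1, by linarith [hr.2]⟩
  refine ⟨θ, θ.contDiff, θ.hasCompactSupport, ?_, fun x => ?_, fun x hx => ?_⟩
  · rw [θ.tsupport_eq]
    exact Metric.closedBall_subset_ball (show (r + 1 / 2) / 2 < 1 / 2 by linarith [hr.2])
  · rw [abs_of_nonneg θ.nonneg]
    exact θ.le_one
  · exact θ.one_of_mem_closedBall (Metric.ball_subset_closedBall (hKr hx))

/-- Functions in the form domain with compact support in the open interval are limits of smooth
functions with compact support, for the energy. -/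
theorem exists_smooth_seq (hV : IsPotential V) (u : formDomain V) {K : Set ℝ} (hK : IsCompact K)
    (hK' : K ⊆ Ioo 0 1) (hu : ∀ x ∈ Icc (0 : ℝ) 1, x ∉ K → u.1 x = 0) :
    ∃ χ : ℕ → formDomain V, (∀ k, ContDiff ℝ ∞ (χ k).1 ∧ HasCompactSupport (χ k).1 ∧
      tsupport (χ k).1 ⊆ Ioo 0 1) ∧
      Tendsto (fun k => ‖embed V (χ k)‖) atTop (𝓝 ‖embed V u‖) ∧
      Tendsto (fun k => ‖weakDeriv V (χ k)‖ ^ 2 + ‖potentialEmbed V (χ k)‖ ^ 2 +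
        γ / 2 * ∫ x, ‖(χ k).1 x‖ ^ 4 ∂unitMeasure) atTop
        (𝓝 (‖weakDeriv V u‖ ^ 2 + ‖potentialEmbed V u‖ ^ 2 +
          γ / 2 * ∫ x, ‖u.1 x‖ ^ 4 ∂unitMeasure)) := by
  obtain ⟨θ, hθ, hθc, hθs, hθ1, hθK⟩ := exists_cutoff hK hK'
  have hτ : ∀ k : ℕ, (0 : ℝ) < 1 / ((k : ℝ) + 1) := fun k => by positivity
  choose g hgc hg hgu using fun k => u.2.isH10.memLp_deriv.exist_eLpNorm_sub_le (by simp) (by simp) (hτ k)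
  have hgm : ∀ k, MemLp (g k) 2 unitMeasure := fun k =>
    memLp_of_continuousOn (hg k).continuous.continuousOn
  set v : ℕ → ℝ → ℂ := fun k x => ∫ t in (0 : ℝ)..x, g k t with hv
  have hvd : ∀ k x, HasDerivAt (v k) (g k x) x := fun k x =>
    intervalIntegral.integral_hasDerivAt_right ((hg k).continuous.intervalIntegrable _ _)
      ((hg k).continuous.stronglyMeasurableAtFilter _ _) (hg k).continuous.continuousAt
  have hvs : ∀ k, ContDiff ℝ ∞ (v k) := fun k => by
    rw [contDiff_infty_iff_deriv]
    refine ⟨fun x => (hvd k x).differentiableAt, ?_⟩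
    rw [show deriv (v k) = g k from funext fun x => (hvd k x).deriv]
    exact hg k
  have hvu : ∀ k, ∀ x ∈ Icc (0 : ℝ) 1, ‖v k x - u.1 x‖ ≤ 1 / ((k : ℝ) + 1) := fun k x hx => by
    rw [u.2.isH10.eq_integral_deriv hx]
    refine (norm_integral_sub_le (hgm k) u.2.isH10.memLp_deriv hx).trans ?_
    rw [eLpNorm_sub_comm]
    exact ENNReal.toReal_le_of_le_ofReal (hτ k).le (hgu k)
  set χ : ℕ → ℝ → ℂ := fun k x => (θ x : ℂ) * v k x with hχ
  have hθC : ContDiff ℝ ∞ fun x => (θ x : ℂ) := Complex.ofRealCLM.contDiff.comp hθ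
  have hχs : ∀ k, ContDiff ℝ ∞ (χ k) := fun k => hθC.mul (hvs k)
  have hsupp : ∀ k, tsupport (χ k) ⊆ tsupport θ := fun k =>
    closure_mono fun x hx h0 => hx (by simp [hχ, h0])
  have hχc : ∀ k, HasCompactSupport (χ k) := fun k => hθc.of_isClosed_subset (isClosed_tsupport _) (hsupp k)
  have hmem : ∀ k, InFormDomain V (χ k) := fun k => by
    obtain ⟨C, hC⟩ := ((hχs k).of_le (by exact_mod_cast le_top (a := (1 : ℕ∞))) :
      ContDiff ℝ 1 (χ k)).lipschitzWith_of_hasCompactSupport (hχc k) one_ne_zero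
    exact inFormDomain_of_lipschitz hV hC hθc hθs fun x hx => by
      have : θ x = 0 := image_eq_zero_of_notMem_tsupport hx
      simp [hχ, this]
  have hθu : ∀ x ∈ Icc (0 : ℝ) 1, (θ x : ℂ) * u.1 x = u.1 x := fun x hx => by
    by_cases hxK : x ∈ K
    · rw [hθK x hxK]; simp
    · rw [hu x hx hxK, mul_zero]
  have hdiff : ∀ k, ∀ x ∈ Icc (0 : ℝ) 1, ‖χ k x - u.1 x‖ ≤ 1 / ((k : ℝ) + 1) := fun k x hx => by
    rw [← hθu x hx, hχ, ← mul_sub, norm_mul, Complex.norm_real, Real.norm_eq_abs]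
    exact (mul_le_of_le_one_left (norm_nonneg _) (hθ1 x)).trans (hvu k x hx)
  have hzero : Tendsto (fun k : ℕ => 1 / ((k : ℝ) + 1)) atTop (𝓝 0) :=
    tendsto_one_div_add_atTop_nhds_zero_nat
  set X : ℕ → formDomain V := fun k => ⟨χ k, hmem k⟩ with hX
  refine ⟨X, fun k => ⟨hχs k, hχc k, (hsupp k).trans hθs⟩, ?_, ?_⟩
  · refine Tendsto.norm ?_
    rw [tendsto_iff_norm_sub_tendsto_zero]
    refine squeeze_zero (fun _ => norm_nonneg _) (fun k => ?_) hzero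
    rw [← map_sub]
    refine (abs_le_of_sq_le_sq' ?_ (hτ k).le).2
    rw [norm_embed_sq]
    calc ∫ x, ‖(X k - u).1 x‖ ^ 2 ∂unitMeasure ≤ ∫ x, (1 / ((k : ℝ) + 1)) ^ 2 ∂unitMeasure := by
          refine integral_mono_ae (integrable_of_continuousOn
            ((X k - u).2.isH10.continuousOn.norm.pow 2)) (integrable_const _) ?_
          filter_upwards [ae_mem_Ioo] with x hx
          exact pow_le_pow_left₀ (norm_nonneg _) (hdiff k x (Ioo_subset_Icc_self hx)) 2
      _ = _ := by simp
  · obtain ⟨D, hD⟩ : ∃ D, ∀ x, ‖deriv (fun x => (θ x : ℂ)) x‖ ≤ D := by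
      obtain ⟨D, hD⟩ := (hθC.continuous_deriv (by simp)).bounded_above_of_compact_support
        (f := deriv fun x => (θ x : ℂ)) (HasCompactSupport.deriv (hθc.comp_left (g := Complex.ofReal) (by simp)))
      exact ⟨D, hD⟩
    have hD0 : 0 ≤ D := (norm_nonneg _).trans (hD 0)
    refine ((Tendsto.pow (Tendsto.norm ?_) 2).add (Tendsto.pow (Tendsto.norm ?_) 2)).add
      (Tendsto.const_mul _ ?_)
    · rw [tendsto_iff_norm_sub_tendsto_zero]
      refine squeeze_zero (fun _ => norm_nonneg _) (fun k => ?_)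
        (by simpa only [mul_zero] using hzero.const_mul (D + 1))
      have hae : ∀ᵐ x ∂unitMeasure, ‖(deriv (χ k) - deriv u.1) x‖ ≤
          ‖D * (1 / ((k : ℝ) + 1)) + ‖(deriv u.1 - g k) x‖‖ := by
        filter_upwards [ae_mem_Ioo, u.2.isH10.ae_differentiableAt] with x hx hxd
        have h1 : HasDerivAt (χ k) (deriv (fun x => (θ x : ℂ)) x * v k x + θ x * g k x) x :=
          ((hθC.differentiable (by simp)) x).hasDerivAt.mul (hvd k x)
        have h2 : HasDerivAt (fun x => (θ x : ℂ) * u.1 x)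
            (deriv (fun x => (θ x : ℂ)) x * u.1 x + θ x * deriv u.1 x) x :=
          ((hθC.differentiable (by simp)) x).hasDerivAt.mul hxd.hasDerivAt
        have h3 : deriv u.1 x = deriv (fun x => (θ x : ℂ)) x * u.1 x + θ x * deriv u.1 x := by
          rw [← h2.deriv]
          refine Filter.EventuallyEq.deriv_eq ?_
          filter_upwards [isOpen_Ioo.mem_nhds hx] with y hy
          exact (hθu y (Ioo_subset_Icc_self hy)).symm
        rw [Pi.sub_apply, h1.deriv, h3, Real.norm_of_nonneg (by positivity), add_sub_add_comm,
          ← mul_sub, ← mul_sub]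
        refine (norm_add_le _ _).trans (add_le_add ?_ ?_)
        · rw [norm_mul]
          exact mul_le_mul (hD x) (hvu k x (Ioo_subset_Icc_self hx)) (norm_nonneg _) hD0
        · rw [norm_mul, Complex.norm_real, Real.norm_eq_abs, norm_sub_rev]
          exact mul_le_of_le_one_left (norm_nonneg _) (hθ1 x)
      have hb : eLpNorm (deriv (χ k) - deriv u.1) 2 unitMeasure ≤
          ENNReal.ofReal ((D + 1) * (1 / ((k : ℝ) + 1))) := by
        have hmd : AEStronglyMeasurable (fun x => ‖(deriv u.1 - g k) x‖) unitMeasure :=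
          (u.2.isH10.memLp_deriv.sub (hgm k)).1.norm
        refine (eLpNorm_mono_ae hae).trans ((eLpNorm_add_le (f := fun _ => D * (1 / ((k : ℝ) + 1)))
          aestronglyMeasurable_const hmd (by simp)).trans ?_)
        rw [eLpNorm_norm, eLpNorm_const' _ (by simp) (by simp), add_mul, one_mul, ENNReal.ofReal_add
          (by positivity) (by positivity)]
        refine add_le_add (le_of_eq ?_) (hgu k)
        simp only [measure_univ, ENNReal.one_rpow, mul_one]
        exact Real.enorm_of_nonneg (by positivity)
      have e : ‖weakDeriv V (X k) - weakDeriv V u‖ =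
          (eLpNorm (deriv (χ k) - deriv u.1) 2 unitMeasure).toReal := by
        change ‖(hmem k).isH10.memLp_deriv.toLp _ - u.2.isH10.memLp_deriv.toLp _‖ = _
        rw [← MemLp.toLp_sub, Lp.norm_toLp]
      rw [e]
      exact ENNReal.toReal_le_of_le_ofReal (by positivity) hb
    · have hVK : V (tsupport θ) < ⊤ := hV.lt_top _ hθc hθs
      rw [tendsto_iff_norm_sub_tendsto_zero]
      refine squeeze_zero (fun _ => norm_nonneg _) (fun k => ?_)
        (by simpa only [mul_zero] using hzero.const_mul (√(V (tsupport θ)).toReal))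
      rw [← map_sub]
      refine (abs_le_of_sq_le_sq' ?_ (by positivity)).2
      rw [norm_potentialEmbed_sq, mul_pow, Real.sq_sqrt ENNReal.toReal_nonneg]
      have h1 : ∀ᵐ x ∂V, ‖(X k - u).1 x‖ ^ 2 ≤
          (tsupport θ).indicator (fun _ => (1 / ((k : ℝ) + 1)) ^ 2) x := by
        filter_upwards [hV.ae_mem] with x hx
        by_cases hxs : x ∈ tsupport θ
        · rw [indicator_of_mem hxs]
          exact pow_le_pow_left₀ (norm_nonneg _) (hdiff k x (Ioo_subset_Icc_self hx)) 2
        · rw [indicator_of_notMem hxs]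
          have h0 : θ x = 0 := image_eq_zero_of_notMem_tsupport hxs
          have h1 := hθu x (Ioo_subset_Icc_self hx)
          rw [h0, Complex.ofReal_zero, zero_mul] at h1
          change ‖χ k x - u.1 x‖ ^ 2 ≤ 0
          simp [hχ, h0, ← h1]
      have hms : MeasurableSet (tsupport θ) := (isClosed_tsupport θ).measurableSet
      refine (integral_mono_ae ((X k - u).2.memLp_potential.integrable_norm_pow two_ne_zero)
        ((integrable_indicator_iff hms).2 (integrableOn_const hVK.ne)) h1).trans (le_of_eq ?_)
      rw [integral_indicator hms, setIntegral_const, smul_eq_mul, Measure.real]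
    · obtain ⟨B, hB⟩ := isCompact_Icc.exists_bound_of_continuousOn u.2.isH10.continuousOn
      refine tendsto_integral_of_dominated_convergence (fun _ => (B + 1) ^ 4)
        (fun k => ((hχs k).continuous.norm.pow 4).aestronglyMeasurable) (integrable_const _)
        (fun k => ?_) ?_
      · filter_upwards [ae_mem_Ioo] with x hx
        have hx' := Ioo_subset_Icc_self hx
        rw [Real.norm_of_nonneg (by positivity)]
        refine pow_le_pow_left₀ (norm_nonneg _) ?_ 4
        have h1 := hdiff k x hx'
        have h2 : 1 / ((k : ℝ) + 1) ≤ 1 := by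
          rw [div_le_one (by positivity)]; linarith [(Nat.cast_nonneg k : (0 : ℝ) ≤ k)]
        have h3 := norm_add_le (u.1 x) (χ k x - u.1 x)
        rw [add_sub_cancel] at h3
        change ‖χ k x‖ ≤ B + 1
        linarith [hB x hx']
      · filter_upwards [ae_mem_Ioo] with x hx
        refine (Tendsto.norm ?_).pow 4
        rw [tendsto_iff_norm_sub_tendsto_zero]
        exact squeeze_zero (fun _ => norm_nonneg _)
          (fun k => hdiff k x (Ioo_subset_Icc_self hx)) hzero

end

/-! ### Smooth normalized trial functions -/

section

variable {V : Measure ℝ} {γ : ℝ} {ψ : ℝ → ℝ}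

/-- Functions whose increments are dominated by those of a function of class `H¹₀`. -/
theorem IsH10.of_norm_sub_le {φ u : ℝ → ℂ} (h : IsH10 φ) (hd : ∀ x y, ‖u x - u y‖ ≤ ‖φ x - φ y‖)
    (h0 : u 0 = 0) (h1 : u 1 = 0) :
    IsH10 u ∧ ∀ᵐ x ∂unitMeasure, ‖deriv u x‖ ≤ ‖deriv φ x‖ := by
  have hac : AbsolutelyContinuousOnInterval u 0 1 :=
    absolutelyContinuous_of_dist_le h.absolutelyContinuous 1 fun x _ y _ => by
      rw [dist_eq_norm, dist_eq_norm, one_mul]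
      exact hd x y
  have hder : ∀ᵐ x ∂unitMeasure, ‖deriv u x‖ ≤ ‖deriv φ x‖ := by
    filter_upwards [h.ae_differentiableAt, absolutelyContinuous_ae_differentiableAt hac] with x h2 h3
    refine le_of_tendsto_of_tendsto' (hasDerivAt_iff_tendsto_slope.1 h3.hasDerivAt).norm
      (hasDerivAt_iff_tendsto_slope.1 h2.hasDerivAt).norm fun y => ?_
    simp only [slope, vsub_eq_sub, norm_smul]
    exact mul_le_mul_of_nonneg_left (hd y x) (norm_nonneg _)
  exact ⟨⟨hac, h.memLp_deriv.mono (measurable_deriv u).aestronglyMeasurable hder, h0, h1⟩, hder⟩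

namespace IsGPMinimizer

/-- The truncations `(ψ - δ)₊` have compact support in the open interval, their energy is at most
that of `ψ`, and they are close to `ψ`. -/
theorem exists_truncation (hV : IsPotential V) (hγ : 0 ≤ γ) (h : IsGPMinimizer V γ ψ) {δ : ℝ}
    (hδ : 0 < δ) :
    ∃ u : formDomain V, (∃ K : Set ℝ, IsCompact K ∧ K ⊆ Ioo 0 1 ∧
      ∀ x ∈ Icc (0 : ℝ) 1, x ∉ K → u.1 x = 0) ∧
      ‖weakDeriv V u‖ ^ 2 + ‖potentialEmbed V u‖ ^ 2 + γ / 2 * ∫ x, ‖u.1 x‖ ^ 4 ∂unitMeasure ≤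
        h.energy hV hγ ∧ 1 - δ ≤ ‖embed V u‖ := by
  set u : ℝ → ℂ := fun x => ((max (ψ x - δ) 0 : ℝ) : ℂ) with hu
  have h0 : ψ 0 = 0 := by simpa using h.isH10.zero_left
  have h1 : ψ 1 = 0 := by simpa using h.isH10.zero_right
  have hle : ∀ x, ‖u x‖ₑ ≤ ‖(ψ x : ℂ)‖ₑ := fun x => by
    rw [← ofReal_norm, ← ofReal_norm]
    refine ENNReal.ofReal_le_ofReal ?_
    simp only [hu, Complex.norm_real, Real.norm_eq_abs]
    rw [abs_of_nonneg (le_max_right _ _)]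
    exact max_le (by linarith [le_abs_self (ψ x)]) (abs_nonneg _)
  obtain ⟨huH, hud⟩ := h.isH10.of_norm_sub_le (u := u) (fun x y => by
    simp only [hu, ← Complex.ofReal_sub, Complex.norm_real, Real.norm_eq_abs]
    refine (abs_max_sub_max_le_abs _ _ _).trans (le_of_eq ?_)
    rw [sub_sub_sub_cancel_right]) (by simp [hu, h0, hδ.le]) (by simp [hu, h1, hδ.le])
  have hVu : ∫⁻ x, ‖u x‖ₑ ^ 2 ∂V < ⊤ := by
    refine (lintegral_mono fun x => pow_le_pow_left' (hle x) 2).trans_lt ?_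
    rw [lintegral_enorm_sq (h.inFormDomain hV hγ).memLp_potential]
    exact ENNReal.ofReal_lt_top
  set U : formDomain V := ⟨u, hV.inFormDomain huH hVu⟩ with hU
  refine ⟨U, ⟨{x | x ∈ Icc 0 1 ∧ ψ x ∈ Ici δ}, ?_, ?_, fun x hx hxK => ?_⟩, ?_, ?_⟩
  · exact isCompact_Icc.of_isClosed_subset
      (h.continuousOn.preimage_isClosed_of_isClosed isClosed_Icc isClosed_Ici) fun x hx => hx.1
  · rintro x ⟨hx, hxδ⟩
    have hxδ' : δ ≤ ψ x := hxδ
    refine ⟨lt_of_le_of_ne hx.1 ?_, lt_of_le_of_ne hx.2 ?_⟩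
    · rintro rfl; linarith
    · rintro rfl; linarith
  · have : ψ x < δ := by
      by_contra! hc
      exact hxK ⟨hx, hc⟩
    simp only [hU, hu]
    rw [max_eq_right (by linarith), Complex.ofReal_zero]
  · have hE : 0 ≤ h.energy hV hγ := zero_le_one.trans (h.one_le_energy hV hγ)
    rw [← ENNReal.ofReal_le_ofReal_iff hE, ← h.gpEnergy_eq_energy, ← gpEnergy_eq hγ]
    refine add_le_add (add_le_add (lintegral_mono_ae ?_) (lintegral_mono fun x => ?_))
      (mul_le_mul_right (lintegral_mono fun x => ?_) _)
    · filter_upwards [hud] with x hx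
      refine pow_le_pow_left' ?_ 2
      rw [← ofReal_norm, ← ofReal_norm]
      exact ENNReal.ofReal_le_ofReal hx
    · exact pow_le_pow_left' (hle x) 2
    · exact pow_le_pow_left' (hle x) 4
  · have h2 : ‖embed V (h.elem hV hγ) - embed V U‖ ≤ δ := by
      rw [← map_sub]
      refine (abs_le_of_sq_le_sq' ?_ hδ.le).2
      rw [norm_embed_sq]
      calc ∫ x, ‖(h.elem hV hγ - U).1 x‖ ^ 2 ∂unitMeasure ≤ ∫ x, δ ^ 2 ∂unitMeasure := by
            refine integral_mono_ae (integrable_of_continuousOn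
              ((h.elem hV hγ - U).2.isH10.continuousOn.norm.pow 2)) (integrable_const _) ?_
            filter_upwards [ae_mem_Ioo] with x hx
            refine pow_le_pow_left₀ (norm_nonneg _) ?_ 2
            change ‖(ψ x : ℂ) - u x‖ ≤ δ
            have hp := h.nonneg x (Ioo_subset_Icc_self hx)
            simp only [hu, ← Complex.ofReal_sub, Complex.norm_real, Real.norm_eq_abs]
            rw [abs_le]
            rcases le_total (ψ x - δ) 0 with hc | hc
            · rw [max_eq_right hc]; constructor <;> linarith
            · rw [max_eq_left hc]; constructor <;> linarith
        _ = _ := by simp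
    have h3 := norm_sub_norm_le (embed V (h.elem hV hγ)) (embed V U)
    rw [h.norm_elem] at h3
    linarith

/-- The energy of `ψ` is the limit of the energies of smooth normalized functions with compact
support in the open interval. -/
theorem exists_smooth_trial (hV : IsPotential V) (hγ : 0 ≤ γ) (h : IsGPMinimizer V γ ψ) {ε : ℝ}
    (hε : 0 < ε) :
    ∃ χ : ℝ → ℂ, ContDiff ℝ ∞ χ ∧ HasCompactSupport χ ∧ tsupport χ ⊆ Ioo 0 1 ∧
      ∫⁻ x, ‖χ x‖ₑ ^ 2 ∂unitMeasure = 1 ∧ gpEnergy V γ χ ≤ ENNReal.ofReal (h.energy hV hγ + ε) := by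
  set e₀ := h.energy hV hγ with he₀
  have he0 : 1 ≤ e₀ := h.one_le_energy hV hγ
  set f : ℝ → ℝ := fun m => (max 1 (m⁻¹ ^ 2)) ^ 2 with hf
  have hfc : ∀ m, m ≠ 0 → ContinuousAt f m := fun m hm =>
    (continuousAt_const.max ((continuousAt_inv₀ hm).pow 2)).pow 2
  have hf0 : ∀ m, 0 ≤ f m := fun m => by positivity
  -- The cost of normalizing a truncation of `ψ` is small.
  obtain ⟨δ, hδ, hδ1, hδε⟩ : ∃ δ > 0, δ < 1 ∧ f (1 - δ) * e₀ < e₀ + ε := by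
    have h1 : Tendsto (fun δ => f (1 - δ) * e₀) (𝓝 0) (𝓝 (f (1 - 0) * e₀)) := by
      refine Tendsto.mul_const _ (Tendsto.comp (hfc _ (by norm_num)) ?_)
      exact (continuous_const.sub continuous_id).tendsto' _ _ rfl
    have h2 : f (1 - 0) * e₀ < e₀ + ε := by
      have : f (1 - 0) = 1 := by simp [hf]
      rw [this, one_mul]; linarith
    have h3 := (h1.eventually (gt_mem_nhds h2)).and (gt_mem_nhds (zero_lt_one' ℝ))
    obtain ⟨δ, hδ, hh⟩ := ((h3.filter_mono nhdsWithin_le_nhds).and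
      (self_mem_nhdsWithin (s := Ioi (0 : ℝ)))).exists.imp fun δ hh => And.intro hh.2 hh.1
    exact ⟨δ, hδ, hh.2, hh.1⟩
  obtain ⟨u, ⟨K, hK, hK', huK⟩, huE, hum⟩ := h.exists_truncation hV hγ hδ
  have hm0 : 0 < ‖embed V u‖ := by linarith
  obtain ⟨χ, hχ, hχn, hχE⟩ := exists_smooth_seq (γ := γ) hV u hK hK' huK
  have hlim := (((hfc _ hm0.ne').tendsto.comp hχn).mul hχE)
  have hlt : f ‖embed V u‖ * (‖weakDeriv V u‖ ^ 2 + ‖potentialEmbed V u‖ ^ 2 +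
      γ / 2 * ∫ x, ‖u.1 x‖ ^ 4 ∂unitMeasure) < e₀ + ε := by
    refine (mul_le_mul_of_nonneg_left huE (hf0 _)).trans_lt (lt_of_le_of_lt ?_ hδε)
    refine mul_le_mul_of_nonneg_right ?_ (by linarith)
    have : (1 - δ) > 0 := by linarith
    simp only [hf]
    gcongr
  obtain ⟨k, hk, hkm⟩ := ((hlim.eventually (gt_mem_nhds hlt)).and
    (hχn.eventually (lt_mem_nhds hm0))).exists
  set m := ‖embed V (χ k)‖ with hm
  set X : formDomain V := (m⁻¹ : ℂ) • χ k with hX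
  have hc : ‖(m⁻¹ : ℂ)‖ = m⁻¹ := by
    rw [← Complex.ofReal_inv, Complex.norm_real, Real.norm_of_nonneg (by positivity)]
  have hXs : tsupport X.1 ⊆ tsupport (χ k).1 :=
    closure_mono fun x hx h0 => hx (by simp [hX, h0])
  refine ⟨X.1, contDiff_const.smul (hχ k).1, (hχ k).2.1.of_isClosed_subset (isClosed_tsupport _) hXs,
    hXs.trans (hχ k).2.2, ?_, ?_⟩
  · rw [lintegral_eq_one_iff, hX, map_smul, norm_smul, hc, ← hm, inv_mul_cancel₀ hkm.ne']
  · rw [gpEnergy_eq hγ]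
    refine ENNReal.ofReal_le_ofReal (le_trans ?_ hk.le)
    have e4 : ∫ x, ‖X.1 x‖ ^ 4 ∂unitMeasure = (m⁻¹ ^ 2) ^ 2 * ∫ x, ‖(χ k).1 x‖ ^ 4 ∂unitMeasure := by
      rw [← integral_const_mul]
      refine integral_congr_ae (ae_of_all _ fun x => ?_)
      change ‖(m⁻¹ : ℂ) • (χ k).1 x‖ ^ 4 = _
      rw [norm_smul, hc]
      ring
    have i4 : 0 ≤ ∫ x, ‖(χ k).1 x‖ ^ 4 ∂unitMeasure := integral_nonneg fun _ => by positivity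
    rw [e4, hX, map_smul, map_smul, norm_smul, norm_smul, hc, mul_pow, mul_pow]
    simp only [Function.comp_apply, hf, ← hm]
    set c := m⁻¹ ^ 2 with hcc
    have c0 : 0 ≤ c := by positivity
    have c1 : c ≤ (max 1 c) ^ 2 := by
      have a := le_max_left 1 c
      have b := le_max_right 1 c
      nlinarith
    have c2 : c ^ 2 ≤ (max 1 c) ^ 2 := pow_le_pow_left₀ c0 (le_max_right _ _) 2
    have q0 : 0 ≤ γ / 2 * ∫ x, ‖(χ k).1 x‖ ^ 4 ∂unitMeasure := by positivity
    have t1 := mul_le_mul_of_nonneg_right c1 (sq_nonneg ‖weakDeriv V (χ k)‖)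
    have t2 := mul_le_mul_of_nonneg_right c1 (sq_nonneg ‖potentialEmbed V (χ k)‖)
    have t3 := mul_le_mul_of_nonneg_right c2 q0
    linarith

end IsGPMinimizer

end

/-! ### Product states and the upper bound on the ground state energy -/

section

variable {V : Measure ℝ} {γ : ℝ} {ψ : ℝ → ℝ} {N : ℕ} {χ : ℝ → ℂ}

/-- The product state in which all particles have the wave function `χ`. -/
def productState (N : ℕ) (χ : ℝ → ℂ) (z : Fin N → ℝ) : ℂ := ∏ i, χ (z i)

theorem isBosonicTestFunction_productState (h : ContDiff ℝ ∞ χ) (hc : HasCompactSupport χ)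
    (hs : tsupport χ ⊆ Ioo 0 1) : IsBosonicTestFunction (productState N χ) := by
  have hsub : tsupport (productState N χ) ⊆ univ.pi fun _ => tsupport χ := by
    refine closure_minimal (fun z hz i _ => subset_tsupport _ fun h0 => hz ?_)
      (isClosed_set_pi fun _ _ => isClosed_tsupport χ)
    exact Finset.prod_eq_zero (Finset.mem_univ i) h0
  refine ⟨contDiff_prod fun i _ => h.comp (contDiff_apply ℝ ℝ i), ?_,
    hsub.trans (pi_mono fun _ _ => hs), fun s z => ?_⟩
  · exact (isCompact_univ_pi fun _ => hc).of_isClosed_subset (isClosed_tsupport _) hsub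
  · exact Equiv.prod_comp s fun i => χ (z i)

theorem measurable_prod_apply {g : ℝ → ℝ≥0∞} (hg : Measurable g) (S : Finset (Fin N)) :
    Measurable fun z : Fin N → ℝ => ∏ k ∈ S, g (z k) :=
  Finset.measurable_prod _ fun k _ => hg.comp (measurable_pi_apply k)

theorem lintegral_prod_eq_one {g : ℝ → ℝ≥0∞} (hg : Measurable g)
    (h1 : ∫⁻ x, g x ∂unitMeasure = 1) (S : Finset (Fin N)) :
    ∫⁻ z, ∏ k ∈ S, g (z k) ∂cubeMeasure N = 1 := by
  classical
  induction S using Finset.induction_on with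
  | empty => simp
  | insert i S hi ih =>
    rw [lintegral_update i (measurable_prod_apply hg _), ← ih]
    refine lintegral_congr fun z => ?_
    have e : ∀ x, ∏ k ∈ insert i S, g (Function.update z i x k) = g x * ∏ k ∈ S, g (z k) := fun x => by
      rw [Finset.prod_insert hi, Function.update_self]
      congr 1
      refine Finset.prod_congr rfl fun k hk => ?_
      rw [Function.update_of_ne (ne_of_mem_of_not_mem hk hi)]
    simp_rw [e]
    rw [lintegral_mul_const _ hg, h1, one_mul]

theorem productState_update (z : Fin N → ℝ) (i : Fin N) (x : ℝ) :
    productState N χ (Function.update z i x) = χ x * ∏ k ∈ Finset.univ.erase i, χ (z k) := by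
  rw [productState, ← Finset.mul_prod_erase _ _ (Finset.mem_univ i), Function.update_self]
  congr 1
  exact Finset.prod_congr rfl fun k hk => by rw [Function.update_of_ne (Finset.ne_of_mem_erase hk)]

theorem enorm_prod_sq (S : Finset (Fin N)) (z : Fin N → ℝ) :
    ‖∏ k ∈ S, χ (z k)‖ₑ ^ 2 = ∏ k ∈ S, ‖χ (z k)‖ₑ ^ 2 := by
  rw [Finset.prod_pow]
  simp [enorm, nnnorm_prod]

theorem mass_productState (h : Continuous χ) (h1 : ∫⁻ x, ‖χ x‖ₑ ^ 2 ∂unitMeasure = 1) :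
    mass (productState N χ) = 1 := by
  simp only [mass, productState, enorm_prod_sq]
  exact lintegral_prod_eq_one (h.measurable.enorm.pow_const 2) h1 _

theorem kinetic_productState (h : ContDiff ℝ ∞ χ) (hc : HasCompactSupport χ)
    (hs : tsupport χ ⊆ Ioo 0 1) (h1 : ∫⁻ x, ‖χ x‖ₑ ^ 2 ∂unitMeasure = 1) (i : Fin N) :
    kinetic (productState N χ) i = ∫⁻ x, ‖deriv χ x‖ₑ ^ 2 ∂unitMeasure := by
  have hg : Measurable fun x => ‖χ x‖ₑ ^ 2 := h.continuous.measurable.enorm.pow_const 2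
  have hd : Measurable fun x => ‖deriv χ x‖ₑ ^ 2 := (measurable_deriv χ).enorm.pow_const 2
  rw [(isBosonicTestFunction_productState h hc hs).kinetic_eq]
  have e : ∀ (z : Fin N → ℝ) x, ‖deriv (fun x => productState N χ (Function.update z i x)) x‖ₑ ^ 2 =
      ‖deriv χ x‖ₑ ^ 2 * ∏ k ∈ Finset.univ.erase i, ‖χ (z k)‖ₑ ^ 2 := fun z x => by
    simp_rw [productState_update]
    rw [deriv_mul_const ((h.differentiable (by simp)) x), enorm_mul, mul_pow, enorm_prod_sq]
  simp_rw [e, lintegral_mul_const _ hd]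
  rw [lintegral_const_mul _ (measurable_prod_apply hg _),
    lintegral_prod_eq_one hg h1, mul_one]

theorem potential_productState (h : Continuous χ) (h1 : ∫⁻ x, ‖χ x‖ₑ ^ 2 ∂unitMeasure = 1)
    (i : Fin N) : potential V (productState N χ) i = ∫⁻ x, ‖χ x‖ₑ ^ 2 ∂V := by
  have hg : Measurable fun x => ‖χ x‖ₑ ^ 2 := h.measurable.enorm.pow_const 2
  simp_rw [potential, productState_update, enorm_mul, mul_pow, enorm_prod_sq,
    lintegral_mul_const _ hg]
  rw [lintegral_const_mul _ (measurable_prod_apply hg _),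
    lintegral_prod_eq_one hg h1, mul_one]

theorem contact_productState (h : Continuous χ) (h1 : ∫⁻ x, ‖χ x‖ₑ ^ 2 ∂unitMeasure = 1)
    {i j : Fin N} (hij : i ≠ j) :
    contact (productState N χ) i j = ∫⁻ x, ‖χ x‖ₑ ^ 4 ∂unitMeasure := by
  have hg : Measurable fun x => ‖χ x‖ₑ ^ 2 := h.measurable.enorm.pow_const 2
  have hg4 : Measurable fun x => ‖χ x‖ₑ ^ 4 := h.measurable.enorm.pow_const 4
  have hij' : i ∈ Finset.univ.erase j := Finset.mem_erase.2 ⟨hij, Finset.mem_univ i⟩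
  have hm : Measurable fun z : Fin N → ℝ => ‖productState N χ (Function.update z j (z i))‖ₑ ^ 2 := by
    simp_rw [productState_update, enorm_mul, mul_pow, enorm_prod_sq]
    exact (hg.comp (measurable_pi_apply i)).mul
      (measurable_prod_apply hg _)
  rw [contact, lintegral_update i hm]
  have e : ∀ (z : Fin N → ℝ) x, ‖productState N χ (Function.update (Function.update z i x) j
      (Function.update z i x i))‖ₑ ^ 2 =
      ‖χ x‖ₑ ^ 4 * ∏ k ∈ (Finset.univ.erase j).erase i, ‖χ (z k)‖ₑ ^ 2 := fun z x => by
    rw [productState_update, enorm_mul, mul_pow, enorm_prod_sq,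
      ← Finset.mul_prod_erase _ _ hij', Function.update_self, ← mul_assoc, ← pow_add]
    congr 1
    exact Finset.prod_congr rfl fun k hk => by
      rw [Function.update_of_ne (Finset.ne_of_mem_erase hk)]
  simp_rw [e, lintegral_mul_const _ hg4]
  rw [lintegral_const_mul _ (measurable_prod_apply hg _),
    lintegral_prod_eq_one hg h1, mul_one]

theorem manyBodyEnergy_productState_le (hγ : 0 ≤ γ) (h : ContDiff ℝ ∞ χ) (hc : HasCompactSupport χ)
    (hs : tsupport χ ⊆ Ioo 0 1) (h1 : ∫⁻ x, ‖χ x‖ₑ ^ 2 ∂unitMeasure = 1) :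
    manyBodyEnergy V γ (productState N χ) ≤ N * gpEnergy V γ χ := by
  have hcard : ENNReal.ofReal (γ / N) * ∑ i : Fin N, ∑ j ∈ Finset.Ioi i, (1 : ℝ≥0∞) ≤
      N * ENNReal.ofReal (γ / 2) := by
    have h2 := sum_pairs_eq (n := N) (fun _ _ => 1) fun _ _ => rfl
    simp only [Finset.sum_const, Finset.card_univ, Fintype.card_fin, nsmul_eq_mul, mul_one] at h2
    have h3 : ∑ i : Fin N, ∑ j ∈ Finset.Ioi i, (1 : ℝ≥0∞) =
        ENNReal.ofReal (∑ i : Fin N, ((Finset.Ioi i).card : ℝ)) := by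
      rw [ENNReal.ofReal_sum_of_nonneg fun _ _ => Nat.cast_nonneg _]
      simp
    rw [h3, ← ENNReal.ofReal_natCast, ← ENNReal.ofReal_mul (by positivity),
      ← ENNReal.ofReal_mul (by positivity)]
    refine ENNReal.ofReal_le_ofReal ?_
    rcases Nat.eq_zero_or_pos N with rfl | hN
    · simp
    have hN' : (0 : ℝ) < N := by exact_mod_cast hN
    rw [div_mul_eq_mul_div, div_le_iff₀ hN']
    have : ∑ i : Fin N, ((Finset.Ioi i).card : ℝ) ≤ N * N / 2 := by linarith
    calc γ * _ ≤ γ * (N * N / 2) := mul_le_mul_of_nonneg_left this hγ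
      _ = _ := by ring
  have e3 : ∑ i : Fin N, ∑ j ∈ Finset.Ioi i, contact (productState N χ) i j =
      (∑ i : Fin N, ∑ j ∈ Finset.Ioi i, (1 : ℝ≥0∞)) * ∫⁻ x, ‖χ x‖ₑ ^ 4 ∂unitMeasure := by
    simp_rw [Finset.sum_mul, one_mul]
    exact Finset.sum_congr rfl fun i _ => Finset.sum_congr rfl fun j hj =>
      contact_productState h.continuous h1 (Finset.mem_Ioi.1 hj).ne
  rw [manyBodyEnergy_eq, e3]
  generalize (∑ i : Fin N, ∑ j ∈ Finset.Ioi i, (1 : ℝ≥0∞)) = S at hcard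
  simp_rw [kinetic_productState h hc hs h1, potential_productState h.continuous h1]
  simp only [Finset.sum_const, Finset.card_univ, Fintype.card_fin, nsmul_eq_mul]
  rw [gpEnergy, mul_add, mul_add, ← mul_assoc, ← mul_assoc]
  exact add_le_add_right (mul_le_mul_left hcard _) _

/-- The ground state energy per particle is at most the Gross-Pitaevskii energy. -/
theorem IsGroundState.closedEnergy_le (hV : IsPotential V) (hγ : 0 ≤ γ) (h : IsGPMinimizer V γ ψ)
    {Ψ : ManyParticle N} (hΨ : IsGroundState V γ Ψ) :
    closedEnergy V γ Ψ ≤ ENNReal.ofReal (N * h.energy hV hγ) := by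
  have key : ∀ ε : ℝ, 0 < ε → closedEnergy V γ Ψ ≤ ENNReal.ofReal (N * (h.energy hV hγ + ε)) := by
    intro ε hε
    obtain ⟨χ, h1, h2, h3, h4, h5⟩ := h.exists_smooth_trial hV hγ hε
    have hΦ := isBosonicTestFunction_productState (N := N) h1 h2 h3
    have hn : ‖hΦ.memLp.toLp‖ = 1 := by
      have e := hΦ.mass_eq
      rw [mass_productState h1.continuous h4, eq_comm, ENNReal.ofReal_eq_one] at e
      exact (pow_eq_one_iff_of_nonneg (norm_nonneg _) two_ne_zero).1 e
    refine (hΨ.minimal _ hn).trans ?_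
    have h6 : closedEnergy V γ hΦ.memLp.toLp ≤ manyBodyEnergy V γ (productState N χ) := by
      refine (iInf₂_le (fun _ => productState N χ) fun _ => hΦ).trans ((iInf_le _ ?_).trans ?_)
      · have e : eLpNorm (fun z => productState N χ z - hΦ.memLp.toLp _ z) 2 (cubeMeasure N) = 0 := by
          rw [eLpNorm_congr_ae (g := 0), eLpNorm_zero]
          filter_upwards [hΦ.memLp.coeFn_toLp] with z hz
          rw [hz, sub_self, Pi.zero_apply]
        exact tendsto_const_nhds.congr fun _ => e.symm
      · simp
    refine h6.trans ((manyBodyEnergy_productState_le hγ h1 h2 h3 h4).trans ?_)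
    rw [ENNReal.ofReal_mul (Nat.cast_nonneg N), ENNReal.ofReal_natCast]
    exact mul_le_mul_right h5 _
  have hlim : Tendsto (fun ε : ℝ => ENNReal.ofReal (N * (h.energy hV hγ + ε))) (𝓝[>] 0)
      (𝓝 (ENNReal.ofReal (N * (h.energy hV hγ + 0)))) :=
    (ENNReal.tendsto_ofReal ((tendsto_const_nhds.add tendsto_id).const_mul _)).mono_left
      nhdsWithin_le_nhds
  rw [add_zero] at hlim
  exact ge_of_tendsto hlim (by filter_upwards [self_mem_nhdsWithin] with ε hε using key ε hε)

end

/-! ### The bound on the depletion of the condensate -/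

section

variable {V : Measure ℝ} {γ : ℝ} {ψ : ℝ → ℝ} {n : ℕ}

theorem IsGPMinimizer.norm_state (hV : IsPotential V) (hγ : 0 ≤ γ) (h : IsGPMinimizer V γ ψ) :
    ‖h.state‖ = 1 := by
  rw [← h.embed_elem hV hγ, h.norm_elem]

theorem occupancy_nonneg (Ψ : ManyParticle (n + 1)) (f : OneParticle) :
    0 ≤ occupancy (reducedDensityMatrix Ψ) f := by
  rw [occupancy_reducedDensityMatrix]; positivity

theorem IsGroundState.occupancy_le (hV : IsPotential V) (hγ : 0 ≤ γ) (h : IsGPMinimizer V γ ψ)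
    {Ψ : ManyParticle (n + 1)} (hΨ : IsGroundState V γ Ψ) :
    occupancy (reducedDensityMatrix Ψ) h.state ≤ ((n + 1 : ℕ) : ℝ) := by
  have h1 := norm_overlap_le Ψ h.state
  rw [hΨ.normalized, h.norm_state hV hγ, one_mul] at h1
  rw [occupancy_reducedDensityMatrix]
  exact mul_le_of_le_one_right (by positivity) (pow_le_one₀ (norm_nonneg _) h1)

theorem IsGPMinimizer.coupling_le (hV : IsPotential V) (hγ : 0 ≤ γ) (h : IsGPMinimizer V γ ψ) :
    γ ≤ 2 * h.energy hV hγ * min √γ γ := by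
  have h1 := h.one_le_energy hV hγ
  have h2 := (h.half_le_selfEnergy hV hγ).trans (h.selfEnergy_le_energy hV hγ)
  have h3 := Real.sq_sqrt hγ
  have h4 := Real.sqrt_nonneg γ
  rcases le_total √γ γ with hc | hc
  · rw [min_eq_left hc]
    have h5 : √γ ≤ 2 * h.energy hV hγ := by nlinarith [sq_nonneg (√γ - 1)]
    nlinarith
  · rw [min_eq_right hc]
    nlinarith

/-- The bound on the depletion. The number of cells is of order `N^{2/3}`, and the fraction `s` of
the kinetic energy which is used to smear the interaction is of order `N^{-1/3}`. -/
theorem IsGroundState.depletion_le (hV : IsPotential V) (hγ : 0 ≤ γ) (h : IsGPMinimizer V γ ψ)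
    {e₁ : ℝ} (he : h.energy hV hγ < e₁) (he4 : e₁ - h.energy hV hγ ≤ 4 * h.energy hV hγ)
    (hgap : ∀ φ : formDomain V, (e₁ + selfEnergy γ ψ) * ‖embed V φ‖ ^ 2 ≤
      ‖energyMap V γ h.isH10 φ‖ ^ 2 +
        (e₁ - h.energy hV hγ) * ‖⟪embed V (h.elem hV hγ), embed V φ⟫_ℂ‖ ^ 2)
    {Ψ : ManyParticle (n + 1)} (hΨ : IsGroundState V γ Ψ) :
    1 - occupancy (reducedDensityMatrix Ψ) h.state / ((n + 1 : ℕ) : ℝ) ≤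
      32 * (h.energy hV hγ / (e₁ - h.energy hV hγ)) * ((n + 1 : ℕ) : ℝ) ^ (-(1 / 3) : ℝ) *
        min (√γ) γ := by
  set e₀ := h.energy hV hγ with he₀
  have he1 : 1 ≤ e₀ := h.one_le_energy hV hγ
  have hN : (0 : ℝ) < ((n + 1 : ℕ) : ℝ) := by positivity
  have hN1 : (1 : ℝ) ≤ ((n + 1 : ℕ) : ℝ) := by exact_mod_cast n.succ_pos
  set r : ℝ := ((n + 1 : ℕ) : ℝ) ^ (-(1 / 3) : ℝ) with hr
  have hr0 : 0 < r := Real.rpow_pos_of_pos hN _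
  have hr1 : r ≤ 1 := Real.rpow_le_one_of_one_le_of_nonpos hN1 (by norm_num)
  have hr3 : r ^ 3 * ((n + 1 : ℕ) : ℝ) = 1 := by
    rw [hr, ← Real.rpow_natCast, ← Real.rpow_mul hN.le]
    norm_num
    rw [Real.rpow_neg_one]
    exact inv_mul_cancel₀ (by positivity)
  have hocc0 := occupancy_nonneg Ψ h.state
  have hocc1 := hΨ.occupancy_le hV hγ h
  set m := min √γ γ with hm
  have hm0 : 0 ≤ m := le_min (Real.sqrt_nonneg γ) hγ
  have hcoup : γ ≤ 2 * e₀ * m := h.coupling_le hV hγ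
  have hself : selfEnergy γ ψ ≤ e₀ := h.selfEnergy_le_energy hV hγ
  have hd : 0 < e₁ - e₀ := by linarith
  have hmr : 0 ≤ m * r := by positivity
  set x := occupancy (reducedDensityMatrix Ψ) h.state / ((n + 1 : ℕ) : ℝ) with hx
  have hx0 : 0 ≤ x := by positivity
  have hx1 : x ≤ 1 := (div_le_one hN).2 hocc1
  have hxN : occupancy (reducedDensityMatrix Ψ) h.state = ((n + 1 : ℕ) : ℝ) * x := by
    rw [hx]; field_simp
  have e : 32 * (e₀ / (e₁ - e₀)) * r * m = 32 * e₀ * (m * r) / (e₁ - e₀) := by ring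
  rw [e, le_div_iff₀ hd]
  rcases lt_or_ge 1 (8 * (m * r)) with hc | hc
  · nlinarith
  -- The number of cells.
  set M : ℕ := ⌈(r ^ 2)⁻¹⌉₊ with hM
  have hM1 : (r ^ 2)⁻¹ ≤ M := Nat.le_ceil _
  have hM2 : (M : ℝ) ≤ 2 * (r ^ 2)⁻¹ := by
    have h1 := (Nat.ceil_lt_add_one (show 0 ≤ (r ^ 2)⁻¹ by positivity)).le
    have h2 : 1 ≤ (r ^ 2)⁻¹ := (one_le_inv₀ (by positivity)).2 (pow_le_one₀ hr0.le hr1)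
    linarith
  have hM0 : 0 < M := Nat.ceil_pos.2 (by positivity)
  have hM0' : (0 : ℝ) < M := by exact_mod_cast hM0
  have hrM : 1 ≤ r ^ 2 * M := by
    rw [inv_le_iff_one_le_mul₀ (by positivity)] at hM1
    linarith
  have hMr : M * r ^ 2 ≤ 2 := by
    calc M * r ^ 2 ≤ 2 * (r ^ 2)⁻¹ * r ^ 2 := mul_le_mul_of_nonneg_right hM2 (by positivity)
      _ = 2 := by field_simp
  obtain ⟨s, hs0, hs1, hη⟩ : ∃ s : ℝ, 0 < s ∧ s ≤ 1 ∧
      (2 * (γ / (s * M)) + 2 * s ≤ 4 * (m * r) ∨ 2 * (γ / (s * M)) + 2 * s * γ ≤ 4 * (m * r)) := by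
    rcases le_total 1 γ with h1 | h1
    · have h2 : √γ ≤ γ := (Real.sqrt_le_left hγ).2 (by nlinarith)
      have h3 : 0 < √γ := Real.sqrt_pos.2 (by linarith)
      rw [min_eq_left h2] at hm
      refine ⟨m * r, by rw [hm]; positivity, by linarith, Or.inl ?_⟩
      have h4 : γ / (m * r * M) ≤ m * r := by
        rw [div_le_iff₀ (by rw [hm]; positivity)]
        have h5 : m ^ 2 = γ := by rw [hm, Real.sq_sqrt hγ]
        calc γ ≤ γ * (r ^ 2 * M) := le_mul_of_one_le_right hγ hrM
          _ = _ := by rw [← h5]; ring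
      linarith
    · have h2 : γ ≤ √γ := Real.le_sqrt_of_sq_le (by nlinarith)
      rw [min_eq_right h2] at hm
      refine ⟨r, hr0, hr1, Or.inr ?_⟩
      have h4 : γ / (r * M) ≤ m * r := by
        rw [div_le_iff₀ (by positivity), hm]
        calc γ ≤ γ * (r ^ 2 * M) := le_mul_of_one_le_right hγ hrM
          _ = _ := by ring
      rw [hm] at h4 ⊢
      linarith
  have hE := hΨ.closedEnergy_le hV hγ h
  have hlow := le_closedEnergy hV hγ h hd.le (by linarith) hgap hM0 hs0 hs1 (η := 4 * (m * r))
    (by linarith) hη hΨ.normalized hE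
  rw [max_eq_left (by positivity), hxN, ← he₀] at hlow
  -- Division by the number of particles.
  have hγM : γ * M / 2 ≤ ((n + 1 : ℕ) : ℝ) * (2 * e₀ * (m * r)) := by
    calc γ * M / 2 = ((n + 1 : ℕ) : ℝ) * (γ * r * (M * r ^ 2) / 2) := by
          linear_combination (-(γ * M / 2)) * hr3
      _ ≤ ((n + 1 : ℕ) : ℝ) * (γ * r * 2 / 2) := by gcongr
      _ = ((n + 1 : ℕ) : ℝ) * (γ * r) := by ring
      _ ≤ ((n + 1 : ℕ) : ℝ) * (2 * e₀ * m * r) := by gcongr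
      _ = _ := by ring
  have hdiv : (1 - 4 * (m * r)) * (e₁ - (e₁ - e₀) * x) - 4 * (m * r) * selfEnergy γ ψ -
      2 * e₀ * (m * r) ≤ e₀ := by
    refine le_of_mul_le_mul_left ?_ hN
    linarith
  have h1 : 4 * (m * r) * selfEnergy γ ψ ≤ 4 * (m * r) * e₀ :=
    mul_le_mul_of_nonneg_left hself (by positivity)
  have h2 : (1 - 4 * (m * r)) * ((e₁ - e₀) * (1 - x)) ≤ 10 * (e₀ * (m * r)) := by linarith
  have h3 : 1 / 2 * ((e₁ - e₀) * (1 - x)) ≤ (1 - 4 * (m * r)) * ((e₁ - e₀) * (1 - x)) :=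
    mul_le_mul_of_nonneg_right (by linarith) (mul_nonneg hd.le (by linarith))
  have h4 : 0 ≤ e₀ * (m * r) := by positivity
  linarith

end

/-! ### The trace norm of a perturbation of a rank one projector -/

section

theorem re_inner_nonneg {E : Type*} [NormedAddCommGroup E] [InnerProductSpace ℂ E]
    {A : E →L[ℂ] E} (hA : 0 ≤ A) (x : E) : 0 ≤ (⟪x, A x⟫_ℂ).re :=
  ((ContinuousLinearMap.nonneg_iff_isPositive A).1 hA).re_inner_nonneg_right x

/-- A finite orthonormal family can be extended such that a given unit vector is in its span. -/
theorem exists_orthonormal_extension {E : Type*} [NormedAddCommGroup E]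
    [InnerProductSpace ℂ E] {φ : E} (hφ : ‖φ‖ = 1) {m : ℕ} {e : Fin m → E} (he : Orthonormal ℂ e) :
    ∃ (k : ℕ) (f : Fin k → E), Orthonormal ℂ f ∧ ∑ j, ‖⟪f j, φ⟫_ℂ‖ ^ 2 = 1 ∧
      ∀ A : E →L[ℂ] E, 0 ≤ A → ∑ i, (⟪e i, A (e i)⟫_ℂ).re ≤ ∑ j, (⟪f j, A (f j)⟫_ℂ).re := by
  set p : E := ∑ i, ⟪e i, φ⟫_ℂ • e i with hp
  set q : E := φ - p with hq
  have heq : ∀ i, ⟪e i, q⟫_ℂ = 0 := fun i => by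
    rw [hq, inner_sub_right, hp, he.inner_right_fintype, sub_self]
  have hpp : ‖p‖ ^ 2 = ∑ i, ‖⟪e i, φ⟫_ℂ‖ ^ 2 := by
    rw [← inner_self_eq_norm_sq (𝕜 := ℂ)]
    conv_lhs => rw [hp]
    rw [he.inner_sum, map_sum]
    refine Finset.sum_congr rfl fun i _ => ?_
    rw [Complex.conj_mul']
    norm_cast
  have hpq : ⟪p, q⟫_ℂ = 0 := by
    rw [hp, sum_inner]
    exact Finset.sum_eq_zero fun i _ => by rw [inner_smul_left, heq, mul_zero]
  have hpyth : ‖p‖ ^ 2 + ‖q‖ ^ 2 = 1 := by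
    have := norm_add_sq_eq_norm_sq_add_norm_sq_of_inner_eq_zero p q hpq
    rw [hq, add_sub_cancel, hφ] at this
    rw [hq]
    linarith
  by_cases hq0 : q = 0
  · refine ⟨m, e, he, ?_, fun A _ => le_rfl⟩
    rw [← hpp, ← hpyth, hq0]; simp
  have hqn : ‖q‖ ≠ 0 := norm_ne_zero_iff.2 hq0
  set u : E := ((‖q‖⁻¹ : ℝ) : ℂ) • q with hu
  have hun : ‖u‖ = 1 := by
    rw [hu, norm_smul, Complex.norm_real, norm_inv, norm_norm, inv_mul_cancel₀ hqn]
  have heu : ∀ i, ⟪e i, u⟫_ℂ = 0 := fun i => by rw [hu, inner_smul_right, heq, mul_zero]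
  refine ⟨m + 1, Fin.cons u e, ⟨fun j => ?_, fun i j hij => ?_⟩, ?_, fun A hA => ?_⟩
  · cases j using Fin.cases with
    | zero => exact hun
    | succ j => exact he.1 j
  · cases i using Fin.cases with
    | zero =>
      cases j using Fin.cases with
      | zero => exact absurd rfl hij
      | succ j => simpa [inner_eq_zero_symm] using heu j
    | succ i =>
      cases j using Fin.cases with
      | zero => simpa using heu i
      | succ j => simpa using he.2 (fun h => hij (congrArg _ h))
  · rw [Fin.sum_univ_succ]
    simp only [Fin.cons_zero, Fin.cons_succ]
    rw [← hpp, ← hpyth, add_comm]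
    congr 1
    have h3 : ⟪u, φ⟫_ℂ = (‖q‖ : ℂ) := by
      have h4 : φ = p + q := by rw [hq, add_sub_cancel]
      have h5 : ⟪q, p⟫_ℂ = 0 := inner_eq_zero_symm.1 hpq
      rw [hu, inner_smul_left, h4, inner_add_right, h5, zero_add, inner_self_eq_norm_sq_to_K,
        Complex.conj_ofReal]
      push_cast
      have : (‖q‖ : ℂ) ≠ 0 := by exact_mod_cast hqn
      change (‖q‖ : ℂ)⁻¹ * (‖q‖ : ℂ) ^ 2 = _
      field_simp
    rw [h3, Complex.norm_real, norm_norm]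
  · rw [Fin.sum_univ_succ]
    simp only [Fin.cons_zero, Fin.cons_succ]
    exact le_add_of_nonneg_left (re_inner_nonneg hA u)

section TraceNorm

variable {E : Type*} [NormedAddCommGroup E] [InnerProductSpace ℂ E] [CompleteSpace E]
  {A T : E →L[ℂ] E} {φ : E} {c : ℝ}

theorem inner_apply_left (hA : IsSelfAdjoint A) (x y : E) : ⟪A x, y⟫_ℂ = ⟪x, A y⟫_ℂ :=
  (ContinuousLinearMap.isSelfAdjoint_iff_isSymmetric.1 hA) x y

theorem apply_eq_zero_of_inner_le (hA : 0 ≤ A) {y : E} (h : (⟪y, A y⟫_ℂ).re ≤ 0) : A y = 0 := by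
  obtain ⟨B, rfl⟩ := CStarAlgebra.nonneg_iff_eq_star_mul_self.1 hA
  have h1 : ⟪y, (star B * B) y⟫_ℂ = ⟪B y, B y⟫_ℂ := ContinuousLinearMap.adjoint_inner_right B y (B y)
  rw [h1] at h
  have h2 : B y = 0 := by
    rw [← norm_eq_zero, ← sq_eq_zero_iff]
    refine le_antisymm ?_ (by positivity)
    rw [← inner_self_eq_norm_sq (𝕜 := ℂ)]
    exact h
  change (star B) (B y) = 0
  rw [h2, map_zero]

/-- If the negative part of the quadratic form of `T` is dominated by that of a rank one operator,
then the operator `T⁻` has rank at most one, and its trace is at most any bound on the quadratic form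
of `-T`. -/
theorem sum_inner_negPart_le (hT : IsSelfAdjoint T) (hc : 0 ≤ c)
    (h1 : ∀ x, -‖⟪φ, x⟫_ℂ‖ ^ 2 ≤ (⟪x, T x⟫_ℂ).re) (h2 : ∀ x, -(c * ‖x‖ ^ 2) ≤ (⟪x, T x⟫_ℂ).re)
    {ι : Type*} [Fintype ι] {f : ι → E} (hf : Orthonormal ℂ f) :
    ∑ i, (⟪f i, T⁻ (f i)⟫_ℂ).re ≤ c := by
  set A := T⁻ with hA
  have hA0 : 0 ≤ A := CFC.negPart_nonneg T
  have hAs : IsSelfAdjoint A := hA0.isSelfAdjoint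
  have hTA : ∀ x, T (A x) = -A (A x) := fun x => by
    have e : T * A = -(A * A) := by
      conv_lhs => rw [← CFC.posPart_sub_negPart T hT, sub_mul, CFC.posPart_mul_negPart, zero_sub]
    exact congrArg (fun S : E →L[ℂ] E => S x) e
  -- `A` vanishes on the orthogonal complement of `A φ`.
  have hker : ∀ x, ⟪A φ, x⟫_ℂ = 0 → A x = 0 := fun x hx => by
    rw [inner_apply_left hAs] at hx
    have h3 := h1 (A x)
    rw [hTA, hx, inner_neg_right] at h3
    have h4 : A (A x) = 0 := apply_eq_zero_of_inner_le hA0 (by simpa using h3)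
    rw [← norm_eq_zero, ← sq_eq_zero_iff, ← inner_self_eq_norm_sq (𝕜 := ℂ), inner_apply_left hAs, h4]
    simp
  by_cases hg : A φ = 0
  · have : ∀ x, A x = 0 := fun x => hker x (by rw [hg, inner_zero_left])
    simp [this, hc]
  set u : E := ((‖A φ‖⁻¹ : ℝ) : ℂ) • A φ with hu
  have hun : ‖u‖ = 1 := by
    rw [hu, norm_smul, Complex.norm_real, norm_inv, norm_norm, inv_mul_cancel₀ (norm_ne_zero_iff.2 hg)]
  have huu : ⟪u, u⟫_ℂ = 1 := by rw [inner_self_eq_norm_sq_to_K, hun]; simp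
  have hker' : ∀ x, ⟪u, x⟫_ℂ = 0 → A x = 0 := fun x hx => hker x (by
    rw [hu, inner_smul_left, mul_eq_zero] at hx
    refine hx.resolve_left ?_
    simpa using hg)
  have hAx : ∀ x, A x = ⟪u, x⟫_ℂ • A u := fun x => by
    have h3 := hker' (x - ⟪u, x⟫_ℂ • u) (by rw [inner_sub_right, inner_smul_right, huu]; simp)
    rw [map_sub, map_smul, sub_eq_zero] at h3
    exact h3
  set l : ℂ := ⟪u, A u⟫_ℂ with hl
  have hl0 : 0 ≤ l.re := re_inner_nonneg hA0 u
  have hreal : conj l = l := by rw [hl, inner_conj_symm, inner_apply_left hAs]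
  have hAu : A u = l • u := by
    refine (sub_eq_zero.1 ?_)
    rw [← norm_eq_zero, ← sq_eq_zero_iff, ← inner_self_eq_norm_sq (𝕜 := ℂ)]
    have h0 : ⟪u, A u - l • u⟫_ℂ = 0 := by rw [inner_sub_right, inner_smul_right, huu]; simp [hl]
    have h4 : ⟪A u - l • u, A u - l • u⟫_ℂ = 0 := by
      conv_lhs => rw [inner_sub_left]
      rw [inner_smul_left, h0, mul_zero, sub_zero, inner_apply_left hAs, hker' _ h0, inner_zero_right]
    rw [h4]; simp
  have hlc : l.re ≤ c := by
    have h3 := h2 (A u)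
    have h5 : ⟪A u, T (A u)⟫_ℂ = -(l * l * l) := by
      rw [hTA, inner_neg_right, hAu, map_smul, hAu, inner_smul_left, inner_smul_right,
        inner_smul_right, huu, hreal]
      ring
    have hlr : l = (l.re : ℂ) := (Complex.conj_eq_iff_re.1 hreal).symm
    have h6 : ‖A u‖ = l.re := by
      rw [hAu, norm_smul, hun, mul_one, hlr, Complex.norm_real, Real.norm_of_nonneg hl0,
        Complex.ofReal_re]
    have h7 : (⟪A u, T (A u)⟫_ℂ).re = -(l.re ^ 3) := by
      rw [h5, hlr]
      norm_cast
      ring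
    rw [h7, h6] at h3
    by_contra! hlt
    have hpos : 0 < l.re := hc.trans_lt hlt
    have : 0 < (l.re - c) * l.re ^ 2 := mul_pos (by linarith) (by positivity)
    linarith
  have hterm : ∀ x, (⟪x, A x⟫_ℂ).re = ‖⟪x, u⟫_ℂ‖ ^ 2 * l.re := fun x => by
    have e1 : ⟪x, A x⟫_ℂ = ((‖⟪x, u⟫_ℂ‖ ^ 2 : ℝ) : ℂ) * l := by
      rw [hAx, hAu, inner_smul_right, inner_smul_right, ← inner_conj_symm u x, mul_left_comm,
        mul_comm l, Complex.conj_mul']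
      norm_cast
    rw [e1, Complex.re_ofReal_mul]
  simp_rw [hterm]
  rw [← Finset.sum_mul]
  have hbes := hf.sum_inner_products_le u (s := Finset.univ)
  rw [hun, one_pow] at hbes
  exact (mul_le_of_le_one_left hl0 hbes).trans hlc

theorem inner_abs_eq (hT : IsSelfAdjoint T) (x : E) :
    (⟪x, CFC.abs T x⟫_ℂ).re = (⟪x, T x⟫_ℂ).re + 2 * (⟪x, T⁻ x⟫_ℂ).re := by
  have e : CFC.abs T = T + (T⁻ + T⁻) := by
    rw [← CFC.posPart_add_negPart T hT]
    conv_rhs => lhs; rw [← CFC.posPart_sub_negPart T hT]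
    abel
  rw [e]
  simp only [_root_.add_apply, inner_add_right, Complex.add_re]
  ring

/-- A self-adjoint operator `T` whose trace is at most zero, and whose quadratic form is bounded
below by that of `-|φ⟩⟨φ|` and by `-c`, has trace norm at most `2 c`. -/
theorem traceNorm_le (hT : IsSelfAdjoint T) (hφ : ‖φ‖ = 1) (hc : 0 ≤ c)
    (h1 : ∀ x, -‖⟪φ, x⟫_ℂ‖ ^ 2 ≤ (⟪x, T x⟫_ℂ).re) (h2 : ∀ x, -(c * ‖x‖ ^ 2) ≤ (⟪x, T x⟫_ℂ).re)
    (h3 : ∀ (k : ℕ) (f : Fin k → E), Orthonormal ℂ f → ∑ j, ‖⟪f j, φ⟫_ℂ‖ ^ 2 = 1 →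
      ∑ j, (⟪f j, T (f j)⟫_ℂ).re ≤ 0) : traceNorm T ≤ ENNReal.ofReal (2 * c) := by
  refine iSup_le fun m => iSup_le fun e => iSup_le fun he => ?_
  obtain ⟨k, f, hf, hfφ, hfe⟩ := exists_orthonormal_extension hφ he
  rw [← ENNReal.ofReal_sum_of_nonneg fun i _ => re_inner_nonneg (CFC.abs_nonneg T) (e i)]
  refine ENNReal.ofReal_le_ofReal ((hfe _ (CFC.abs_nonneg T)).trans ?_)
  simp_rw [inner_abs_eq hT]
  rw [Finset.sum_add_distrib, ← Finset.mul_sum]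
  have h4 := sum_inner_negPart_le hT hc h1 h2 hf
  have h5 := h3 k f hf hfφ
  linarith

end TraceNorm

end

/-! ### Convergence of the reduced density matrix -/

section

variable {V : Measure ℝ} {γ : ℝ} {ψ : ℝ → ℝ} {n : ℕ}

theorem enorm_sq_eq_lintegral_slice (Ψ : ManyParticle (n + 1)) :
    ‖Ψ‖ₑ ^ 2 = ∫⁻ z, ∫⁻ y, ‖Ψ (Fin.cons y z)‖ₑ ^ 2 ∂unitMeasure ∂cubeMeasure n := by
  have h := eLpNorm_comp_measurePreserving (p := 2) (Lp.memLp Ψ).1 (measurePreserving_cons n)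
  rw [Lp.enorm_def, ← h,
    eLpNorm_eq_lintegral_rpow_enorm_toReal two_ne_zero ENNReal.ofNat_ne_top,
    ← ENNReal.rpow_natCast, ← ENNReal.rpow_mul]
  simp only [ENNReal.toReal_ofNat, Nat.cast_ofNat, Function.comp_apply]
  norm_num
  rw [lintegral_prod_symm]
  exact (memLp_cons Ψ).1.enorm.pow_const 2

/-- Bessel's inequality for the slices of `Ψ`: the trace of the reduced density matrix is at most
the number of particles. -/
theorem sum_norm_overlap_sq_le (Ψ : ManyParticle (n + 1)) {ι : Type*} [Fintype ι]
    {f : ι → OneParticle} (hf : Orthonormal ℂ f) : ∑ j, ‖overlap Ψ (f j)‖ ^ 2 ≤ ‖Ψ‖ ^ 2 := by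
  have h1 : ∀ᵐ z ∂cubeMeasure n, ∑ j, ‖overlapFun Ψ (f j) z‖ₑ ^ 2 ≤
      ∫⁻ y, ‖Ψ (Fin.cons y z)‖ₑ ^ 2 ∂unitMeasure := by
    filter_upwards [ae_memLp_slice Ψ] with z hz
    have h2 : ∀ g : OneParticle, overlapFun Ψ g z = ⟪hz.toLp, g⟫_ℂ := fun g => by
      rw [overlapFun, L2.inner_def]
      refine integral_congr_ae ?_
      filter_upwards [hz.coeFn_toLp] with y hy
      rw [hy, RCLike.inner_apply, mul_comm]
    have h3 := hf.sum_inner_products_le hz.toLp (s := Finset.univ)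
    rw [lintegral_enorm_sq hz, ← norm_toLp_sq hz]
    refine le_trans (le_of_eq ?_) (ENNReal.ofReal_le_ofReal h3)
    rw [ENNReal.ofReal_sum_of_nonneg fun _ _ => by positivity]
    refine Finset.sum_congr rfl fun j _ => ?_
    rw [h2, ENNReal.ofReal_pow (norm_nonneg _), norm_inner_symm, ofReal_norm]
  have h2 := lintegral_mono_ae h1
  rw [lintegral_finsetSum' _ fun j _ =>
      (aestronglyMeasurable_overlapFun Ψ (f j)).enorm.pow_const 2,
    ← enorm_sq_eq_lintegral_slice] at h2
  have h3 : ∀ j, ∫⁻ z, ‖overlapFun Ψ (f j) z‖ₑ ^ 2 ∂cubeMeasure n =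
      ENNReal.ofReal (‖overlap Ψ (f j)‖ ^ 2) := fun j => by
    rw [lintegral_enorm_sq (memLp_overlapFun _ _), ← norm_toLp_sq (memLp_overlapFun _ _)]
    rfl
  simp_rw [h3] at h2
  rw [← ENNReal.ofReal_sum_of_nonneg fun _ _ => by positivity, ← ofReal_norm,
    ← ENNReal.ofReal_pow (norm_nonneg _), ENNReal.ofReal_le_ofReal_iff (by positivity)] at h2
  exact h2

/-- States orthogonal to the condensate have a small occupancy. -/
theorem norm_overlap_sq_le_of_orthogonal {Ψ : ManyParticle (n + 1)} (hΨ : ‖Ψ‖ = 1)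
    {φ y : OneParticle} (hφ : ‖φ‖ = 1) (hy : ⟪φ, y⟫_ℂ = 0) :
    ‖overlap Ψ y‖ ^ 2 ≤ (1 - ‖overlap Ψ φ‖ ^ 2) * ‖y‖ ^ 2 := by
  by_cases hy0 : y = 0
  · simp [hy0]
  have hyn : ‖y‖ ≠ 0 := norm_ne_zero_iff.2 hy0
  set u : OneParticle := ((‖y‖⁻¹ : ℝ) : ℂ) • y with hu
  have hun : ‖u‖ = 1 := by
    rw [hu, norm_smul, Complex.norm_real, norm_inv, norm_norm, inv_mul_cancel₀ hyn]
  have hφu : ⟪φ, u⟫_ℂ = 0 := by rw [hu, inner_smul_right, hy, mul_zero]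
  have ho : Orthonormal ℂ ![φ, u] := by
    refine ⟨fun i => ?_, fun i j hij => ?_⟩
    · fin_cases i
      · exact hφ
      · exact hun
    · fin_cases i <;> fin_cases j
      · exact absurd rfl hij
      · exact hφu
      · exact inner_eq_zero_symm.1 hφu
      · exact absurd rfl hij
  have h1 := sum_norm_overlap_sq_le Ψ ho
  rw [Fin.sum_univ_two, hΨ] at h1
  have h2 : ‖overlap Ψ u‖ = ‖y‖⁻¹ * ‖overlap Ψ y‖ := by
    rw [hu, map_smul, norm_smul, Complex.norm_real, norm_inv, norm_norm]
  simp only [Matrix.cons_val_zero, Matrix.cons_val_one, h2] at h1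
  have h3 : ‖overlap Ψ y‖ ^ 2 = (‖y‖⁻¹ * ‖overlap Ψ y‖) ^ 2 * ‖y‖ ^ 2 := by field_simp
  rw [h3]
  exact mul_le_mul_of_nonneg_right (by linarith) (by positivity)

/-- The trace norm distance between the reduced density matrix per particle and the projector on
a state is controlled by the depletion. -/
theorem traceNorm_reducedDensityMatrix_sub_le {Ψ : ManyParticle (n + 1)} (hΨ : ‖Ψ‖ = 1)
    {φ : OneParticle} (hφ : ‖φ‖ = 1) :
    traceNorm (((n + 1 : ℕ) : ℂ)⁻¹ • reducedDensityMatrix Ψ - projector φ) ≤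
      ENNReal.ofReal (2 * ((1 - ‖overlap Ψ φ‖ ^ 2) + 2 * √(1 - ‖overlap Ψ φ‖ ^ 2))) := by
  set K := overlap Ψ with hK
  have hK1 : ‖K φ‖ ≤ 1 := by
    have := norm_overlap_le Ψ φ
    rwa [hΨ, hφ, one_mul] at this
  have hd0 : 0 ≤ 1 - ‖K φ‖ ^ 2 := by
    have := pow_le_one₀ (norm_nonneg (K φ)) hK1 (n := 2)
    linarith
  have hT : ((n + 1 : ℕ) : ℂ)⁻¹ • reducedDensityMatrix Ψ - projector φ =
      (ContinuousLinearMap.adjoint K).comp K - projector φ := by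
    have hn : ((n + 1 : ℕ) : ℂ) ≠ 0 := by exact_mod_cast n.succ_ne_zero
    rw [reducedDensityMatrix, smul_smul, inv_mul_cancel₀ hn, one_smul]
  have hquad : ∀ x, (⟪x, ((ContinuousLinearMap.adjoint K).comp K - projector φ) x⟫_ℂ).re =
      ‖K x‖ ^ 2 - ‖⟪φ, x⟫_ℂ‖ ^ 2 := fun x => by
    have e1 : (⟪x, ⟪φ, x⟫_ℂ • φ⟫_ℂ).re = ‖⟪φ, x⟫_ℂ‖ ^ 2 := by
      rw [inner_smul_right, ← inner_conj_symm x φ, Complex.mul_conj']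
      norm_cast
    rw [_root_.sub_apply, inner_sub_right, Complex.sub_re, ContinuousLinearMap.comp_apply,
      ContinuousLinearMap.adjoint_inner_right, projector, InnerProductSpace.rankOne_apply, e1]
    congr 1
    exact inner_self_eq_norm_sq (𝕜 := ℂ) (K x)
  rw [hT]
  refine traceNorm_le (φ := φ) ?_ hφ (by positivity) (fun x => ?_) (fun x => ?_) fun k f hf hfφ => ?_
  · refine IsSelfAdjoint.sub ?_ ?_
    · exact (ContinuousLinearMap.isPositive_adjoint_comp_self K).isSelfAdjoint
    · rw [ContinuousLinearMap.isSelfAdjoint_iff_isSymmetric]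
      intro x y
      simp only [ContinuousLinearMap.coe_coe, projector, InnerProductSpace.rankOne_apply]
      rw [inner_smul_left, inner_smul_right, inner_conj_symm, mul_comm]
  · rw [hquad]
    linarith [sq_nonneg ‖K x‖]
  · rw [hquad]
    set α := ⟪φ, x⟫_ℂ with hα
    set y := x - α • φ with hy
    have hφφ : ⟪φ, φ⟫_ℂ = 1 := by rw [inner_self_eq_norm_sq_to_K, hφ]; simp
    have hφy : ⟪φ, y⟫_ℂ = 0 := by
      rw [hy, inner_sub_right, inner_smul_right, hφφ, mul_one, sub_self]
    have hxy : x = α • φ + y := by rw [hy, add_sub_cancel]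
    have hpyth : ‖x‖ ^ 2 = ‖α‖ ^ 2 + ‖y‖ ^ 2 := by
      have h1 := norm_add_sq_eq_norm_sq_add_norm_sq_of_inner_eq_zero (𝕜 := ℂ) (α • φ) y (by
        rw [inner_smul_left, hφy, mul_zero])
      rw [← hxy, norm_smul, hφ, mul_one] at h1
      linarith
    have hαx : ‖α‖ ≤ ‖x‖ := (abs_le_of_sq_le_sq' (by linarith [sq_nonneg ‖y‖]) (norm_nonneg x)).2
    have hb : ‖K y‖ ≤ √(1 - ‖K φ‖ ^ 2) * ‖x‖ := by
      refine (abs_le_of_sq_le_sq' ?_ (by positivity)).2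
      rw [mul_pow, Real.sq_sqrt hd0]
      refine (norm_overlap_sq_le_of_orthogonal hΨ hφ hφy).trans ?_
      exact mul_le_mul_of_nonneg_left (by linarith [sq_nonneg ‖α‖]) hd0
    have hKx : ‖α‖ * ‖K φ‖ ≤ ‖K x‖ + ‖K y‖ := by
      have h1 : α • K φ = K x - K y := by rw [hxy, map_add, map_smul, add_sub_cancel_right]
      rw [← norm_smul, h1]
      exact norm_sub_le _ _
    set k := ‖K φ‖ with hk
    have hk0 : 0 ≤ k := norm_nonneg _
    have hαk : ‖α‖ * k ≤ ‖x‖ :=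
      (mul_le_of_le_one_right (norm_nonneg _) hK1).trans hαx
    have h2 : (‖α‖ * k) ^ 2 - 2 * (‖α‖ * k) * ‖K y‖ ≤ ‖K x‖ ^ 2 := by
      have h3 : 0 ≤ ‖α‖ * k := by positivity
      rcases le_total (‖α‖ * k) ‖K y‖ with hc | hc
      · nlinarith [norm_nonneg (K y), sq_nonneg ‖K x‖]
      · have := pow_le_pow_left₀ (sub_nonneg.2 hc) (show ‖α‖ * k - ‖K y‖ ≤ ‖K x‖ by linarith) 2
        nlinarith [sq_nonneg ‖K y‖]
    have h4 : (‖α‖ * k) * ‖K y‖ ≤ ‖x‖ * (√(1 - k ^ 2) * ‖x‖) :=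
      mul_le_mul hαk hb (norm_nonneg _) (norm_nonneg _)
    have h5 : ‖α‖ ^ 2 * (1 - k ^ 2) ≤ ‖x‖ ^ 2 * (1 - k ^ 2) :=
      mul_le_mul_of_nonneg_right (pow_le_pow_left₀ (norm_nonneg _) hαx 2) hd0
    linarith
  · simp_rw [hquad]
    rw [Finset.sum_sub_distrib]
    have h1 := sum_norm_overlap_sq_le Ψ hf
    rw [hΨ, one_pow] at h1
    simp_rw [norm_inner_symm φ, hfφ]
    linarith

/-- If the depletion is at most of order `N^{-1/3}`, then there is complete condensation. -/
theorem tendsto_traceNorm {φ : OneParticle} (hφ : ‖φ‖ = 1) {Ψ : (n : ℕ) → ManyParticle (n + 1)}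
    (hΨ : ∀ n, ‖Ψ n‖ = 1) {D : ℝ}
    (h : ∀ n, 1 - occupancy (reducedDensityMatrix (Ψ n)) φ / ((n + 1 : ℕ) : ℝ) ≤
      D * ((n + 1 : ℕ) : ℝ) ^ (-(1 / 3) : ℝ)) :
    Tendsto (fun n => traceNorm (((n + 1 : ℕ) : ℂ)⁻¹ • reducedDensityMatrix (Ψ n) - projector φ))
      atTop (𝓝 0) := by
  have hocc : ∀ n, occupancy (reducedDensityMatrix (Ψ n)) φ / ((n + 1 : ℕ) : ℝ) =
      ‖overlap (Ψ n) φ‖ ^ 2 := fun n => by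
    have : ((n + 1 : ℕ) : ℝ) ≠ 0 := by positivity
    rw [occupancy_reducedDensityMatrix]
    field_simp
  simp_rw [hocc] at h
  have hr : Tendsto (fun n : ℕ => D * ((n + 1 : ℕ) : ℝ) ^ (-(1 / 3) : ℝ)) atTop (𝓝 0) := by
    have h1 := (tendsto_rpow_neg_atTop (y := 1 / 3) (by norm_num)).comp
      (tendsto_natCast_atTop_atTop.comp (tendsto_add_atTop_nat 1))
    simpa using h1.const_mul D
  have hd : Tendsto (fun n => 1 - ‖overlap (Ψ n) φ‖ ^ 2) atTop (𝓝 0) := by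
    refine squeeze_zero (fun n => ?_) h hr
    have h1 := norm_overlap_le (Ψ n) φ
    rw [hΨ, hφ, one_mul] at h1
    linarith [pow_le_one₀ (norm_nonneg (overlap (Ψ n) φ)) h1 (n := 2)]
  have hc : Tendsto (fun n => ENNReal.ofReal (2 * ((1 - ‖overlap (Ψ n) φ‖ ^ 2) +
      2 * √(1 - ‖overlap (Ψ n) φ‖ ^ 2)))) atTop (𝓝 0) := by
    have h1 := ENNReal.tendsto_ofReal ((hd.add (hd.sqrt.const_mul 2)).const_mul 2)
    simpa using h1
  exact tendsto_of_tendsto_of_tendsto_of_le_of_le tendsto_const_nhds hc (fun _ => zero_le)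
    fun n => traceNorm_reducedDensityMatrix_sub_le (hΨ n) hφ

end

end DisorderedBEC

end

theorem theorem2p2 :
    ∃ C : ℝ, 0 < C ∧
      ∀ (V : Measure ℝ), IsPotential V → ∀ (γ : ℝ), 0 ≤ γ →
      ∀ (ψ : ℝ → ℝ) (hψ : IsGPMinimizer V γ ψ),
        (∃ e₀ e₁ : ℝ,
          IsMeanFieldEigenvalue V γ ψ 0 e₀ ∧ IsMeanFieldEigenvalue V γ ψ 1 e₁ ∧ e₀ < e₁ ∧
          ∀ (n : ℕ) (Ψ : ManyParticle (n + 1)), IsGroundState V γ Ψ →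
            1 - occupancy (reducedDensityMatrix Ψ) hψ.state / ((n + 1 : ℕ) : ℝ) ≤
              C * (e₀ / (e₁ - e₀)) * ((n + 1 : ℕ) : ℝ) ^ (-(1 / 3) : ℝ) * min (√γ) γ) ∧
        ∀ Ψ : (n : ℕ) → ManyParticle (n + 1), (∀ n, IsGroundState V γ (Ψ n)) →
          Tendsto
            (fun n => traceNorm
              (((n + 1 : ℕ) : ℂ)⁻¹ • reducedDensityMatrix (Ψ n) - projector hψ.state))
            atTop (𝓝 0) := by
  refine ⟨32, by norm_num, fun V hV γ hγ ψ hψ => ?_⟩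
  obtain ⟨e₁, h0, h1, he, he4, hgap⟩ := hψ.exists_gap hV hγ
  refine ⟨⟨hψ.energy hV hγ, e₁, h0, h1, he, fun n Ψ hΨ => hΨ.depletion_le hV hγ hψ he he4 hgap⟩,
    fun Ψ hΨ => ?_⟩
  refine tendsto_traceNorm (hψ.norm_state hV hγ) (fun n => (hΨ n).normalized)
    (D := 32 * (hψ.energy hV hγ / (e₁ - hψ.energy hV hγ)) * min (√γ) γ) fun n => ?_
  refine ((hΨ n).depletion_le hV hγ hψ he he4 hgap).trans (le_of_eq ?_)
  ring
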